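/- **Setting.** Let $p,q,k\ge 0$ be integers, $\Theta\subset\mathbb R^p$ a neighbourhood of $\theta_0$, $f\in\mathbb R^p$ fixed, and $\theta_n=\theta_0+n^{-1/2}f$. Let $g:\mathbb R^k\times\mathbb R^p\to\mathbb R^p$ be an estimating function, measurable in its first argument, with Jacobian $G_x(\theta)=\partial g(x,\theta)/\partial\theta^T$, and let $c:\mathbb R^p\to\mathbb R^q$ have Jacobian $C(\theta)$. For each $n$ let $X_{n,1},\dots,X_{n,n}$ be i.i.d. random vectors in $\mathbb R^k$ with law $F_n$, and let $F$ be a probability law on $\mathbb R^k$. **Empirical likelihood.** For a sample $x_1,\dots,x_n$ and a parameter $\theta$ let $t(\theta)\in\mathbb R^p$ satisfy $1+t(\theta)^Tg(x_i,\theta)>0$ for all $i$ and $\frac1n\sum_{i}\frac{g(x_i,\theta)}{1+t(\theta)^Tg(x_i,\theta)}=0$. Put $\ell_{E,n}(\theta)=-\sum_{i}\log(1+t(\theta)^Tg(x_i,\theta))$, with value $-\infty$ if no such $t(\theta)$ exists, and $$D_\phi(F_n^{\mathrm{emp}},F_{n,\theta})=\frac1n\sum_{i=1}^n\frac{\phi\big(1+t(\theta)^Tg(x_i,\theta)\big)}{1+t(\theta)^Tg(x_i,\theta)},$$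 $$T_n^\phi(\theta_1,\theta_2)=\frac{2n}{\phi''(1)}\Big(D_\phi(F_n^{\mathrm{emp}},F_{n,\theta_2})-D_\phi(F_n^{\mathrm{emp}},F_{n,\theta_1})\Big),$$ where $\phi$ is convex on $(0,\infty)$, twice differentiable at $1$, $\phi(1)=\phi'(1)=0$ and $\phi''(1)>0$. Let $\rho_n\to0$ with $\sqrt n\,\rho_n\to\infty$ (for example $\rho_n=n^{-1/3}$). With probability tending to one, $\widehat\theta_{E,n}$ maximizes $\ell_{E,n}$ over $\{\theta\in\Theta:\|\theta-\theta_0\|\le\rho_n\}$ and $\widetilde\theta_{E,n}$ maximizes $\ell_{E,n}$ over $\{\theta\in\Theta:\|\theta-\theta_0\|\le\rho_n,\ c(\theta)=0\}$, both with finite maximum; $\widehat\theta_{E,n}$, $\widetilde\theta_{E,n}$ and the statistic are random variables. (Consistent maximizers over all of $\Theta$ are of this form for some $\rho_n$.) **Assumptions.** 1. $E_F[g(X,\theta_0)]=0$; $S_{11}=E_F[g(X,\theta_0)g(X,\theta_0)^T]$ is positive definite and $S_{12}=E_F[G_X(\theta_0)]$ has rank $p$. 2. In a neighbourhood of $\theta_0$,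 the same for all $x$, $g(x,\cdot)$ is twice continuously differentiable. 3. In a neighbourhood of $\theta_0$, each of $\|g(x,\theta)\|^3$, $\|G_x(\theta)\|$ and $\|\partial G_x(\theta)/\partial\theta\|$ is bounded by a function $K(x)$ that is integrable under $F$ and, for large $n$, under $F_n$, with $E_{F_n}[K(X)]\to E_F[K(X)]$. 4. $c(\theta_0)=0$, $\mathrm{rank}\,C(\theta_0)=q$, and in a neighbourhood of $\theta_0$ the maps $c$ and $C$ are differentiable and $\|\partial C(\theta)/\partial\theta\|$ is bounded by a constant. 5. ($H_{1,n}$) $E_{F_n}[g(X,\theta_n)]=0$ for all $n\ge1$, and $F_n(A)\to F(A)$ for every Borel set $A$ (which holds, for instance, if the laws $F_n^{\otimes n}$ are contiguous to $F^{\otimes n}$). **Conclusion.** Let $V=(S_{12}^TS_{11}^{-1}S_{12})^{-1}$ and $Q=(C(\theta_0)VC(\theta_0)^T)^{-1}$. Then $$T_n^\phi(\widehat\theta_{E,n},\widetilde\theta_{E,n})\ \longrightarrow\ \chi^2_q\big(f^TC(\theta_0)^TQ\,C(\theta_0)f\big)\quad\text{in law},$$ where $\chi^2_q(\delta)$ is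 the law of $\sum_{j=1}^q Z_j^2$ for independent $Z_j\sim\mathcal N(\mu_j,1)$ with $\sum_j\mu_j^2=\delta$. -/

import Mathlib

open MeasureTheory ProbabilityTheory Filter Topology

noncomputable section

/-- The noncentral chi-squared law with `q` degrees of freedom and noncentrality `δ ≥ 0`: the law of
`∑ j, Z j ^ 2` for independent `Z j` with unit variance and means `√(δ / q)`, so that the squares of
the `q` means add up to `δ`. For `q = 0` it is the point mass at `0`. -/
def noncentralChiSq (q : ℕ) (δ : ℝ) : Measure ℝ :=
  (Measure.pi (fun _ : Fin q => gaussianReal (Real.sqrt (δ / q)) 1)).map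
    (fun z => ∑ j, z j ^ 2)

instance isProbabilityMeasure_noncentralChiSq (q : ℕ) (δ : ℝ) :
    IsProbabilityMeasure (noncentralChiSq q δ) :=
  Measure.isProbabilityMeasure_map (Measurable.aemeasurable (by fun_prop))

/-! ### Empirical likelihood

Below `y : Fin n → ℝ^r` stands for the values `g (x i) θ`, `i < n`, of the estimating function at
the sample `x` and at a parameter value `θ`. -/

/-- The weights `p i = n⁻¹ (1 + tᵀ y i)⁻¹`. -/
def elWeight {r n : ℕ} (y : Fin n → EuclideanSpace ℝ (Fin r)) (t : EuclideanSpace ℝ (Fin r))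
    (i : Fin n) : ℝ :=
  (n : ℝ)⁻¹ * (1 + inner ℝ t (y i))⁻¹

/-- `t` is a Lagrange multiplier of the empirical likelihood problem at `y`: the weights are
positive and `∑ i, p i • y i = 0`. (For `n ≥ 1` it follows that the weights add up to one.) -/
def IsELMultiplier {r n : ℕ} (y : Fin n → EuclideanSpace ℝ (Fin r))
    (t : EuclideanSpace ℝ (Fin r)) : Prop :=
  (∀ i, 0 < 1 + inner ℝ t (y i)) ∧ ∑ i, elWeight y t i • y i = 0

open Classical in
/-- The multiplier `t(θ)`. If one exists, the numbers `tᵀ y i`, and with them everything defined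
below, do not depend on which one is chosen. -/
def elMultiplier {r n : ℕ} (y : Fin n → EuclideanSpace ℝ (Fin r)) : EuclideanSpace ℝ (Fin r) :=
  if h : ∃ t, IsELMultiplier y t then h.choose else 0

open Classical in
/-- The kernel `- ∑ i, log (1 + t(θ)ᵀ g (x i) θ)` of the empirical log-likelihood; it is `-∞` where
the restrictions cannot be met with positive weights. -/
def elLogLik {r n : ℕ} (y : Fin n → EuclideanSpace ℝ (Fin r)) : EReal :=
  if ∃ t, IsELMultiplier y t then
    ((-∑ i, Real.log (1 + inner ℝ (elMultiplier y) (y i)) : ℝ) : EReal)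
  else ⊥

/-- The divergence `D_φ(F_n, F_{n,θ})` between the empirical distribution and its empirical
likelihood version at `θ`. -/
def elPhiDiv {r n : ℕ} (φ : ℝ → ℝ) (y : Fin n → EuclideanSpace ℝ (Fin r)) : ℝ :=
  (n : ℝ)⁻¹ * ∑ i, (1 + inner ℝ (elMultiplier y) (y i))⁻¹ *
    φ (1 + inner ℝ (elMultiplier y) (y i))

/-- The empirical `φ`-divergence test statistic
`T_n^φ(θ₁, θ₂) = (2 n / φ''(1)) (D_φ(F_n, F_{n,θ₂}) - D_φ(F_n, F_{n,θ₁}))` of the sample `x`. -/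
def elPhiStat {k p r n : ℕ} (φ : ℝ → ℝ)
    (g : EuclideanSpace ℝ (Fin k) → EuclideanSpace ℝ (Fin p) → EuclideanSpace ℝ (Fin r))
    (x : Fin n → EuclideanSpace ℝ (Fin k)) (θ₁ θ₂ : EuclideanSpace ℝ (Fin p)) : ℝ :=
  2 * n / deriv (deriv φ) 1 *
    (elPhiDiv φ (fun i => g (x i) θ₂) - elPhiDiv φ (fun i => g (x i) θ₁))

/-- `θ` maximizes the empirical log-likelihood of the sample `x` over the set `A`, with a maximum
that is not `-∞`. -/
def IsELMaximizer {k p r n : ℕ}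
    (g : EuclideanSpace ℝ (Fin k) → EuclideanSpace ℝ (Fin p) → EuclideanSpace ℝ (Fin r))
    (x : Fin n → EuclideanSpace ℝ (Fin k)) (A : Set (EuclideanSpace ℝ (Fin p)))
    (θ : EuclideanSpace ℝ (Fin p)) : Prop :=
  θ ∈ A ∧ elLogLik (fun i => g (x i) θ) ≠ ⊥ ∧ IsMaxOn (fun θ' => elLogLik (fun i => g (x i) θ')) A θ

/-- The class `Φ` of divergence generators: convex on `(0, ∞)`, twice differentiable at `1`, with
`φ(1) = φ'(1) = 0` and `φ''(1) > 0`. -/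
structure IsDivGenerator (φ : ℝ → ℝ) : Prop where
  convexOn : ConvexOn ℝ (Set.Ioi 0) φ
  map_one : φ 1 = 0
  differentiableAt : ∀ᶠ x in 𝓝 (1 : ℝ), DifferentiableAt ℝ φ x
  deriv_one : deriv φ 1 = 0
  differentiableAt_deriv : DifferentiableAt ℝ (deriv φ) 1
  deriv_deriv_one_pos : 0 < deriv (deriv φ) 1

/-! ### Limit matrices -/

/-- `S₁₁(θ) = E[g(X, θ) g(X, θ)ᵀ]` for `X` with law `F`. -/
def matS11 {k p r : ℕ}
    (g : EuclideanSpace ℝ (Fin k) → EuclideanSpace ℝ (Fin p) → EuclideanSpace ℝ (Fin r))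
    (F : Measure (EuclideanSpace ℝ (Fin k))) (θ : EuclideanSpace ℝ (Fin p)) :
    Matrix (Fin r) (Fin r) ℝ :=
  Matrix.of fun i j => ∫ x, g x θ i * g x θ j ∂F

/-- The Jacobian matrix of `h` at `θ`. -/
def jacobian {p m : ℕ} (h : EuclideanSpace ℝ (Fin p) → EuclideanSpace ℝ (Fin m))
    (θ : EuclideanSpace ℝ (Fin p)) : Matrix (Fin m) (Fin p) ℝ :=
  Matrix.of fun i j => fderiv ℝ h θ (EuclideanSpace.single j 1) i

/-- `S₁₂(θ) = E[G_X(θ)]`, with `G_x(θ)` the Jacobian matrix of `g x` at `θ`, for `X` with law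
`F`. -/
def matS12 {k p r : ℕ}
    (g : EuclideanSpace ℝ (Fin k) → EuclideanSpace ℝ (Fin p) → EuclideanSpace ℝ (Fin r))
    (F : Measure (EuclideanSpace ℝ (Fin k))) (θ : EuclideanSpace ℝ (Fin p)) :
    Matrix (Fin r) (Fin p) ℝ :=
  Matrix.of fun i j => ∫ x, jacobian (g x) θ i j ∂F

/-- `V(θ) = (S₁₂(θ)ᵀ S₁₁(θ)⁻¹ S₁₂(θ))⁻¹`. -/
def matV {k p r : ℕ}
    (g : EuclideanSpace ℝ (Fin k) → EuclideanSpace ℝ (Fin p) → EuclideanSpace ℝ (Fin r))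
    (F : Measure (EuclideanSpace ℝ (Fin k))) (θ : EuclideanSpace ℝ (Fin p)) :
    Matrix (Fin p) (Fin p) ℝ :=
  ((matS12 g F θ).transpose * (matS11 g F θ)⁻¹ * matS12 g F θ)⁻¹

/-- `Q(θ) = (C(θ) V(θ) C(θ)ᵀ)⁻¹`, with `C` the Jacobian matrix of `c`. -/
def matQ {k p r q : ℕ}
    (g : EuclideanSpace ℝ (Fin k) → EuclideanSpace ℝ (Fin p) → EuclideanSpace ℝ (Fin r))
    (c : EuclideanSpace ℝ (Fin p) → EuclideanSpace ℝ (Fin q))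
    (F : Measure (EuclideanSpace ℝ (Fin k))) (θ : EuclideanSpace ℝ (Fin p)) :
    Matrix (Fin q) (Fin q) ℝ :=
  (jacobian c θ * matV g F θ * (jacobian c θ).transpose)⁻¹

/-! ### Regularity conditions -/

/-- In a neighbourhood of `θ₀`, `h x θ` is bounded by a function `K x` that is integrable under
`F₀` and under the laws `F n` (for large `n`), with `E_{F n}[K] → E_{F₀}[K]`. For a constant
sequence `F n = F₀` this is domination by an integrable function. -/
def LocallyDominated {k p : ℕ} (F : ℕ → Measure (EuclideanSpace ℝ (Fin k)))
    (F₀ : Measure (EuclideanSpace ℝ (Fin k))) (θ₀ : EuclideanSpace ℝ (Fin p))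
    (h : EuclideanSpace ℝ (Fin k) → EuclideanSpace ℝ (Fin p) → ℝ) : Prop :=
  ∃ K : EuclideanSpace ℝ (Fin k) → ℝ, Measurable K ∧ Integrable K F₀ ∧
    (∀ᶠ n in atTop, Integrable K (F n)) ∧
    Tendsto (fun n => ∫ x, K x ∂(F n)) atTop (𝓝 (∫ x, K x ∂F₀)) ∧
    ∀ᶠ θ in 𝓝 θ₀, ∀ x, h x θ ≤ K x

/-- The regularity conditions on the estimating function `g`, with true parameter `θ₀` under `F₀`. -/
structure ELRegular {k p r : ℕ}
    (g : EuclideanSpace ℝ (Fin k) → EuclideanSpace ℝ (Fin p) → EuclideanSpace ℝ (Fin r))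
    (F : ℕ → Measure (EuclideanSpace ℝ (Fin k)))
    (F₀ : Measure (EuclideanSpace ℝ (Fin k))) (θ₀ : EuclideanSpace ℝ (Fin p)) : Prop where
  measurable : ∀ θ, Measurable fun x => g x θ
  integral_eq_zero : ∫ x, g x θ₀ ∂F₀ = 0
  posDef : (matS11 g F₀ θ₀).PosDef
  rank_eq : (matS12 g F₀ θ₀).rank = p
  /-- For all `x`, the first and second derivatives of `g x` exist and are continuous in one
  neighbourhood of `θ₀`. -/
  contDiffAt : ∀ᶠ θ in 𝓝 θ₀, ∀ x, ContDiffAt ℝ 2 (g x) θ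
  dominated_g : LocallyDominated F F₀ θ₀ fun x θ => ‖g x θ‖ ^ 3
  dominated_deriv : LocallyDominated F F₀ θ₀ fun x θ => ‖fderiv ℝ (g x) θ‖
  dominated_deriv_deriv :
    LocallyDominated F F₀ θ₀ fun x θ => ‖fderiv ℝ (fderiv ℝ (g x)) θ‖

/-- The conditions on the constraint function `c` at a point `θ₀` of the null hypothesis. -/
structure ConstraintRegular {p q : ℕ}
    (c : EuclideanSpace ℝ (Fin p) → EuclideanSpace ℝ (Fin q))
    (θ₀ : EuclideanSpace ℝ (Fin p)) : Prop where
  map_eq_zero : c θ₀ = 0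
  differentiableAt : ∀ᶠ θ in 𝓝 θ₀, DifferentiableAt ℝ c θ
  differentiableAt_fderiv : ∀ᶠ θ in 𝓝 θ₀, DifferentiableAt ℝ (fderiv ℝ c) θ
  bounded : ∃ M : ℝ, ∀ᶠ θ in 𝓝 θ₀, ‖fderiv ℝ (fderiv ℝ c) θ‖ ≤ M
  rank_eq : (jacobian c θ₀).rank = q

end

noncomputable section

/-! ### Sample averages -/

/-- The average of a finite family of vectors. -/
def sampleMean {n : ℕ} {V : Type*} [AddCommGroup V] [Module ℝ V] (y : Fin n → V) : V :=
  (n : ℝ)⁻¹ • ∑ i, y i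

/-- The second moment operator `v ↦ n⁻¹ ∑ i, ⟪y i, v⟫ y i` of a finite family of vectors. -/
def sampleGram {n : ℕ} {V : Type*} [NormedAddCommGroup V] [InnerProductSpace ℝ V]
    (y : Fin n → V) : V →L[ℝ] V :=
  sampleMean fun i => InnerProductSpace.rankOne ℝ (y i) (y i)

section Averages

variable {n : ℕ} {V : Type*} [NormedAddCommGroup V] [InnerProductSpace ℝ V]

theorem natCast_smul_sampleMean {V : Type*} [AddCommGroup V] [Module ℝ V] (y : Fin n → V) :
    (n : ℝ) • sampleMean y = ∑ i, y i := by
  rcases Nat.eq_zero_or_pos n with rfl | hn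
  · simp [sampleMean]
  · rw [sampleMean, smul_smul, mul_inv_cancel₀ (by positivity), one_smul]

theorem natCast_mul_sampleMean (y : Fin n → ℝ) : (n : ℝ) * sampleMean y = ∑ i, y i :=
  natCast_smul_sampleMean y

theorem norm_sampleMean_le {V : Type*} [NormedAddCommGroup V] [NormedSpace ℝ V] (y : Fin n → V) :
    ‖sampleMean y‖ ≤ sampleMean fun i => ‖y i‖ := by
  rw [sampleMean, sampleMean, norm_smul, norm_inv, Real.norm_natCast, smul_eq_mul]
  gcongr
  exact norm_sum_le _ _

theorem sampleMean_mono {y z : Fin n → ℝ} (h : ∀ i, y i ≤ z i) : sampleMean y ≤ sampleMean z := by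
  rw [sampleMean, sampleMean, smul_eq_mul, smul_eq_mul]
  gcongr with i
  exact h i

theorem sampleMean_nonneg {y : Fin n → ℝ} (h : ∀ i, 0 ≤ y i) : 0 ≤ sampleMean y := by
  rw [sampleMean, smul_eq_mul]
  exact mul_nonneg (by positivity) (Finset.sum_nonneg fun i _ => h i)

theorem sampleMean_sub {V : Type*} [AddCommGroup V] [Module ℝ V] (y z : Fin n → V) :
    (sampleMean fun i => y i - z i) = sampleMean y - sampleMean z := by
  simp [sampleMean, smul_sub]

theorem sampleMean_mul_const (y : Fin n → ℝ) (c : ℝ) :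
    (sampleMean fun i => y i * c) = sampleMean y * c := by
  simp [sampleMean, Finset.sum_mul, mul_assoc]

theorem map_sampleMean {V W : Type*} [NormedAddCommGroup V] [NormedSpace ℝ V]
    [NormedAddCommGroup W] [NormedSpace ℝ W] (L : V →L[ℝ] W) (y : Fin n → V) :
    L (sampleMean y) = sampleMean fun i => L (y i) := by
  simp [sampleMean]

theorem sampleGram_apply (y : Fin n → V) (v : V) :
    sampleGram y v = sampleMean fun i => inner ℝ (y i) v • y i := by
  simp [sampleGram, sampleMean]

theorem natCast_mul_inner_sampleGram (y : Fin n → V) (v : V) :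
    (n : ℝ) * inner ℝ v (sampleGram y v) = ∑ i, inner ℝ v (y i) ^ 2 := by
  rw [← inner_smul_right, sampleGram_apply, natCast_smul_sampleMean, inner_sum]
  exact Finset.sum_congr rfl fun i _ => by
    rw [inner_smul_right, real_inner_comm, sq]

theorem natCast_mul_inner_sampleMean (y : Fin n → V) (v : V) :
    (n : ℝ) * inner ℝ v (sampleMean y) = ∑ i, inner ℝ v (y i) := by
  rw [← inner_smul_right, natCast_smul_sampleMean, inner_sum]

theorem norm_pow_three_le_sum {V : Type*} [NormedAddCommGroup V] (y : Fin n → V) (i : Fin n) :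
    ‖y i‖ ^ 3 ≤ n * sampleMean fun i => ‖y i‖ ^ 3 := by
  rw [natCast_mul_sampleMean]
  exact Finset.single_le_sum (f := fun i => ‖y i‖ ^ 3) (fun _ _ => by positivity)
    (Finset.mem_univ i)

end Averages

/-! ### The Lagrange multiplier -/

section Multiplier

variable {r n : ℕ} {y : Fin n → EuclideanSpace ℝ (Fin r)} {t s : EuclideanSpace ℝ (Fin r)}

theorem isELMultiplier_iff : IsELMultiplier y t ↔
    (∀ i, 0 < 1 + inner ℝ t (y i)) ∧ ∑ i, (1 + inner ℝ t (y i))⁻¹ • y i = 0 := by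
  rcases Nat.eq_zero_or_pos n with rfl | hn
  · simp [IsELMultiplier]
  · have : (n : ℝ)⁻¹ ≠ 0 := by positivity
    simp [IsELMultiplier, elWeight, mul_smul, ← Finset.smul_sum, this]

theorem IsELMultiplier.sum_inner (h : IsELMultiplier y t) (v : EuclideanSpace ℝ (Fin r)) :
    ∑ i, (1 + inner ℝ t (y i))⁻¹ * inner ℝ v (y i) = 0 := by
  have := congrArg (inner ℝ v) (isELMultiplier_iff.1 h).2
  simpa [inner_sum, inner_smul_right] using this

theorem IsELMultiplier.inner_eq (ht : IsELMultiplier y t) (hs : IsELMultiplier y s) (i : Fin n) :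
    inner ℝ t (y i) = inner ℝ s (y i) := by
  have h1 := ht.sum_inner (s - t)
  have h2 := hs.sum_inner (s - t)
  have h3 : ∑ i, (inner ℝ s (y i) - inner ℝ t (y i)) ^ 2 *
      ((1 + inner ℝ t (y i))⁻¹ * (1 + inner ℝ s (y i))⁻¹) = 0 := by
    rw [← sub_zero (0 : ℝ)]
    nth_rewrite 1 [← h1]
    rw [← h2, ← Finset.sum_sub_distrib]
    refine Finset.sum_congr rfl fun i _ => ?_
    have := (ht.1 i).ne'
    have := (hs.1 i).ne'
    rw [inner_sub_left]
    field_simp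
    ring
  have h4 := (Finset.sum_eq_zero_iff_of_nonneg fun i _ => by
    have := ht.1 i
    have := hs.1 i
    positivity).1 h3 i (Finset.mem_univ i)
  have := ht.1 i
  have := hs.1 i
  have h5 : (inner ℝ s (y i) - inner ℝ t (y i)) ^ 2 = 0 :=
    (mul_eq_zero.1 h4).resolve_right (by positivity)
  nlinarith [pow_eq_zero_iff (two_ne_zero) |>.1 h5]

theorem IsELMultiplier.sum_log_le (ht : IsELMultiplier y t) (hs : ∀ i, 0 < 1 + inner ℝ s (y i)) :
    ∑ i, Real.log (1 + inner ℝ s (y i)) ≤ ∑ i, Real.log (1 + inner ℝ t (y i)) := by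
  have h1 := ht.sum_inner (s - t)
  have h2 : ∀ i, Real.log (1 + inner ℝ s (y i)) ≤ Real.log (1 + inner ℝ t (y i)) +
      (1 + inner ℝ t (y i))⁻¹ * inner ℝ (s - t) (y i) := by
    intro i
    have a := ht.1 i
    have b := hs i
    have h := Real.log_le_sub_one_of_pos (div_pos b a)
    rw [Real.log_div b.ne' a.ne'] at h
    have : (1 + inner ℝ t (y i))⁻¹ * inner ℝ (s - t) (y i) =
        (1 + inner ℝ s (y i)) / (1 + inner ℝ t (y i)) - 1 := by
      rw [inner_sub_left]
      field_simp
      ring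
    linarith
  calc _ ≤ ∑ i, (Real.log (1 + inner ℝ t (y i)) +
      (1 + inner ℝ t (y i))⁻¹ * inner ℝ (s - t) (y i)) := Finset.sum_le_sum fun i _ => h2 i
    _ = _ := by rw [Finset.sum_add_distrib, h1, add_zero]

theorem isELMultiplier_elMultiplier (h : ∃ t, IsELMultiplier y t) :
    IsELMultiplier y (elMultiplier y) := by
  rw [elMultiplier, dif_pos h]
  exact h.choose_spec

theorem IsELMultiplier.elLogLik_eq (ht : IsELMultiplier y t) :
    elLogLik y = ((-∑ i, Real.log (1 + inner ℝ t (y i)) : ℝ) : EReal) := by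
  rw [elLogLik, if_pos ⟨t, ht⟩]
  simp_rw [(isELMultiplier_elMultiplier ⟨t, ht⟩).inner_eq ht]

theorem IsELMultiplier.elPhiDiv_eq (ht : IsELMultiplier y t) (φ : ℝ → ℝ) :
    elPhiDiv φ y = (n : ℝ)⁻¹ * ∑ i, (1 + inner ℝ t (y i))⁻¹ * φ (1 + inner ℝ t (y i)) := by
  rw [elPhiDiv]
  simp_rw [(isELMultiplier_elMultiplier ⟨t, ht⟩).inner_eq ht]

theorem exists_isELMultiplier_of_elLogLik_ne_bot (h : elLogLik y ≠ ⊥) :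
    ∃ t, IsELMultiplier y t := by
  by_contra h'
  exact h (by rw [elLogLik, if_neg h'])

theorem exists_isELMultiplier {R : ℝ} (hR : 0 ≤ R) (hpos : ∀ i, R * ‖y i‖ < 1)
    (hneg : ∀ t, ‖t‖ = R → ∑ i, Real.log (1 + inner ℝ t (y i)) < 0) :
    ∃ t, ‖t‖ ≤ R ∧ IsELMultiplier y t := by
  have hposm : ∀ t, ‖t‖ ≤ R → ∀ i, 0 < 1 + inner ℝ t (y i) := by
    intro t ht i
    have h1 := abs_real_inner_le_norm t (y i)
    have h2 : ‖t‖ * ‖y i‖ ≤ R * ‖y i‖ := by gcongr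
    linarith [neg_abs_le (inner ℝ t (y i)), hpos i]
  have hcont : ContinuousOn (fun t => ∑ i, Real.log (1 + inner ℝ t (y i)))
      (Metric.closedBall 0 R) := by
    refine continuousOn_finsetSum _ fun i _ => ContinuousOn.log (by fun_prop) fun t ht => ?_
    exact (hposm t (by simpa using ht) i).ne'
  obtain ⟨t, ht, hmax⟩ := (isCompact_closedBall (0 : EuclideanSpace ℝ (Fin r)) R).exists_isMaxOn
    ⟨0, by simpa using hR⟩ hcont
  have htR : ‖t‖ ≤ R := by simpa using ht
  have h0 : 0 ≤ ∑ i, Real.log (1 + inner ℝ t (y i)) := by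
    simpa using hmax (by simpa using hR : (0 : EuclideanSpace ℝ (Fin r)) ∈ Metric.closedBall 0 R)
  have hlt : ‖t‖ < R := lt_of_le_of_ne htR fun h => (hneg t h).not_ge h0
  refine ⟨t, htR, isELMultiplier_iff.2 ⟨hposm t htR, ?_⟩⟩
  refine ext_inner_left ℝ fun v => ?_
  rw [inner_sum, inner_zero_right]
  have hloc : IsLocalMax (fun a : ℝ => ∑ i, Real.log (1 + inner ℝ (t + a • v) (y i))) 0 := by
    have hc : Tendsto (fun a : ℝ => t + a • v) (𝓝 0) (𝓝 t) := by
      have : Continuous (fun a : ℝ => t + a • v) := by fun_prop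
      simpa using this.tendsto 0
    have hb : Metric.closedBall (0 : EuclideanSpace ℝ (Fin r)) R ∈ 𝓝 t :=
      Filter.mem_of_superset (Metric.isOpen_ball.mem_nhds (by simpa using hlt))
        Metric.ball_subset_closedBall
    filter_upwards [hc hb] with a ha
    simpa using hmax ha
  have hder : HasDerivAt (fun a : ℝ => ∑ i, Real.log (1 + inner ℝ (t + a • v) (y i)))
      (∑ i, inner ℝ v (y i) / (1 + inner ℝ (t + (0 : ℝ) • v) (y i))) 0 := by
    refine HasDerivAt.fun_sum fun i _ => HasDerivAt.log ?_ ?_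
    · have h : HasDerivAt (fun a : ℝ => 1 + (inner ℝ t (y i) + a * inner ℝ v (y i)))
          (inner ℝ v (y i)) 0 := by
        simpa using (((hasDerivAt_id (0 : ℝ)).mul_const (inner ℝ v (y i))).const_add
          (inner ℝ t (y i))).const_add 1
      simpa [inner_add_left, inner_smul_left] using h
    · simpa using (hposm t htR i).ne'
  have := hloc.hasDerivAt_eq_zero hder
  rw [← this]
  refine Finset.sum_congr rfl fun i _ => ?_
  rw [inner_smul_right, zero_smul, add_zero]
  ring

end Multiplier

/-! ### Expansions of the dual problem -/

section Expansion

variable {r n : ℕ} {y : Fin n → EuclideanSpace ℝ (Fin r)} {t : EuclideanSpace ℝ (Fin r)} {M : ℝ}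

theorem abs_log_one_add_sub_le {x : ℝ} (hx : |x| ≤ 1 / 2) :
    |Real.log (1 + x) - x + x ^ 2 / 2| ≤ 2 * |x| ^ 3 := by
  have h := Real.abs_log_sub_add_sum_range_le (x := -x) (by rw [abs_neg]; linarith) 2
  rw [abs_neg] at h
  calc |Real.log (1 + x) - x + x ^ 2 / 2| ≤ |x| ^ 3 / (1 - |x|) := by
        convert h using 2
        simp [Finset.sum_range_succ]
        ring
    _ ≤ |x| ^ 3 / (1 / 2) := by gcongr; linarith
    _ = 2 * |x| ^ 3 := by ring

theorem abs_inv_one_add_sub_le {x : ℝ} (hx : |x| ≤ 1 / 2) :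
    |1 - x - (1 + x)⁻¹| ≤ 2 * x ^ 2 := by
  have h := (abs_le.1 hx).1
  have h1 : 0 < 1 + x := by linarith
  rw [show 1 - x - (1 + x)⁻¹ = -(x ^ 2 / (1 + x)) by field_simp; ring, abs_neg,
    abs_of_nonneg (by positivity), div_le_iff₀ h1]
  nlinarith [sq_nonneg x]

theorem norm_mul_norm_le_of_pow_three {δ : ℝ} (hδ : 0 ≤ δ)
    (hM : (sampleMean fun i => ‖y i‖ ^ 3) ≤ M) (ht : ‖t‖ ^ 3 * (n * M) ≤ δ ^ 3) (i : Fin n) :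
    ‖t‖ * ‖y i‖ ≤ δ := by
  refine le_of_pow_le_pow_left₀ three_ne_zero hδ (le_trans ?_ ht)
  rw [mul_pow]
  gcongr
  exact (norm_pow_three_le_sum y i).trans (by gcongr)

theorem abs_inner_le_of_pow_three {δ : ℝ} (hδ : 0 ≤ δ)
    (hM : (sampleMean fun i => ‖y i‖ ^ 3) ≤ M) (ht : ‖t‖ ^ 3 * (n * M) ≤ δ ^ 3) (i : Fin n) :
    |inner ℝ t (y i)| ≤ δ :=
  (abs_real_inner_le_norm t (y i)).trans (norm_mul_norm_le_of_pow_three hδ hM ht i)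

theorem abs_sum_log_sub_le (hM : (sampleMean fun i => ‖y i‖ ^ 3) ≤ M)
    (ht : ‖t‖ ^ 3 * (n * M) ≤ (1 / 2) ^ 3) :
    |∑ i, Real.log (1 + inner ℝ t (y i)) - n * inner ℝ t (sampleMean y)
      + n * inner ℝ t (sampleGram y t) / 2| ≤ 2 * (‖t‖ ^ 3 * (n * M)) := by
  have hx := abs_inner_le_of_pow_three (by norm_num) hM ht
  rw [natCast_mul_inner_sampleMean, natCast_mul_inner_sampleGram, Finset.sum_div,
    ← Finset.sum_sub_distrib, ← Finset.sum_add_distrib]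
  calc _ ≤ ∑ i, |Real.log (1 + inner ℝ t (y i)) - inner ℝ t (y i) + inner ℝ t (y i) ^ 2 / 2| :=
        Finset.abs_sum_le_sum_abs _ _
    _ ≤ ∑ i, 2 * (‖t‖ ^ 3 * ‖y i‖ ^ 3) := by
        refine Finset.sum_le_sum fun i _ => (abs_log_one_add_sub_le (hx i)).trans ?_
        rw [← mul_pow]
        gcongr
        exact abs_real_inner_le_norm t (y i)
    _ = 2 * (‖t‖ ^ 3 * (n * sampleMean fun i => ‖y i‖ ^ 3)) := by
        rw [natCast_mul_sampleMean, ← Finset.mul_sum, ← Finset.mul_sum]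
    _ ≤ _ := by gcongr

theorem IsELMultiplier.norm_sub_le (h : IsELMultiplier y t)
    (hM : (sampleMean fun i => ‖y i‖ ^ 3) ≤ M) (ht : ‖t‖ ^ 3 * (n * M) ≤ (1 / 2) ^ 3) :
    ‖(n : ℝ) • (sampleMean y - sampleGram y t)‖ ≤ 2 * (‖t‖ ^ 2 * (n * M)) := by
  have hx := abs_inner_le_of_pow_three (by norm_num) hM ht
  have h1 : (n : ℝ) • (sampleMean y - sampleGram y t) =
      ∑ i, (1 - inner ℝ t (y i) - (1 + inner ℝ t (y i))⁻¹) • y i := by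
    rw [smul_sub, sampleGram_apply, natCast_smul_sampleMean, natCast_smul_sampleMean]
    simp_rw [sub_smul, Finset.sum_sub_distrib, (isELMultiplier_iff.1 h).2, one_smul, sub_zero,
      real_inner_comm]
  rw [h1]
  calc _ ≤ ∑ i, 2 * (‖t‖ ^ 2 * ‖y i‖ ^ 3) := by
        refine norm_sum_le_of_le _ fun i _ => ?_
        rw [norm_smul, Real.norm_eq_abs]
        calc _ ≤ 2 * inner ℝ t (y i) ^ 2 * ‖y i‖ := by
              gcongr
              exact abs_inv_one_add_sub_le (hx i)
          _ ≤ 2 * (‖t‖ * ‖y i‖) ^ 2 * ‖y i‖ := by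
              gcongr 2 * ?_ * _
              rw [← sq_abs]
              gcongr
              exact abs_real_inner_le_norm t (y i)
          _ = _ := by ring
    _ = 2 * (‖t‖ ^ 2 * (n * sampleMean fun i => ‖y i‖ ^ 3)) := by
        rw [natCast_mul_sampleMean, ← Finset.mul_sum, ← Finset.mul_sum]
    _ ≤ _ := by gcongr

theorem IsDivGenerator.exists_abs_sub_le {φ : ℝ → ℝ} (hφ : IsDivGenerator φ) {ε : ℝ}
    (hε : 0 < ε) :
    ∃ δ > 0, ∀ x : ℝ, |x| ≤ δ →
      |(1 + x)⁻¹ * φ (1 + x) - deriv (deriv φ) 1 / 2 * x ^ 2| ≤ ε * x ^ 2 := by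
  set a := deriv (deriv φ) 1 with ha
  have ha0 : 0 < a := hφ.deriv_deriv_one_pos
  have h1 := hφ.differentiableAt_deriv.hasDerivAt.isLittleO.def (show 0 < ε / 4 by positivity)
  obtain ⟨η, hη, hball⟩ := Metric.eventually_nhds_iff.1 (h1.and hφ.differentiableAt)
  refine ⟨min (η / 2) (min (1 / 2) (ε / (2 * a))), by positivity, fun x hx => ?_⟩
  have hxη : |x| < η := (hx.trans (min_le_left _ _)).trans_lt (by linarith)
  have hx2 : |x| ≤ 1 / 2 := hx.trans ((min_le_right _ _).trans (min_le_left _ _))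
  have hxa : |x| ≤ ε / (2 * a) := hx.trans ((min_le_right _ _).trans (min_le_right _ _))
  have hψ : |φ (1 + x) - a / 2 * x ^ 2| ≤ ε / 4 * x ^ 2 := by
    have hder : ∀ z ∈ Set.uIcc 0 x, HasDerivWithinAt (fun z => φ (1 + z) - a / 2 * z ^ 2)
        (deriv φ (1 + z) - a * z) (Set.uIcc 0 x) z := by
      intro z hz
      have hzx : |z| ≤ |x| := by simpa using Set.abs_sub_left_of_mem_uIcc hz
      have hd := (hball (y := 1 + z) (by simpa [Real.dist_eq] using hzx.trans_lt hxη)).2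
      have h3 : HasDerivAt (fun z => φ (1 + z)) (deriv φ (1 + z)) z := by
        simpa using hd.hasDerivAt.comp_const_add 1 z
      have h4 : HasDerivAt (fun z : ℝ => a / 2 * z ^ 2) (a * z) z :=
        ((hasDerivAt_pow 2 z).const_mul (a / 2)).congr_deriv (by push_cast; ring)
      exact (h3.sub h4).hasDerivWithinAt
    have hb : ∀ z ∈ Set.uIcc 0 x, ‖deriv φ (1 + z) - a * z‖ ≤ ε / 4 * |x| := by
      intro z hz
      have hzx : |z| ≤ |x| := by simpa using Set.abs_sub_left_of_mem_uIcc hz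
      have hd := (hball (y := 1 + z) (by simpa [Real.dist_eq] using hzx.trans_lt hxη)).1
      rw [hφ.deriv_one, add_sub_cancel_left, sub_zero, smul_eq_mul, Real.norm_eq_abs z] at hd
      rw [mul_comm a]
      exact hd.trans (by gcongr)
    have := (convex_uIcc (0 : ℝ) x).norm_image_sub_le_of_norm_hasDerivWithin_le hder hb
      Set.left_mem_uIcc Set.right_mem_uIcc
    simp only [add_zero, hφ.map_one, ne_eq, OfNat.ofNat_ne_zero, not_false_eq_true, zero_pow,
      mul_zero, sub_zero, Real.norm_eq_abs] at this
    rwa [mul_assoc, ← sq, sq_abs] at this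
  have h1x : 0 < 1 + x := by linarith [(abs_le.1 hx2).1]
  have hinv : (1 + x)⁻¹ ≤ 2 := by
    rw [inv_le_comm₀ h1x two_pos]
    linarith [(abs_le.1 hx2).1]
  have e : (1 + x)⁻¹ * φ (1 + x) - a / 2 * x ^ 2 =
      (1 + x)⁻¹ * (φ (1 + x) - a / 2 * x ^ 2) - (1 + x)⁻¹ * (a / 2 * x ^ 2 * x) := by
    field_simp
    ring
  rw [e]
  calc _ ≤ |(1 + x)⁻¹ * (φ (1 + x) - a / 2 * x ^ 2)| + |(1 + x)⁻¹ * (a / 2 * x ^ 2 * x)| :=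
        abs_sub _ _
    _ = (1 + x)⁻¹ * |φ (1 + x) - a / 2 * x ^ 2| + (1 + x)⁻¹ * (a / 2 * x ^ 2 * |x|) := by
        have : |(1 + x)⁻¹| = (1 + x)⁻¹ := abs_of_pos (by positivity)
        rw [abs_mul, abs_mul, this, abs_mul _ x, abs_of_nonneg (show 0 ≤ a / 2 * x ^ 2 by positivity)]
    _ ≤ 2 * (ε / 4 * x ^ 2) + 2 * (a / 2 * x ^ 2 * (ε / (2 * a))) := by gcongr
    _ = ε * x ^ 2 := by
        field_simp
        ring

theorem abs_elPhiDiv_sub_le {φ : ℝ → ℝ} {a ε δ : ℝ} (hn : 0 < n) (h : IsELMultiplier y t)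
    (hM : (sampleMean fun i => ‖y i‖ ^ 3) ≤ M) (hδ : 0 ≤ δ) (ht : ‖t‖ ^ 3 * (n * M) ≤ δ ^ 3)
    (hφ : ∀ x : ℝ, |x| ≤ δ → |(1 + x)⁻¹ * φ (1 + x) - a * x ^ 2| ≤ ε * x ^ 2) :
    |n * elPhiDiv φ y - a * (n * inner ℝ t (sampleGram y t))| ≤
      ε * (n * inner ℝ t (sampleGram y t)) := by
  have hx := abs_inner_le_of_pow_three hδ hM ht
  rw [h.elPhiDiv_eq, mul_inv_cancel_left₀ (by positivity), natCast_mul_inner_sampleGram,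
    Finset.mul_sum, ← Finset.sum_sub_distrib, Finset.mul_sum]
  exact (Finset.abs_sum_le_sum_abs _ _).trans (Finset.sum_le_sum fun i _ => hφ _ (hx i))

end Expansion

/-! ### Asymptotics of the empirical likelihood along a sequence of arrays -/

section Asymptotics

variable {p : ℕ} {n : ℕ → ℕ} {y : ∀ j, Fin (n j) → EuclideanSpace ℝ (Fin p)}
  {a : EuclideanSpace ℝ (Fin p)}
  {S Si : EuclideanSpace ℝ (Fin p) →L[ℝ] EuclideanSpace ℝ (Fin p)} {M : ℝ}

theorem tendsto_inv_sqrt_natCast (hn : Tendsto n atTop atTop) :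
    Tendsto (fun j => (Real.sqrt (n j))⁻¹) atTop (𝓝 0) :=
  tendsto_inv_atTop_zero.comp
    (Real.tendsto_sqrt_atTop.comp (tendsto_natCast_atTop_atTop.comp hn))

theorem pow_three_mul_natCast {V : Type*} [SeminormedAddCommGroup V] [NormedSpace ℝ V] {N : ℕ}
    (hN : 0 < N) (t : V) :
    ‖t‖ ^ 3 * N = (Real.sqrt N)⁻¹ * ‖Real.sqrt N • t‖ ^ 3 := by
  have h : 0 < Real.sqrt N := by positivity
  rw [norm_smul, Real.norm_of_nonneg h.le, mul_pow]
  nth_rewrite 1 [← Real.sq_sqrt (Nat.cast_nonneg N : (0 : ℝ) ≤ N)]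
  field_simp

theorem exists_isELMultiplier_of_tendsto (hn : Tendsto n atTop atTop)
    (hmean : Tendsto (fun j => Real.sqrt (n j) • sampleMean (y j)) atTop (𝓝 a))
    (hgram : Tendsto (fun j => sampleGram (y j)) atTop (𝓝 S))
    (hcube : ∀ᶠ j in atTop, (sampleMean fun i => ‖y j i‖ ^ 3) ≤ M)
    (hS : ∃ l > 0, ∀ v, l * ‖v‖ ^ 2 ≤ inner ℝ v (S v)) :
    ∃ R, ∃ t : ℕ → EuclideanSpace ℝ (Fin p), ∀ᶠ j in atTop,
      ‖Real.sqrt (n j) • t j‖ ≤ R ∧ IsELMultiplier (y j) (t j) := by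
  obtain ⟨l, hl, hS⟩ := hS
  set R := 4 * (‖a‖ + 2) / l with hRdef
  have hR : 0 < R := by positivity
  refine ⟨R, ?_⟩
  refine (Filter.skolem (P := fun j t =>
    ‖Real.sqrt (n j) • t‖ ≤ R ∧ IsELMultiplier (y j) t)).1 ?_
  have h0 : Tendsto (fun j => (Real.sqrt (n j))⁻¹ * R ^ 3 * M) atTop (𝓝 0) := by
    simpa using ((tendsto_inv_sqrt_natCast hn).mul_const (R ^ 3)).mul_const M
  filter_upwards [hn.eventually_gt_atTop 0, hcube,
    hmean.norm.eventually_le_const (lt_add_one ‖a‖),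
    (tendsto_iff_norm_sub_tendsto_zero.1 hgram).eventually_le_const (half_pos hl),
    h0.eventually_lt_const (show (0 : ℝ) < (1 / 2) ^ 3 by norm_num),
    h0.eventually_lt_const (half_pos hR)] with j hj hcj hmj hgj h1 h2
  have hs : 0 < Real.sqrt (n j) := by positivity
  have hcub : ∀ t : EuclideanSpace ℝ (Fin p), ‖t‖ = (Real.sqrt (n j))⁻¹ * R →
      ‖t‖ ^ 3 * (n j * M) = (Real.sqrt (n j))⁻¹ * R ^ 3 * M := by
    intro t ht
    rw [← mul_assoc, pow_three_mul_natCast hj, norm_smul, ht, Real.norm_of_nonneg hs.le,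
      mul_inv_cancel_left₀ hs.ne']
  have hpos : ∀ i, (Real.sqrt (n j))⁻¹ * R * ‖y j i‖ < 1 := by
    intro i
    have h : ((Real.sqrt (n j))⁻¹ * R * ‖y j i‖) ^ 3 ≤ (1 / 2) ^ 3 := by
      refine le_trans ?_ h1.le
      rw [mul_pow, mul_pow]
      calc _ ≤ (Real.sqrt (n j))⁻¹ ^ 3 * R ^ 3 * (n j * M) := by
            gcongr
            exact (norm_pow_three_le_sum (y j) i).trans (by gcongr)
        _ = (Real.sqrt (n j))⁻¹ ^ 3 * R ^ 3 * (Real.sqrt (n j) ^ 2 * M) := by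
            rw [Real.sq_sqrt (Nat.cast_nonneg _)]
        _ = _ := by field_simp
    have := le_of_pow_le_pow_left₀ three_ne_zero (by norm_num) h
    linarith
  have hneg : ∀ t, ‖t‖ = (Real.sqrt (n j))⁻¹ * R →
      ∑ i, Real.log (1 + inner ℝ t (y j i)) < 0 := by
    intro t ht
    have hc := hcub t ht
    have hlog := (abs_le.1 (abs_sum_log_sub_le hcj (t := t) (by rw [hc]; exact h1.le))).2
    rw [hc] at hlog
    have hτ : ‖Real.sqrt (n j) • t‖ = R := by
      rw [norm_smul, Real.norm_of_nonneg hs.le, ht, mul_inv_cancel_left₀ hs.ne']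
    have hsq : (n j : ℝ) = Real.sqrt (n j) * Real.sqrt (n j) :=
      (Real.mul_self_sqrt (Nat.cast_nonneg _)).symm
    have e1 : (n j : ℝ) * inner ℝ t (sampleMean (y j)) =
        inner ℝ (Real.sqrt (n j) • t) (Real.sqrt (n j) • sampleMean (y j)) := by
      rw [inner_smul_left, inner_smul_right, ← mul_assoc, conj_trivial, ← hsq]
    have e2 : (n j : ℝ) * inner ℝ t (sampleGram (y j) t) =
        inner ℝ (Real.sqrt (n j) • t) (sampleGram (y j) (Real.sqrt (n j) • t)) := by
      rw [map_smul, inner_smul_left, inner_smul_right, ← mul_assoc, conj_trivial, ← hsq]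
    rw [e1, e2] at hlog
    set τ := Real.sqrt (n j) • t
    have b1 : inner ℝ τ (Real.sqrt (n j) • sampleMean (y j)) ≤ R * (‖a‖ + 1) := by
      refine (real_inner_le_norm _ _).trans ?_
      rw [hτ]
      gcongr
    have b2 : l / 2 * R ^ 2 ≤ inner ℝ τ (sampleGram (y j) τ) := by
      have h3 := hS τ
      have h4 : |inner ℝ τ ((sampleGram (y j) - S) τ)| ≤ l / 2 * R ^ 2 := by
        refine (abs_real_inner_le_norm _ _).trans ?_
        calc _ ≤ ‖τ‖ * (‖sampleGram (y j) - S‖ * ‖τ‖) := by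
              gcongr
              exact ContinuousLinearMap.le_opNorm _ _
          _ ≤ ‖τ‖ * (l / 2 * ‖τ‖) := by gcongr
          _ = l / 2 * R ^ 2 := by rw [hτ]; ring
      rw [sub_apply, inner_sub_right] at h4
      rw [hτ] at h3
      linarith [(abs_le.1 h4).1]
    have b3 : l / 4 * R ^ 2 = R * (‖a‖ + 2) := by
      rw [hRdef]
      field_simp
    linarith
  obtain ⟨t, ht, hmul⟩ := exists_isELMultiplier (by positivity) hpos hneg
  refine ⟨t, ?_, hmul⟩
  rw [norm_smul, Real.norm_of_nonneg hs.le]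
  calc _ ≤ Real.sqrt (n j) * ((Real.sqrt (n j))⁻¹ * R) := by gcongr
    _ = R := mul_inv_cancel_left₀ hs.ne' R

/-- If the means of the arrays are of order `n ^ (-1/2)`, their second moments converge to an
invertible operator and their third moments are bounded, then multipliers eventually exist, and both
the log-likelihood ratio and the `φ`-divergences behave like a quadratic form in the means. -/
theorem tendsto_logRatio_and_elPhiDiv (hn : Tendsto n atTop atTop)
    (hmean : Tendsto (fun j => Real.sqrt (n j) • sampleMean (y j)) atTop (𝓝 a))
    (hgram : Tendsto (fun j => sampleGram (y j)) atTop (𝓝 S))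
    (hcube : ∀ᶠ j in atTop, (sampleMean fun i => ‖y j i‖ ^ 3) ≤ M)
    (hS : ∃ l > 0, ∀ v, l * ‖v‖ ^ 2 ≤ inner ℝ v (S v)) (hSi : ∀ v, Si (S v) = v)
    {φ : ℝ → ℝ} (hφ : IsDivGenerator φ) :
    ∃ t : ℕ → EuclideanSpace ℝ (Fin p), (∀ᶠ j in atTop, IsELMultiplier (y j) (t j)) ∧
      Tendsto (fun j => ∑ i, Real.log (1 + inner ℝ (t j) (y j i))) atTop
        (𝓝 (inner ℝ (Si a) a / 2)) ∧
      Tendsto (fun j => 2 * n j / deriv (deriv φ) 1 * elPhiDiv φ (y j)) atTop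
        (𝓝 (inner ℝ (Si a) a)) := by
  obtain ⟨R, t, ht⟩ := exists_isELMultiplier_of_tendsto hn hmean hgram hcube hS
  set τ := fun j => Real.sqrt (n j) • t j with hτ
  have hsq : ∀ j, (n j : ℝ) = Real.sqrt (n j) * Real.sqrt (n j) := fun j =>
    (Real.mul_self_sqrt (Nat.cast_nonneg _)).symm
  have hinv := tendsto_inv_sqrt_natCast hn
  have h0 : ∀ c : ℝ, Tendsto (fun j => (Real.sqrt (n j))⁻¹ * c) atTop (𝓝 0) := fun c => by
    simpa using hinv.mul_const c
  have hsmall : ∀ δ : ℝ, 0 < δ → ∀ᶠ j in atTop, ‖t j‖ ^ 3 * (n j * M) ≤ δ ^ 3 := by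
    intro δ hδ
    filter_upwards [ht, hn.eventually_gt_atTop 0, hcube,
      (h0 (R ^ 3 * M)).eventually_le_const (show 0 < δ ^ 3 by positivity)] with j hj hj0 hcj h3
    have hM : 0 ≤ M := le_trans (sampleMean_nonneg fun i => by positivity) hcj
    rw [← mul_assoc, pow_three_mul_natCast hj0]
    refine le_trans ?_ h3
    rw [← mul_assoc]
    gcongr
    exact hj.1
  have hfoc : Tendsto (fun j => Real.sqrt (n j) • sampleMean (y j) - sampleGram (y j) (τ j))
      atTop (𝓝 0) := by
    refine squeeze_zero_norm' ?_ (h0 (2 * (R ^ 2 * M)))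
    filter_upwards [ht, hn.eventually_gt_atTop 0, hcube, hsmall (1 / 2) (by norm_num)]
      with j hj hj0 hcj h3
    have hs : 0 < Real.sqrt (n j) := by positivity
    have hM : 0 ≤ M := le_trans (sampleMean_nonneg fun i => by positivity) hcj
    have h4 := hj.2.norm_sub_le hcj h3
    have e : Real.sqrt (n j) • sampleMean (y j) - sampleGram (y j) (τ j) =
        (Real.sqrt (n j))⁻¹ • ((n j : ℝ) • (sampleMean (y j) - sampleGram (y j) (t j))) := by
      have hc : (Real.sqrt (n j))⁻¹ * n j = Real.sqrt (n j) := by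
        rw [inv_mul_eq_iff_eq_mul₀ hs.ne', ← hsq]
      rw [smul_smul, hc, smul_sub, hτ, map_smul]
    rw [e, norm_smul, norm_inv, Real.norm_of_nonneg hs.le]
    gcongr
    refine h4.trans (mul_le_mul_of_nonneg_left ?_ two_pos.le)
    rw [← mul_assoc]
    gcongr
    calc ‖t j‖ ^ 2 * n j = ‖τ j‖ ^ 2 := by
          rw [hτ, norm_smul, Real.norm_of_nonneg hs.le, mul_pow, Real.sq_sqrt (Nat.cast_nonneg _)]
          ring
      _ ≤ R ^ 2 := by gcongr; exact hj.1
  have hSnτ : Tendsto (fun j => sampleGram (y j) (τ j)) atTop (𝓝 a) := by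
    simpa using hmean.sub hfoc
  have hdiff : Tendsto (fun j => (S - sampleGram (y j)) (τ j)) atTop (𝓝 0) := by
    have h5 : Tendsto (fun j => ‖S - sampleGram (y j)‖ * R) atTop (𝓝 0) := by
      have := (tendsto_iff_norm_sub_tendsto_zero.1 hgram).mul_const R
      simpa only [norm_sub_rev, zero_mul] using this
    refine squeeze_zero_norm' ?_ h5
    filter_upwards [ht] with j hj
    refine (ContinuousLinearMap.le_opNorm _ _).trans ?_
    gcongr
    exact hj.1
  have hτlim : Tendsto τ atTop (𝓝 (Si a)) := by
    have h6 : Tendsto (fun j => S (τ j)) atTop (𝓝 a) := by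
      simpa using hdiff.add hSnτ
    simpa [Function.comp_def, hSi] using (Si.continuous.tendsto a).comp h6
  have hquad : Tendsto (fun j => (n j : ℝ) * inner ℝ (t j) (sampleGram (y j) (t j))) atTop
      (𝓝 (inner ℝ (Si a) a)) := by
    refine (hτlim.inner hSnτ).congr fun j => ?_
    rw [hτ, map_smul, inner_smul_left, inner_smul_right, ← mul_assoc, conj_trivial, ← hsq]
  have hlin : Tendsto (fun j => (n j : ℝ) * inner ℝ (t j) (sampleMean (y j))) atTop
      (𝓝 (inner ℝ (Si a) a)) := by
    refine (hτlim.inner hmean).congr fun j => ?_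
    rw [hτ, inner_smul_left, inner_smul_right, ← mul_assoc, conj_trivial, ← hsq]
  refine ⟨t, ht.mono fun j hj => hj.2, ?_, ?_⟩
  · have h7 : Tendsto (fun j => ∑ i, Real.log (1 + inner ℝ (t j) (y j i)) -
        n j * inner ℝ (t j) (sampleMean (y j)) +
        n j * inner ℝ (t j) (sampleGram (y j) (t j)) / 2) atTop (𝓝 0) := by
      refine squeeze_zero_norm' ?_ (h0 (2 * (R ^ 3 * M)))
      filter_upwards [ht, hn.eventually_gt_atTop 0, hcube, hsmall (1 / 2) (by norm_num)]
        with j hj hj0 hcj h3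
      have hM : 0 ≤ M := le_trans (sampleMean_nonneg fun i => by positivity) hcj
      refine (abs_sum_log_sub_le hcj h3).trans ?_
      rw [← mul_assoc (‖t j‖ ^ 3), pow_three_mul_natCast hj0]
      calc _ ≤ 2 * ((Real.sqrt (n j))⁻¹ * R ^ 3 * M) := by gcongr; exact hj.1
        _ = _ := by ring
    convert (h7.add hlin).sub (hquad.div_const 2) using 2 <;> ring
  · set b := deriv (deriv φ) 1 with hb
    have hb0 : 0 < b := hφ.deriv_deriv_one_pos
    have h8 : Tendsto (fun j => (n j : ℝ) * elPhiDiv φ (y j)) atTop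
        (𝓝 (b / 2 * inner ℝ (Si a) a)) := by
      rw [Metric.tendsto_atTop']
      have hq0 : 0 ≤ inner ℝ (Si a) a := by
        refine ge_of_tendsto hquad (.of_forall fun j => ?_)
        rw [natCast_mul_inner_sampleGram]
        positivity
      intro ε hε
      set q := inner ℝ (Si a) a
      obtain ⟨δ, hδ, hφδ⟩ := hφ.exists_abs_sub_le (ε := ε / (2 * (q + 1))) (by positivity)
      have h9 := (tendsto_iff_norm_sub_tendsto_zero.1 (hquad.const_mul (b / 2))).eventually_lt_const
        (half_pos hε)
      obtain ⟨N, hN⟩ := eventually_atTop.1 (((ht.and (hn.eventually_gt_atTop 0)).and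
        (hcube.and (hsmall δ hδ))).and (h9.and (hquad.eventually_le_const (lt_add_one q))))
      refine ⟨N, fun j hj => ?_⟩
      obtain ⟨⟨⟨⟨-, hm⟩, hj0⟩, hcj, h3⟩, h4, h5⟩ := hN j hj.le
      have h6 := abs_elPhiDiv_sub_le hj0 hm hcj hδ.le h3 hφδ
      have h7 : ε / (2 * (q + 1)) * (n j * inner ℝ (t j) (sampleGram (y j) (t j))) ≤ ε / 2 := by
        calc _ ≤ ε / (2 * (q + 1)) * (q + 1) := by gcongr
          _ = ε / 2 := by field_simp
      rw [Real.dist_eq]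
      calc _ ≤ _ := abs_sub_le _ (b / 2 * (n j * inner ℝ (t j) (sampleGram (y j) (t j)))) _
        _ < ε := by
          rw [Real.norm_eq_abs] at h4
          linarith
    convert h8.const_mul (2 / b) using 2
    · ring
    · field_simp

end Asymptotics

/-! ### Dependence of the estimating function on the parameter -/

/-- On the ball of radius `r` around `θ₀`, the functions `g x` are twice continuously
differentiable, and `‖g x θ‖ ^ 3` and the first two derivatives are bounded by `K x`. -/
structure IsEnvelope {k p : ℕ}
    (g : EuclideanSpace ℝ (Fin k) → EuclideanSpace ℝ (Fin p) → EuclideanSpace ℝ (Fin p))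
    (θ₀ : EuclideanSpace ℝ (Fin p)) (K : EuclideanSpace ℝ (Fin k) → ℝ) (r : ℝ) : Prop where
  pos : 0 < r
  contDiffAt : ∀ θ ∈ Metric.ball θ₀ r, ∀ x, ContDiffAt ℝ 2 (g x) θ
  cube_le : ∀ θ ∈ Metric.ball θ₀ r, ∀ x, ‖g x θ‖ ^ 3 ≤ K x
  deriv_le : ∀ θ ∈ Metric.ball θ₀ r, ∀ x, ‖fderiv ℝ (g x) θ‖ ≤ K x
  deriv_deriv_le : ∀ θ ∈ Metric.ball θ₀ r, ∀ x, ‖fderiv ℝ (fderiv ℝ (g x)) θ‖ ≤ K x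

namespace IsEnvelope

variable {k p : ℕ}
  {g : EuclideanSpace ℝ (Fin k) → EuclideanSpace ℝ (Fin p) → EuclideanSpace ℝ (Fin p)}
  {θ₀ θ : EuclideanSpace ℝ (Fin p)} {K : EuclideanSpace ℝ (Fin k) → ℝ} {r : ℝ}

theorem self_mem (h : IsEnvelope g θ₀ K r) : θ₀ ∈ Metric.ball θ₀ r :=
  Metric.mem_ball_self h.pos

theorem nonneg (h : IsEnvelope g θ₀ K r) (x : EuclideanSpace ℝ (Fin k)) : 0 ≤ K x :=
  (norm_nonneg _).trans (h.deriv_le θ₀ h.self_mem x)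

theorem norm_sub_le (h : IsEnvelope g θ₀ K r) (hθ : θ ∈ Metric.ball θ₀ r)
    (x : EuclideanSpace ℝ (Fin k)) : ‖g x θ - g x θ₀‖ ≤ K x * ‖θ - θ₀‖ :=
  (convex_ball θ₀ r).norm_image_sub_le_of_norm_fderiv_le
    (fun θ' hθ' => (h.contDiffAt θ' hθ' x).differentiableAt (by norm_num))
    (fun θ' hθ' => h.deriv_le θ' hθ' x) h.self_mem hθ

theorem norm_fderiv_sub_le (h : IsEnvelope g θ₀ K r) (hθ : θ ∈ Metric.ball θ₀ r)
    (x : EuclideanSpace ℝ (Fin k)) :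
    ‖fderiv ℝ (g x) θ - fderiv ℝ (g x) θ₀‖ ≤ K x * ‖θ - θ₀‖ :=
  (convex_ball θ₀ r).norm_image_sub_le_of_norm_fderiv_le
    (fun θ' hθ' => ((h.contDiffAt θ' hθ' x).fderiv_right (m := 1) (by norm_num)).differentiableAt
      (by norm_num))
    (fun θ' hθ' => h.deriv_deriv_le θ' hθ' x) h.self_mem hθ

theorem norm_taylor_le (h : IsEnvelope g θ₀ K r) (hθ : θ ∈ Metric.ball θ₀ r)
    (x : EuclideanSpace ℝ (Fin k)) :
    ‖g x θ - g x θ₀ - fderiv ℝ (g x) θ₀ (θ - θ₀)‖ ≤ K x * ‖θ - θ₀‖ ^ 2 := by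
  have hsub : Metric.closedBall θ₀ ‖θ - θ₀‖ ⊆ Metric.ball θ₀ r :=
    Metric.closedBall_subset_ball (by simpa [dist_eq_norm] using hθ)
  have := (convex_closedBall θ₀ ‖θ - θ₀‖).norm_image_sub_le_of_norm_fderiv_le'
    (f := g x) (φ := fderiv ℝ (g x) θ₀) (C := K x * ‖θ - θ₀‖)
    (fun θ' hθ' => (h.contDiffAt θ' (hsub hθ') x).differentiableAt (by norm_num))
    (fun θ' hθ' => (h.norm_fderiv_sub_le (hsub hθ') x).trans (by
      have := h.nonneg x
      gcongr
      simpa [dist_eq_norm] using hθ'))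
    (Metric.mem_closedBall_self (norm_nonneg _)) (by simp [dist_eq_norm] : θ ∈ _)
  rwa [mul_assoc, ← sq] at this

variable {N : ℕ} {x : Fin N → EuclideanSpace ℝ (Fin k)}

theorem norm_sampleMean_taylor_le (h : IsEnvelope g θ₀ K r) (hθ : θ ∈ Metric.ball θ₀ r) :
    ‖(sampleMean fun i => g (x i) θ) - (sampleMean fun i => g (x i) θ₀) -
      (sampleMean fun i => fderiv ℝ (g (x i)) θ₀) (θ - θ₀)‖ ≤
      (sampleMean fun i => K (x i)) * ‖θ - θ₀‖ ^ 2 := by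
  have e : (sampleMean fun i => fderiv ℝ (g (x i)) θ₀) (θ - θ₀) =
      sampleMean fun i => fderiv ℝ (g (x i)) θ₀ (θ - θ₀) := by simp [sampleMean]
  rw [e, ← sampleMean_sub, ← sampleMean_sub, ← sampleMean_mul_const]
  exact (norm_sampleMean_le _).trans (sampleMean_mono fun i => h.norm_taylor_le hθ (x i))

theorem norm_sampleGram_sub_le (h : IsEnvelope g θ₀ K r) (hθ : θ ∈ Metric.ball θ₀ r) {b : ℝ}
    (hb : 0 ≤ b) (hK : N * (sampleMean fun i => K (x i)) ≤ b ^ 3) :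
    ‖(sampleGram fun i => g (x i) θ) - sampleGram fun i => g (x i) θ₀‖ ≤
      (sampleMean fun i => K (x i)) * (‖θ - θ₀‖ * (2 * b)) := by
  have hg : ∀ θ' ∈ Metric.ball θ₀ r, ∀ i, ‖g (x i) θ'‖ ≤ b := by
    intro θ' hθ' i
    refine le_of_pow_le_pow_left₀ three_ne_zero hb (le_trans ?_ hK)
    rw [natCast_mul_sampleMean]
    exact (h.cube_le θ' hθ' (x i)).trans
      (Finset.single_le_sum (f := fun i => K (x i)) (fun _ _ => h.nonneg _) (Finset.mem_univ i))
  rw [sampleGram, sampleGram, ← sampleMean_sub, ← sampleMean_mul_const]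
  refine (norm_sampleMean_le _).trans (sampleMean_mono fun i => ?_)
  have e : InnerProductSpace.rankOne ℝ (g (x i) θ) (g (x i) θ) -
      InnerProductSpace.rankOne ℝ (g (x i) θ₀) (g (x i) θ₀) =
      InnerProductSpace.rankOne ℝ (g (x i) θ - g (x i) θ₀) (g (x i) θ) +
      InnerProductSpace.rankOne ℝ (g (x i) θ₀) (g (x i) θ - g (x i) θ₀) := by
    simp
  rw [e]
  refine (norm_add_le _ _).trans ?_
  rw [InnerProductSpace.norm_rankOne, InnerProductSpace.norm_rankOne]
  have h1 := h.norm_sub_le hθ (x i)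
  have h2 := hg θ hθ i
  have h3 := hg θ₀ h.self_mem i
  have := h.nonneg (x i)
  calc _ ≤ K (x i) * ‖θ - θ₀‖ * b + b * (K (x i) * ‖θ - θ₀‖) := by gcongr
    _ = _ := by ring

end IsEnvelope

/-- A sequence of samples `x j` of sizes `n j → ∞` whose standardized mean of `g · θ₀`, second
moments of `g · θ₀` and mean derivative converge to `z`, `S` and `G`, and whose mean of `K` is
bounded by `M`. -/
structure SampleLimits {k p : ℕ}
    (g : EuclideanSpace ℝ (Fin k) → EuclideanSpace ℝ (Fin p) → EuclideanSpace ℝ (Fin p))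
    (θ₀ : EuclideanSpace ℝ (Fin p)) (K : EuclideanSpace ℝ (Fin k) → ℝ)
    (n : ℕ → ℕ) (x : ∀ j, Fin (n j) → EuclideanSpace ℝ (Fin k)) (z : EuclideanSpace ℝ (Fin p))
    (S G : EuclideanSpace ℝ (Fin p) →L[ℝ] EuclideanSpace ℝ (Fin p)) (M : ℝ) : Prop where
  size : Tendsto n atTop atTop
  mean : Tendsto (fun j => Real.sqrt (n j) • sampleMean fun i => g (x j i) θ₀) atTop (𝓝 z)
  gram : Tendsto (fun j => sampleGram fun i => g (x j i) θ₀) atTop (𝓝 S)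
  jac : Tendsto (fun j => sampleMean fun i => fderiv ℝ (g (x j i)) θ₀) atTop (𝓝 G)
  bound : ∀ᶠ j in atTop, (sampleMean fun i => K (x j i)) ≤ M

theorem _root_.Filter.Tendsto.clm_apply_of_tendsto {α V W : Type*} [NormedAddCommGroup V]
    [NormedSpace ℝ V] [NormedAddCommGroup W] [NormedSpace ℝ W] {l : Filter α} {A : α → V →L[ℝ] W}
    {B : V →L[ℝ] W} {v : α → V} {w : V} (hA : Tendsto A l (𝓝 B)) (hv : Tendsto v l (𝓝 w)) :
    Tendsto (fun a => A a (v a)) l (𝓝 (B w)) :=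
  ((isBoundedBilinearMap_apply (𝕜 := ℝ) (E := V) (F := W)).continuous.tendsto (B, w)).comp
    (hA.prodMk_nhds hv)

namespace SampleLimits

variable {k p : ℕ}
  {g : EuclideanSpace ℝ (Fin k) → EuclideanSpace ℝ (Fin p) → EuclideanSpace ℝ (Fin p)}
  {θ₀ : EuclideanSpace ℝ (Fin p)} {K : EuclideanSpace ℝ (Fin k) → ℝ} {r M : ℝ}
  {n : ℕ → ℕ} {x : ∀ j, Fin (n j) → EuclideanSpace ℝ (Fin k)} {z w : EuclideanSpace ℝ (Fin p)}
  {S G Si : EuclideanSpace ℝ (Fin p) →L[ℝ] EuclideanSpace ℝ (Fin p)}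
  {u θ : ℕ → EuclideanSpace ℝ (Fin p)}

theorem comp (h : SampleLimits g θ₀ K n x z S G M) {m : ℕ → ℕ} (hm : Tendsto m atTop atTop) :
    SampleLimits g θ₀ K (fun j => n (m j)) (fun j => x (m j)) z S G M where
  size := h.size.comp hm
  mean := h.mean.comp hm
  gram := h.gram.comp hm
  jac := h.jac.comp hm
  bound := hm.eventually h.bound

theorem bound_nonneg (h : SampleLimits g θ₀ K n x z S G M) (hK : IsEnvelope g θ₀ K r) : 0 ≤ M := by
  obtain ⟨j, hj⟩ := h.bound.exists
  exact (sampleMean_nonneg fun i => hK.nonneg _).trans hj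

theorem eventually_cube_le (h : SampleLimits g θ₀ K n x z S G M) (hK : IsEnvelope g θ₀ K r)
    (hθ : Tendsto θ atTop (𝓝 θ₀)) :
    ∀ᶠ j in atTop, (sampleMean fun i => ‖g (x j i) (θ j)‖ ^ 3) ≤ M := by
  filter_upwards [h.bound, hθ (Metric.ball_mem_nhds θ₀ hK.pos)] with j hj hθj
  exact (sampleMean_mono fun i => hK.cube_le _ hθj _).trans hj

theorem tendsto_of_smul_sub (hn : Tendsto n atTop atTop)
    (hu : Tendsto (fun j => Real.sqrt (n j) • (θ j - θ₀)) atTop (𝓝 w)) :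
    Tendsto θ atTop (𝓝 θ₀) := by
  have h1 := (tendsto_inv_sqrt_natCast hn).smul hu
  rw [zero_smul] at h1
  have h2 : Tendsto (fun j => θ j - θ₀) atTop (𝓝 0) := by
    refine h1.congr' ?_
    filter_upwards [hn.eventually_gt_atTop 0] with j hj
    rw [smul_smul, inv_mul_cancel₀ (by positivity), one_smul]
  simpa using h2.add_const θ₀

theorem tendsto_mean (h : SampleLimits g θ₀ K n x z S G M) (hK : IsEnvelope g θ₀ K r)
    (hu : Tendsto (fun j => Real.sqrt (n j) • (θ j - θ₀)) atTop (𝓝 w)) :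
    Tendsto (fun j => Real.sqrt (n j) • sampleMean fun i => g (x j i) (θ j)) atTop
      (𝓝 (z + G w)) := by
  have hθ := tendsto_of_smul_sub h.size hu
  have h1 : Tendsto (fun j => (sampleMean fun i => fderiv ℝ (g (x j i)) θ₀)
      (Real.sqrt (n j) • (θ j - θ₀))) atTop (𝓝 (G w)) := 
    Filter.Tendsto.clm_apply_of_tendsto h.jac hu
  have h2 : Tendsto (fun j => Real.sqrt (n j) • ((sampleMean fun i => g (x j i) (θ j)) -
      (sampleMean fun i => g (x j i) θ₀) -
      (sampleMean fun i => fderiv ℝ (g (x j i)) θ₀) (θ j - θ₀))) atTop (𝓝 0) := by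
    have h3 : Tendsto (fun j => M * ‖Real.sqrt (n j) • (θ j - θ₀)‖ * ‖θ j - θ₀‖) atTop (𝓝 0) := by
      have h4 : Tendsto (fun j => ‖θ j - θ₀‖) atTop (𝓝 0) := by
        simpa using (hθ.sub_const θ₀).norm
      simpa using (hu.norm.const_mul M).mul h4
    refine squeeze_zero_norm' ?_ h3
    filter_upwards [h.bound, hθ (Metric.ball_mem_nhds θ₀ hK.pos)] with j hj hθj
    rw [norm_smul, norm_smul]
    calc _ ≤ ‖Real.sqrt (n j)‖ * (M * ‖θ j - θ₀‖ ^ 2) := by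
          gcongr
          exact (hK.norm_sampleMean_taylor_le hθj).trans (by gcongr)
      _ = _ := by ring
  have h5 := (h.mean.add h1).add h2
  rw [add_zero] at h5
  refine h5.congr fun j => ?_
  rw [map_smul, ← smul_add, ← smul_add]
  congr 1
  abel

theorem tendsto_gram (h : SampleLimits g θ₀ K n x z S G M) (hK : IsEnvelope g θ₀ K r)
    (hu : Tendsto (fun j => Real.sqrt (n j) • (θ j - θ₀)) atTop (𝓝 w)) :
    Tendsto (fun j => sampleGram fun i => g (x j i) (θ j)) atTop (𝓝 S) := by
  have hθ := tendsto_of_smul_sub h.size hu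
  have hM := h.bound_nonneg hK
  suffices h1 : Tendsto (fun j => (sampleGram fun i => g (x j i) (θ j)) -
      sampleGram fun i => g (x j i) θ₀) atTop (𝓝 0) by
    simpa using h1.add h.gram
  rw [Metric.tendsto_atTop']
  intro ε hε
  set c := 2 * M * (‖w‖ + 1) + 1 with hc
  have hc0 : 0 < c := by positivity
  set δ := ε / c with hδ
  have hδ0 : 0 < δ := by positivity
  have h0 : Tendsto (fun j => (Real.sqrt (n j))⁻¹ * M) atTop (𝓝 0) := by
    simpa using (tendsto_inv_sqrt_natCast h.size).mul_const M
  obtain ⟨N, hN⟩ := eventually_atTop.1 (((h.bound.and (hθ (Metric.ball_mem_nhds θ₀ hK.pos))).and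
    (h.size.eventually_gt_atTop 0)).and
    ((hu.norm.eventually_le_const (lt_add_one ‖w‖)).and
      (h0.eventually_le_const (show 0 < δ ^ 3 by positivity))))
  refine ⟨N, fun j hj => ?_⟩
  obtain ⟨⟨⟨h1, h2⟩, h3⟩, h4, h5⟩ := hN j hj.le
  have hs : 0 < Real.sqrt (n j) := by positivity
  have h6 : n j * (sampleMean fun i => K (x j i)) ≤ (δ * Real.sqrt (n j)) ^ 3 := by
    calc _ ≤ n j * M := by gcongr
      _ = Real.sqrt (n j) ^ 3 * ((Real.sqrt (n j))⁻¹ * M) := by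
          nth_rewrite 1 [← Real.sq_sqrt (Nat.cast_nonneg (n j) : (0 : ℝ) ≤ n j)]
          field_simp
      _ ≤ Real.sqrt (n j) ^ 3 * δ ^ 3 := by gcongr
      _ = _ := by ring
  rw [dist_zero_right]
  rw [norm_smul, Real.norm_of_nonneg hs.le] at h4
  calc _ ≤ _ := hK.norm_sampleGram_sub_le h2 (by positivity) h6
    _ = (sampleMean fun i => K (x j i)) * (Real.sqrt (n j) * ‖θ j - θ₀‖) * (2 * δ) := by ring
    _ ≤ M * (‖w‖ + 1) * (2 * δ) := by gcongr
    _ = (c - 1) * δ := by rw [hc]; ring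
    _ < c * δ := by linarith
    _ = ε := by rw [hδ]; field_simp

theorem tendsto_logRatio_and_elPhiDiv (h : SampleLimits g θ₀ K n x z S G M)
    (hK : IsEnvelope g θ₀ K r) (hS : ∃ l > 0, ∀ v, l * ‖v‖ ^ 2 ≤ inner ℝ v (S v))
    (hSi : ∀ v, Si (S v) = v) {φ : ℝ → ℝ} (hφ : IsDivGenerator φ)
    (hu : Tendsto (fun j => Real.sqrt (n j) • (θ j - θ₀)) atTop (𝓝 w)) :
    ∃ t : ℕ → EuclideanSpace ℝ (Fin p),
      (∀ᶠ j in atTop, IsELMultiplier (fun i => g (x j i) (θ j)) (t j)) ∧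
      Tendsto (fun j => ∑ i, Real.log (1 + inner ℝ (t j) (g (x j i) (θ j)))) atTop
        (𝓝 (inner ℝ (Si (z + G w)) (z + G w) / 2)) ∧
      Tendsto (fun j => 2 * n j / deriv (deriv φ) 1 * elPhiDiv φ fun i => g (x j i) (θ j)) atTop
        (𝓝 (inner ℝ (Si (z + G w)) (z + G w))) :=
  _root_.tendsto_logRatio_and_elPhiDiv h.size (h.tendsto_mean hK hu) (h.tendsto_gram hK hu)
    (h.eventually_cube_le hK (tendsto_of_smul_sub h.size hu)) hS hSi hφ

end SampleLimits

/-! ### Local maximizers of the empirical likelihood -/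

theorem IsELMultiplier.sqrt_mul_norm_le {p n : ℕ} {y : Fin n → EuclideanSpace ℝ (Fin p)}
    {t : EuclideanSpace ℝ (Fin p)} {M : ℝ} (h : IsELMultiplier y t) (hn : 0 < n)
    (hM : (sampleMean fun i => ‖y i‖ ^ 3) ≤ M) (hMn : (Real.sqrt n)⁻¹ * M ≤ (1 / 2) ^ 3) :
    Real.sqrt n * ‖sampleMean y‖ ≤ ∑ i, Real.log (1 + inner ℝ t (y i)) + (1 + M) := by
  have hs : 0 < Real.sqrt n := by positivity
  have hM0 : 0 ≤ M := le_trans (sampleMean_nonneg fun i => by positivity) hM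
  set e := ‖sampleMean y‖⁻¹ • sampleMean y with he
  set s := (Real.sqrt n)⁻¹ • e with hsdef
  have he1 : ‖e‖ ≤ 1 := by
    rw [he, norm_smul, norm_inv, norm_norm]
    exact inv_mul_le_one
  have hs1 : ‖s‖ ≤ (Real.sqrt n)⁻¹ := by
    rw [hsdef, norm_smul, norm_inv, Real.norm_of_nonneg hs.le]
    exact mul_le_of_le_one_right (by positivity) he1
  have hsn : Real.sqrt n • s = e := by
    rw [hsdef, smul_smul, mul_inv_cancel₀ hs.ne', one_smul]
  have hcub : ‖s‖ ^ 3 * (n * M) ≤ (1 / 2) ^ 3 := by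
    refine le_trans ?_ hMn
    rw [← mul_assoc, pow_three_mul_natCast hn, hsn]
    gcongr
    exact mul_le_of_le_one_right (by positivity) (pow_le_one₀ (norm_nonneg _) he1)
  have hlog := (abs_le.1 (abs_sum_log_sub_le hM hcub)).1
  have hpos : ∀ i, 0 < 1 + inner ℝ s (y i) := fun i => by
    have := (abs_le.1 (abs_inner_le_of_pow_three (by norm_num) hM hcub i)).1
    linarith
  have hle := h.sum_log_le hpos
  have hlin : (n : ℝ) * inner ℝ s (sampleMean y) = Real.sqrt n * ‖sampleMean y‖ := by
    have h1 : inner ℝ e (sampleMean y) = ‖sampleMean y‖ := by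
      rw [he, inner_smul_left, real_inner_self_eq_norm_sq, conj_trivial, sq, ← mul_assoc]
      exact inv_mul_mul_self _
    rw [hsdef, inner_smul_left, h1, conj_trivial, ← mul_assoc, ← div_eq_mul_inv,
      Real.div_sqrt]
  have hquad : (n : ℝ) * inner ℝ s (sampleGram y s) ≤ 1 + M := by
    rw [natCast_mul_inner_sampleGram]
    calc _ ≤ ∑ i, (Real.sqrt n)⁻¹ ^ 2 * (1 + ‖y i‖ ^ 3) := by
          refine Finset.sum_le_sum fun i _ => ?_
          rw [← sq_abs]
          calc _ ≤ (‖s‖ * ‖y i‖) ^ 2 := by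
                gcongr
                exact abs_real_inner_le_norm _ _
            _ ≤ ((Real.sqrt n)⁻¹ * ‖y i‖) ^ 2 := by gcongr
            _ = (Real.sqrt n)⁻¹ ^ 2 * ‖y i‖ ^ 2 := mul_pow _ _ _
            _ ≤ _ := by
                gcongr
                nlinarith [norm_nonneg (y i), sq_nonneg (‖y i‖ - 1),
                  mul_nonneg (norm_nonneg (y i)) (sq_nonneg (‖y i‖ - 1))]
      _ = 1 + sampleMean fun i => ‖y i‖ ^ 3 := by
          rw [← Finset.mul_sum, Finset.sum_add_distrib, inv_pow, Real.sq_sqrt (Nat.cast_nonneg n),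
            sampleMean, smul_eq_mul, mul_add]
          simp [hn.ne']
      _ ≤ 1 + M := by gcongr
  rw [hlin] at hlog
  linarith

/-- The operators in the limit of the constrained problem: `S` is the second moment of the
estimating function, `G` its mean derivative and `C` the derivative of the constraint; `B` has the
same kernel as `C ∘ G⁻¹` and satisfies `B S B† = 1`. -/
structure IsLimitData {p q : ℕ}
    (S Si G Gi : EuclideanSpace ℝ (Fin p) →L[ℝ] EuclideanSpace ℝ (Fin p))
    (C B : EuclideanSpace ℝ (Fin p) →L[ℝ] EuclideanSpace ℝ (Fin q)) : Prop where
  symm : ∀ v w, inner ℝ (S v) w = inner ℝ v (S w)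
  coercive : ∃ l > 0, ∀ v, l * ‖v‖ ^ 2 ≤ inner ℝ v (S v)
  inv_apply : ∀ v, Si (S v) = v
  apply_inv : ∀ v, S (Si v) = v
  jac_inv_apply : ∀ v, Gi (G v) = v
  jac_apply_inv : ∀ v, G (Gi v) = v
  ker_iff : ∀ v, C v = 0 ↔ B (G v) = 0
  whiten : ∀ s, B (S (ContinuousLinearMap.adjoint B s)) = s

namespace IsLimitData

variable {p q : ℕ} {S Si G Gi : EuclideanSpace ℝ (Fin p) →L[ℝ] EuclideanSpace ℝ (Fin p)}
  {C B : EuclideanSpace ℝ (Fin p) →L[ℝ] EuclideanSpace ℝ (Fin q)}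

theorem norm_sq_le (h : IsLimitData S Si G Gi C B) (a : EuclideanSpace ℝ (Fin p)) :
    ‖B a‖ ^ 2 ≤ inner ℝ (Si a) a := by
  set b := ContinuousLinearMap.adjoint B (B a) with hb
  set r := a - S b with hr
  have ha : a = S b + r := by rw [hr]; abel
  have hBr : B r = 0 := by rw [hr, map_sub, hb, h.whiten, sub_self]
  have hSia : Si a = b + Si r := by
    conv_lhs => rw [ha, map_add, h.inv_apply]
  have h1 : inner ℝ b (S b) = ‖B a‖ ^ 2 := by
    rw [hb, ContinuousLinearMap.adjoint_inner_left, h.whiten, real_inner_self_eq_norm_sq]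
  have h2 : inner ℝ b r = 0 := by
    rw [hb, ContinuousLinearMap.adjoint_inner_left, hBr, inner_zero_right]
  have h3 : inner ℝ (Si r) (S b) = 0 := by
    rw [← h.symm, h.apply_inv, real_inner_comm, h2]
  have h4 : 0 ≤ inner ℝ (Si r) r := by
    obtain ⟨l, hl, hc⟩ := h.coercive
    have := hc (Si r)
    rw [h.apply_inv] at this
    exact le_trans (by positivity) this
  have h5 : inner ℝ (Si a) a = ‖B a‖ ^ 2 + inner ℝ (Si r) r := by
    rw [hSia]
    nth_rewrite 1 [ha]
    rw [inner_add_left, inner_add_right, inner_add_right, h1, h2, h3]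
    ring
  linarith

theorem exists_inner_eq (h : IsLimitData S Si G Gi C B) (z : EuclideanSpace ℝ (Fin p)) :
    ∃ v, C v = 0 ∧ inner ℝ (Si (z + G v)) (z + G v) = ‖B z‖ ^ 2 := by
  set b := ContinuousLinearMap.adjoint B (B z) with hb
  refine ⟨Gi (S b - z), ?_, ?_⟩
  · rw [h.ker_iff, h.jac_apply_inv, map_sub, hb, h.whiten, sub_self]
  · rw [h.jac_apply_inv, add_sub_cancel, h.inv_apply, hb, ContinuousLinearMap.adjoint_inner_left,
      h.whiten, real_inner_self_eq_norm_sq]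

theorem exists_pos_mul_norm_le (h : IsLimitData S Si G Gi C B) :
    ∃ l > 0, ∀ v, l * ‖v‖ ≤ ‖G v‖ := by
  refine ⟨(‖Gi‖ + 1)⁻¹, by positivity, fun v => ?_⟩
  rw [inv_mul_le_iff₀ (by positivity)]
  calc ‖v‖ = ‖Gi (G v)‖ := by rw [h.jac_inv_apply]
    _ ≤ ‖Gi‖ * ‖G v‖ := Gi.le_opNorm _
    _ ≤ _ := by gcongr; linarith

end IsLimitData

/-- Every tangent vector at a regular point of a level set is the velocity of a sequence in it. -/
theorem exists_seq_of_hasStrictFDerivAt {E F : Type*} [NormedAddCommGroup E] [NormedSpace ℝ E]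
    [CompleteSpace E] [NormedAddCommGroup F] [NormedSpace ℝ F] [FiniteDimensional ℝ F]
    {c : E → F} {C : E →L[ℝ] F} {a v : E} (hc : HasStrictFDerivAt c C a)
    (hC : C.range = ⊤) (hv : C v = 0) {b : ℕ → ℝ} (hb : Tendsto b atTop atTop) :
    ∃ u : ℕ → E, (∀ᶠ j in atTop, c (u j) = c a) ∧
      Tendsto (fun j => b j • (u j - a)) atTop (𝓝 v) := by
  set γ := hc.implicitFunction c C hC (c a)
  have hv' : v ∈ C.ker := hv
  have hd : Tendsto (fun j => (b j)⁻¹ • (⟨v, hv'⟩ : C.ker)) atTop (𝓝 0) := by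
    simpa using (tendsto_inv_atTop_zero.comp hb).smul_const (⟨v, hv'⟩ : C.ker)
  refine ⟨fun j => γ ((b j)⁻¹ • ⟨v, hv'⟩), ?_, ?_⟩
  · have h1 : Tendsto (fun j => (c a, (b j)⁻¹ • (⟨v, hv'⟩ : C.ker))) atTop (𝓝 (c a, 0)) :=
      tendsto_const_nhds.prodMk_nhds hd
    exact h1.eventually (hc.map_implicitFunction_eq hC)
  · have h2 := (hc.to_implicitFunction hC).hasFDerivAt.hasFDerivWithinAt (s := Set.univ)
    have h3 := h2.lim (c := b) (v := ⟨v, hv'⟩) hd (.of_forall fun _ => Set.mem_univ _) (by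
      refine tendsto_const_nhds.congr' ?_
      filter_upwards [hb.eventually_gt_atTop 0] with j hj
      rw [smul_smul, mul_inv_cancel₀ hj.ne', one_smul])
    simpa [hc.implicitFunction_apply_image hC, γ] using h3

namespace SampleLimits

variable {k p q : ℕ}
  {g : EuclideanSpace ℝ (Fin k) → EuclideanSpace ℝ (Fin p) → EuclideanSpace ℝ (Fin p)}
  {θ₀ : EuclideanSpace ℝ (Fin p)} {K : EuclideanSpace ℝ (Fin k) → ℝ} {r M : ℝ}
  {n : ℕ → ℕ} {x : ∀ j, Fin (n j) → EuclideanSpace ℝ (Fin k)} {z w : EuclideanSpace ℝ (Fin p)}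
  {S Si G Gi : EuclideanSpace ℝ (Fin p) →L[ℝ] EuclideanSpace ℝ (Fin p)}
  {C B : EuclideanSpace ℝ (Fin p) →L[ℝ] EuclideanSpace ℝ (Fin q)}
  {θ : ℕ → EuclideanSpace ℝ (Fin p)} {φ : ℝ → ℝ}

theorem exists_eventually_norm_le (h : SampleLimits g θ₀ K n x z S G M)
    (hK : IsEnvelope g θ₀ K r) (hL : IsLimitData S Si G Gi C B) (hφ : IsDivGenerator φ)
    (hθ : Tendsto θ atTop (𝓝 θ₀))
    (hmax : ∀ᶠ j in atTop, elLogLik (fun i => g (x j i) (θ j)) ≠ ⊥ ∧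
      elLogLik (fun i => g (x j i) θ₀) ≤ elLogLik (fun i => g (x j i) (θ j))) :
    ∃ R, ∀ᶠ j in atTop, ‖Real.sqrt (n j) • (θ j - θ₀)‖ ≤ R := by
  obtain ⟨t, ht, hlim, -⟩ := h.tendsto_logRatio_and_elPhiDiv hK hL.coercive hL.inv_apply hφ
    (θ := fun _ => θ₀) (w := 0) (by simp)
  obtain ⟨l, hl, hG⟩ := hL.exists_pos_mul_norm_le
  have hM := h.bound_nonneg hK
  set a := inner ℝ (Si (z + G 0)) (z + G 0) / 2
  have h0 : Tendsto (fun j => (Real.sqrt (n j))⁻¹ * M) atTop (𝓝 0) := by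
    simpa using (tendsto_inv_sqrt_natCast h.size).mul_const M
  have hθ' : Tendsto (fun j => M * ‖θ j - θ₀‖) atTop (𝓝 0) := by
    simpa using (hθ.sub_const θ₀).norm.const_mul M
  refine ⟨2 / l * (a + 1 + (1 + M) + (‖z‖ + 1)), ?_⟩
  filter_upwards [hmax, ht, hlim.eventually_le_const (lt_add_one a), h.bound,
    h.eventually_cube_le hK hθ, h.size.eventually_gt_atTop 0,
    h0.eventually_le_const (show (0 : ℝ) < (1 / 2) ^ 3 by norm_num),
    hθ'.eventually_le_const (show 0 < l / 4 by positivity),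
    (tendsto_iff_norm_sub_tendsto_zero.1 h.jac).eventually_le_const (show 0 < l / 4 by positivity),
    h.mean.norm.eventually_le_const (lt_add_one ‖z‖), hθ (Metric.ball_mem_nhds θ₀ hK.pos)]
    with j hmj htj hlj hbj hcj hnj h0j hθj hGj hzj hball
  obtain ⟨s, hs⟩ := exists_isELMultiplier_of_elLogLik_ne_bot hmj.1
  have hle := hmj.2
  rw [hs.elLogLik_eq, htj.elLogLik_eq, EReal.coe_le_coe_iff] at hle
  have h1 := hs.sqrt_mul_norm_le hnj hcj h0j
  have hsq : 0 < Real.sqrt (n j) := by positivity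
  have h2 := hK.norm_sampleMean_taylor_le (x := x j) hball
  set m := sampleMean fun i => g (x j i) (θ j)
  set m₀ := sampleMean fun i => g (x j i) θ₀
  set D := sampleMean fun i => fderiv ℝ (g (x j i)) θ₀
  set d := θ j - θ₀
  have h3 : l * ‖d‖ ≤ ‖m‖ + ‖m₀‖ + l / 4 * ‖d‖ + l / 4 * ‖d‖ := by
    have e : G d = m - m₀ - (m - m₀ - D d) - (D - G) d := by
      rw [sub_apply]
      abel
    calc l * ‖d‖ ≤ ‖G d‖ := hG d
      _ ≤ ‖m‖ + ‖m₀‖ + ‖m - m₀ - D d‖ + ‖(D - G) d‖ := by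
          rw [e]
          refine (norm_sub_le _ _).trans ?_
          gcongr
          refine (norm_sub_le _ _).trans ?_
          gcongr
          exact norm_sub_le _ _
      _ ≤ _ := by
          gcongr
          · refine h2.trans ?_
            rw [sq, ← mul_assoc]
            gcongr
            exact le_trans (by gcongr) hθj
          · exact (ContinuousLinearMap.le_opNorm _ _).trans (by gcongr)
  rw [norm_smul, Real.norm_of_nonneg hsq.le] at hzj ⊢
  have h4 : l / 2 * (Real.sqrt (n j) * ‖d‖) ≤ Real.sqrt (n j) * ‖m‖ + Real.sqrt (n j) * ‖m₀‖ := by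
    have : l / 2 * ‖d‖ ≤ ‖m‖ + ‖m₀‖ := by linarith
    nlinarith
  rw [div_mul_eq_mul_div, le_div_iff₀ hl]
  linarith

variable {c : EuclideanSpace ℝ (Fin p) → EuclideanSpace ℝ (Fin q)}
  {Θ : Set (EuclideanSpace ℝ (Fin p))} {ρ : ℕ → ℝ}

theorem tendsto_elPhiDiv_of_isELMaximizer_of_tendsto (h : SampleLimits g θ₀ K n x z S G M)
    (hK : IsEnvelope g θ₀ K r) (hL : IsLimitData S Si G Gi C B) (hφ : IsDivGenerator φ)
    (hc : HasStrictFDerivAt c C θ₀) (hC : C.range = ⊤) (hc0 : c θ₀ = 0) (hΘ : Θ ∈ 𝓝 θ₀)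
    (hρ : Tendsto (fun j => Real.sqrt (n j) * ρ j) atTop atTop)
    (hmax : ∀ᶠ j in atTop,
      IsELMaximizer g (x j) (Θ ∩ Metric.closedBall θ₀ (ρ j) ∩ {θ | c θ = 0}) (θ j))
    (hu : Tendsto (fun j => Real.sqrt (n j) • (θ j - θ₀)) atTop (𝓝 w)) :
    Tendsto (fun j => 2 * n j / deriv (deriv φ) 1 * elPhiDiv φ fun i => g (x j i) (θ j)) atTop
      (𝓝 (‖B z‖ ^ 2)) := by
  have hsqrt : Tendsto (fun j => Real.sqrt (n j)) atTop atTop :=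
    Real.tendsto_sqrt_atTop.comp (tendsto_natCast_atTop_atTop.comp h.size)
  obtain ⟨t, ht, hlim, hdiv⟩ := h.tendsto_logRatio_and_elPhiDiv hK hL.coercive hL.inv_apply hφ hu
  obtain ⟨v, hCv, hv⟩ := hL.exists_inner_eq z
  obtain ⟨θ', hθ'c, hu'⟩ := exists_seq_of_hasStrictFDerivAt hc hC hCv hsqrt
  obtain ⟨s, hs, hlim', -⟩ := h.tendsto_logRatio_and_elPhiDiv hK hL.coercive hL.inv_apply hφ hu'
  have hCw : C w = 0 := by
    have hd : Tendsto (fun j => θ j - θ₀) atTop (𝓝 0) := by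
      simpa using (tendsto_of_smul_sub h.size hu).sub_const θ₀
    have h1 := (hc.hasFDerivAt.hasFDerivWithinAt (s := Set.univ)).lim hd
      (.of_forall fun _ => Set.mem_univ _) hu
    refine tendsto_nhds_unique h1 (tendsto_const_nhds.congr' ?_)
    filter_upwards [hmax] with j hj
    have : c (θ j) = 0 := hj.1.2
    simp [this, hc0]
  have hle : inner ℝ (Si (z + G w)) (z + G w) / 2 ≤ inner ℝ (Si (z + G v)) (z + G v) / 2 := by
    refine le_of_tendsto_of_tendsto hlim hlim' ?_
    filter_upwards [hmax, ht, hs, hθ'c, tendsto_of_smul_sub h.size hu' hΘ,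
      h.size.eventually_gt_atTop 0, hu'.norm.eventually_le_const (lt_add_one ‖v‖),
      hρ.eventually_ge_atTop (‖v‖ + 1)] with j hmj htj hsj hcj hΘj hnj hvj hρj
    have hsq : 0 < Real.sqrt (n j) := by positivity
    rw [norm_smul, Real.norm_of_nonneg hsq.le] at hvj
    have hmem : θ' j ∈ Θ ∩ Metric.closedBall θ₀ (ρ j) ∩ {θ | c θ = 0} := by
      refine ⟨⟨hΘj, ?_⟩, hcj.trans hc0⟩
      rw [mem_closedBall_iff_norm]
      exact le_of_mul_le_mul_left (hvj.trans hρj) hsq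
    have h2 := hmj.2.2 hmem
    simp only [Set.mem_ofPred_eq] at h2
    rw [hsj.elLogLik_eq, htj.elLogLik_eq, EReal.coe_le_coe_iff] at h2
    linarith
  have hge := hL.norm_sq_le (z + G w)
  rw [map_add, (hL.ker_iff w).1 hCw, add_zero] at hge
  rwa [show inner ℝ (Si (z + G w)) (z + G w) = ‖B z‖ ^ 2 by linarith] at hdiv

/-- At a constrained maximizer the rescaled divergence converges to the squared norm of `B z`. -/
theorem tendsto_elPhiDiv_of_isELMaximizer (h : SampleLimits g θ₀ K n x z S G M)
    (hK : IsEnvelope g θ₀ K r) (hL : IsLimitData S Si G Gi C B) (hφ : IsDivGenerator φ)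
    (hc : HasStrictFDerivAt c C θ₀) (hC : C.range = ⊤) (hc0 : c θ₀ = 0) (hΘ : Θ ∈ 𝓝 θ₀)
    (hρ0 : Tendsto ρ atTop (𝓝 0))
    (hρ : Tendsto (fun j => Real.sqrt (n j) * ρ j) atTop atTop)
    (hmax : ∀ᶠ j in atTop,
      IsELMaximizer g (x j) (Θ ∩ Metric.closedBall θ₀ (ρ j) ∩ {θ | c θ = 0}) (θ j)) :
    Tendsto (fun j => 2 * n j / deriv (deriv φ) 1 * elPhiDiv φ fun i => g (x j i) (θ j)) atTop
      (𝓝 (‖B z‖ ^ 2)) := by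
  have hθ : Tendsto θ atTop (𝓝 θ₀) := by
    rw [tendsto_iff_dist_tendsto_zero]
    refine squeeze_zero' (.of_forall fun _ => dist_nonneg) ?_ hρ0
    filter_upwards [hmax] with j hj using hj.1.1.2
  obtain ⟨R, hR⟩ := h.exists_eventually_norm_le hK hL hφ hθ (by
    filter_upwards [hmax, hρ.eventually_ge_atTop 0, h.size.eventually_gt_atTop 0]
      with j hj hρj hnj
    have hρ1 : 0 ≤ ρ j := nonneg_of_mul_nonneg_right hρj (by positivity)
    exact ⟨hj.2.1, hj.2.2 ⟨⟨mem_of_mem_nhds hΘ, Metric.mem_closedBall_self hρ1⟩, hc0⟩⟩)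
  refine tendsto_of_subseq_tendsto fun ns hns => ?_
  obtain ⟨w, -, ms, hms, hw⟩ := tendsto_subseq_of_frequently_bounded
    (x := fun j => Real.sqrt (n (ns j)) • (θ (ns j) - θ₀))
    (Metric.isBounded_closedBall (x := 0) (r := R))
    ((hns.eventually hR).frequently.mono fun j hj => by simpa using hj)
  have hsub : Tendsto (fun j => ns (ms j)) atTop atTop := hns.comp hms.tendsto_atTop
  exact ⟨ms, (h.comp hsub).tendsto_elPhiDiv_of_isELMaximizer_of_tendsto hK hL hφ hc hC hc0 hΘ
    (hρ.comp hsub) (hsub.eventually hmax) hw⟩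

end SampleLimits

section Uniform

variable {k p q : ℕ}
  {g : EuclideanSpace ℝ (Fin k) → EuclideanSpace ℝ (Fin p) → EuclideanSpace ℝ (Fin p)}
  {θ₀ : EuclideanSpace ℝ (Fin p)} {K : EuclideanSpace ℝ (Fin k) → ℝ} {r κ : ℝ}
  {S Si G Gi : EuclideanSpace ℝ (Fin p) →L[ℝ] EuclideanSpace ℝ (Fin p)}
  {C B : EuclideanSpace ℝ (Fin p) →L[ℝ] EuclideanSpace ℝ (Fin q)}
  {φ : ℝ → ℝ} {c : EuclideanSpace ℝ (Fin p) → EuclideanSpace ℝ (Fin q)}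
  {Θ : Set (EuclideanSpace ℝ (Fin p))} {ρ : ℕ → ℝ}

/-- The standardized mean of the estimating function at `θ₀`. -/
def scoreMean (g : EuclideanSpace ℝ (Fin k) → EuclideanSpace ℝ (Fin p) → EuclideanSpace ℝ (Fin p))
    (θ₀ : EuclideanSpace ℝ (Fin p)) {n : ℕ} (x : Fin n → EuclideanSpace ℝ (Fin k)) :
    EuclideanSpace ℝ (Fin p) :=
  Real.sqrt n • sampleMean fun i => g (x i) θ₀

/-- The deviation of the sample moments from their limits. -/
def sampleDeviation
    (g : EuclideanSpace ℝ (Fin k) → EuclideanSpace ℝ (Fin p) → EuclideanSpace ℝ (Fin p))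
    (θ₀ : EuclideanSpace ℝ (Fin p)) (K : EuclideanSpace ℝ (Fin k) → ℝ)
    (S G : EuclideanSpace ℝ (Fin p) →L[ℝ] EuclideanSpace ℝ (Fin p)) (κ : ℝ)
    {n : ℕ} (x : Fin n → EuclideanSpace ℝ (Fin k)) : ℝ :=
  ‖(sampleGram fun i => g (x i) θ₀) - S‖ + ‖(sampleMean fun i => fderiv ℝ (g (x i)) θ₀) - G‖ +
    |(sampleMean fun i => K (x i)) - κ|

theorem IsLimitData.unconstrained (hL : IsLimitData S Si G Gi C B) :
    IsLimitData S Si G Gi (0 : EuclideanSpace ℝ (Fin p) →L[ℝ] EuclideanSpace ℝ (Fin 0)) 0 :=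
  { hL with
    ker_iff := fun _ => by simp
    whiten := fun _ => Subsingleton.elim _ _ }

theorem SampleLimits.tendsto_elPhiStat {n : ℕ → ℕ} {x : ∀ j, Fin (n j) → EuclideanSpace ℝ (Fin k)}
    {z : EuclideanSpace ℝ (Fin p)} {M : ℝ} {θ₁ θ₂ : ℕ → EuclideanSpace ℝ (Fin p)}
    (h : SampleLimits g θ₀ K n x z S G M)
    (hK : IsEnvelope g θ₀ K r) (hL : IsLimitData S Si G Gi C B) (hφ : IsDivGenerator φ)
    (hc : HasStrictFDerivAt c C θ₀) (hC : C.range = ⊤) (hc0 : c θ₀ = 0) (hΘ : Θ ∈ 𝓝 θ₀)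
    (hρ0 : Tendsto ρ atTop (𝓝 0))
    (hρ : Tendsto (fun j => Real.sqrt (n j) * ρ j) atTop atTop)
    (h₁ : ∀ᶠ j in atTop, IsELMaximizer g (x j) (Θ ∩ Metric.closedBall θ₀ (ρ j)) (θ₁ j))
    (h₂ : ∀ᶠ j in atTop,
      IsELMaximizer g (x j) (Θ ∩ Metric.closedBall θ₀ (ρ j) ∩ {θ | c θ = 0}) (θ₂ j)) :
    Tendsto (fun j => elPhiStat φ g (x j) (θ₁ j) (θ₂ j)) atTop (𝓝 (‖B z‖ ^ 2)) := by
  have hlim₂ := h.tendsto_elPhiDiv_of_isELMaximizer hK hL hφ hc hC hc0 hΘ hρ0 hρ h₂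
  have hlim₁ := h.tendsto_elPhiDiv_of_isELMaximizer hK hL.unconstrained hφ
    (c := fun _ => 0) (hasStrictFDerivAt_const _ _) (Subsingleton.elim _ _) rfl hΘ hρ0 hρ
    (θ := θ₁) (by simpa using h₁)
  simpa [elPhiStat, mul_sub] using hlim₂.sub hlim₁

/-- If the sample moments are close to their limits and the standardized mean is bounded, then the
statistic is uniformly close to a quadratic form in the standardized mean. -/
theorem exists_forall_abs_elPhiStat_sub_lt
    (hK : IsEnvelope g θ₀ K r) (hL : IsLimitData S Si G Gi C B) (hφ : IsDivGenerator φ)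
    (hc : HasStrictFDerivAt c C θ₀) (hC : C.range = ⊤) (hc0 : c θ₀ = 0) (hΘ : Θ ∈ 𝓝 θ₀)
    (hρ0 : Tendsto ρ atTop (𝓝 0))
    (hρ : Tendsto (fun n : ℕ => Real.sqrt n * ρ n) atTop atTop) {ε : ℝ} (hε : 0 < ε) (R : ℝ) :
    ∃ δ > 0, ∃ N, ∀ n, N ≤ n → ∀ x : Fin n → EuclideanSpace ℝ (Fin k),
      sampleDeviation g θ₀ K S G κ x < δ → ‖scoreMean g θ₀ x‖ ≤ R →
      ∀ θ₁ θ₂, IsELMaximizer g x (Θ ∩ Metric.closedBall θ₀ (ρ n)) θ₁ →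
        IsELMaximizer g x (Θ ∩ Metric.closedBall θ₀ (ρ n) ∩ {θ | c θ = 0}) θ₂ →
        |elPhiStat φ g x θ₁ θ₂ - ‖B (scoreMean g θ₀ x)‖ ^ 2| < ε := by
  by_contra! hcon
  choose n hn x hdev hscore θ₁ θ₂ h₁ h₂ hbig using
    fun m : ℕ => hcon (1 / ((m : ℝ) + 1)) Nat.one_div_pos_of_nat m
  have hsize : Tendsto n atTop atTop := tendsto_atTop_mono hn tendsto_id
  obtain ⟨z, -, ms, hms, hz⟩ := tendsto_subseq_of_bounded
    (x := fun j => scoreMean g θ₀ (x j)) (Metric.isBounded_closedBall (x := 0) (r := R))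
    (fun j => by simpa using hscore j)
  have hms' := hms.tendsto_atTop
  have hdev0 : Tendsto (fun j => sampleDeviation g θ₀ K S G κ (x (ms j))) atTop (𝓝 0) := by
    refine squeeze_zero (fun j => by unfold sampleDeviation; positivity) (fun j => (hdev _).le) ?_
    exact tendsto_one_div_add_atTop_nhds_zero_nat.comp hms'
  have hsz : Tendsto (fun j => n (ms j)) atTop atTop := hsize.comp hms'
  have hlim : SampleLimits g θ₀ K (fun j => n (ms j)) (fun j => x (ms j)) z S G (κ + 1) :=
    { size := hsz
      mean := hz
      gram := by
        rw [tendsto_iff_norm_sub_tendsto_zero]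
        refine squeeze_zero (fun _ => norm_nonneg _) (fun j => ?_) hdev0
        unfold sampleDeviation
        linarith [norm_nonneg ((sampleMean fun i => fderiv ℝ (g (x (ms j) i)) θ₀) - G),
          abs_nonneg ((sampleMean fun i => K (x (ms j) i)) - κ)]
      jac := by
        rw [tendsto_iff_norm_sub_tendsto_zero]
        refine squeeze_zero (fun _ => norm_nonneg _) (fun j => ?_) hdev0
        unfold sampleDeviation
        linarith [norm_nonneg ((sampleGram fun i => g (x (ms j) i) θ₀) - S),
          abs_nonneg ((sampleMean fun i => K (x (ms j) i)) - κ)]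
      bound := by
        filter_upwards [hdev0.eventually_le_const one_pos] with j hj
        unfold sampleDeviation at hj
        linarith [norm_nonneg ((sampleGram fun i => g (x (ms j) i) θ₀) - S),
          norm_nonneg ((sampleMean fun i => fderiv ℝ (g (x (ms j) i)) θ₀) - G),
          le_abs_self ((sampleMean fun i => K (x (ms j) i)) - κ)] }
  have h3 := hlim.tendsto_elPhiStat (ρ := fun j => ρ (n (ms j))) hK hL hφ hc hC hc0 hΘ
    (hρ0.comp hsz) (hρ.comp hsz) (.of_forall fun j => h₁ (ms j)) (.of_forall fun j => h₂ (ms j))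
  have h4 : Tendsto (fun j => ‖B (scoreMean g θ₀ (x (ms j)))‖ ^ 2) atTop (𝓝 (‖B z‖ ^ 2)) :=
    ((B.continuous.tendsto z).comp hz).norm.pow 2
  have h5 := (h3.sub h4).abs
  rw [sub_self, abs_zero] at h5
  obtain ⟨j, hj⟩ := (h5.eventually_lt_const hε).exists
  exact hj.not_ge (hbig (ms j))

end Uniform

/-! ### Setwise convergence of laws and convergence of integrals -/

section Setwise

variable {𝓧 : Type*} [MeasurableSpace 𝓧] {F : ℕ → Measure 𝓧} {F₀ : Measure 𝓧}

theorem integrable_of_abs_le {μ : Measure 𝓧} [IsFiniteMeasure μ] {h : 𝓧 → ℝ} (hm : Measurable h)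
    {M : ℝ} (hM : ∀ x, |h x| ≤ M) : Integrable h μ :=
  Integrable.of_bound hm.aestronglyMeasurable M (.of_forall hM)

theorem tendsto_integral_of_setwise_of_abs_le
    [∀ n, IsProbabilityMeasure (F n)] [IsProbabilityMeasure F₀]
    (hF : ∀ A, MeasurableSet A → Tendsto (fun n => F n A) atTop (𝓝 (F₀ A)))
    {h : 𝓧 → ℝ} (hm : Measurable h) {M : ℝ} (hM : ∀ x, |h x| ≤ M) :
    Tendsto (fun n => ∫ x, h x ∂(F n)) atTop (𝓝 (∫ x, h x ∂F₀)) := by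
  have hlayer : ∀ (μ : Measure 𝓧) [IsProbabilityMeasure μ],
      ∫ x, h x ∂μ = (∫ t in Set.Ioc 0 (2 * M), μ.real {x | t ≤ h x + M}) - M := by
    intro μ _
    have h1 := Integrable.integral_eq_integral_Ioc_meas_le (μ := μ) (f := fun x => h x + M)
      (M := 2 * M) ((integrable_of_abs_le hm hM).add (integrable_const M))
      (.of_forall fun x => by simpa using by linarith [(abs_le.1 (hM x)).1])
      (.of_forall fun x => by linarith [(abs_le.1 (hM x)).2])
    rw [← h1, integral_add (integrable_of_abs_le hm hM) (integrable_const M)]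
    simp
  simp_rw [hlayer]
  refine Tendsto.sub_const ?_ M
  refine tendsto_integral_of_dominated_convergence (fun _ => 1) (fun n => ?_) ?_ (fun n => ?_) ?_
  · have : Antitone fun t : ℝ => (F n).real {x | t ≤ h x + M} := fun s t hst =>
      measureReal_mono fun x (hx : t ≤ h x + M) => hst.trans hx
    exact this.measurable.aestronglyMeasurable
  · exact integrable_const 1
  · exact .of_forall fun t => by
      rw [Real.norm_of_nonneg measureReal_nonneg]
      exact measureReal_le_one
  · refine .of_forall fun t => ?_
    exact (ENNReal.tendsto_toReal (measure_ne_top _ _)).comp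
      (hF _ (measurableSet_le measurable_const (hm.add_const M)))

/-- A measurable function `K ≥ 0` whose expectations under `F n` converge to the one under `F₀`. -/
structure IsIntegrableEnvelope (F : ℕ → Measure 𝓧) (F₀ : Measure 𝓧) (K : 𝓧 → ℝ) : Prop where
  measurable : Measurable K
  nonneg : ∀ x, 0 ≤ K x
  integrable_limit : Integrable K F₀
  integrable : ∀ᶠ n in atTop, Integrable K (F n)
  tendsto : Tendsto (fun n => ∫ x, K x ∂(F n)) atTop (𝓝 (∫ x, K x ∂F₀))

namespace IsIntegrableEnvelope

variable {K : 𝓧 → ℝ} {h : 𝓧 → ℝ}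

theorem tendsto_integral_sub_min [∀ n, IsProbabilityMeasure (F n)] [IsProbabilityMeasure F₀]
    (hK : IsIntegrableEnvelope F F₀ K)
    (hF : ∀ A, MeasurableSet A → Tendsto (fun n => F n A) atTop (𝓝 (F₀ A))) {M : ℝ} (hM : 0 ≤ M) :
    Tendsto (fun n => ∫ x, K x - min (K x) M ∂(F n)) atTop (𝓝 (∫ x, K x - min (K x) M ∂F₀)) := by
  have hb : ∀ x, |min (K x) M| ≤ M := fun x => by
    rw [abs_of_nonneg (le_min (hK.nonneg x) hM)]
    exact min_le_right _ _
  have hm : Measurable fun x => min (K x) M := hK.measurable.min measurable_const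
  rw [integral_sub hK.integrable_limit (integrable_of_abs_le hm hb)]
  refine (hK.tendsto.sub (tendsto_integral_of_setwise_of_abs_le hF hm hb)).congr' ?_
  filter_upwards [hK.integrable] with n hn
  rw [integral_sub hn (integrable_of_abs_le hm hb)]

theorem exists_integral_sub_min_lt (hK : IsIntegrableEnvelope F F₀ K) {ε : ℝ} (hε : 0 < ε) :
    ∃ M, 0 ≤ M ∧ ∫ x, K x - min (K x) M ∂F₀ < ε := by
  have h : Tendsto (fun m : ℕ => ∫ x, K x - min (K x) (m : ℝ) ∂F₀) atTop (𝓝 (∫ _, (0 : ℝ) ∂F₀)) := by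
    refine tendsto_integral_of_dominated_convergence K (fun m => ?_) hK.integrable_limit
      (fun m => .of_forall fun x => ?_) (.of_forall fun x => ?_)
    · exact (hK.measurable.sub (hK.measurable.min measurable_const)).aestronglyMeasurable
    · rw [Real.norm_of_nonneg (sub_nonneg.2 (min_le_left _ _))]
      linarith [le_min (hK.nonneg x) (Nat.cast_nonneg (α := ℝ) m)]
    · refine tendsto_const_nhds.congr' ?_
      filter_upwards [eventually_ge_atTop ⌈K x⌉₊] with m hm
      rw [min_eq_left ((Nat.le_ceil _).trans (Nat.cast_le.2 hm)), sub_self]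
  rw [integral_zero] at h
  obtain ⟨m, hm⟩ := (h.eventually_lt_const hε).exists
  exact ⟨m, Nat.cast_nonneg m, hm⟩

end IsIntegrableEnvelope

theorem abs_clamp_le {a M : ℝ} (hM : 0 ≤ M) : |max (-M) (min a M)| ≤ M :=
  abs_le.2 ⟨le_max_left _ _, max_le (by linarith) (min_le_right _ _)⟩

theorem abs_sub_clamp_le {a b M : ℝ} (hM : 0 ≤ M) (hab : |a| ≤ b) :
    |a - max (-M) (min a M)| ≤ b - min b M := by
  have := abs_le.1 hab
  rw [abs_le]
  rcases max_cases (-M) (min a M) with h | h <;> rcases min_cases a M with h' | h' <;>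
    rcases min_cases b M with h'' | h'' <;> constructor <;> linarith

theorem measurable_clamp {h : 𝓧 → ℝ} (hm : Measurable h) (M : ℝ) :
    Measurable fun x => max (-M) (min (h x) M) :=
  measurable_const.max (hm.min measurable_const)

theorem IsIntegrableEnvelope.abs_integral_sub_clamp_le {K h : 𝓧 → ℝ} {μ : Measure 𝓧}
    [IsProbabilityMeasure μ] (hKm : Integrable K μ) (hm : Measurable h)
    (hh : ∀ x, |h x| ≤ K x) {M : ℝ} (hM : 0 ≤ M) (hmin : Integrable (fun x => min (K x) M) μ) :
    |(∫ x, h x ∂μ) - ∫ x, max (-M) (min (h x) M) ∂μ| ≤ ∫ x, K x - min (K x) M ∂μ := by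
  have h1 : Integrable h μ := hKm.mono' hm.aestronglyMeasurable (.of_forall hh)
  rw [← integral_sub h1 (integrable_of_abs_le (measurable_clamp hm M) fun x => abs_clamp_le hM)]
  refine abs_integral_le_integral_abs.trans (integral_mono_of_nonneg (.of_forall fun _ => abs_nonneg _)
    (hKm.sub hmin) (.of_forall fun x => abs_sub_clamp_le hM (hh x)))

theorem IsIntegrableEnvelope.integrable_min {K : 𝓧 → ℝ} (hK : IsIntegrableEnvelope F F₀ K)
    {μ : Measure 𝓧} [IsProbabilityMeasure μ] {M : ℝ} (hM : 0 ≤ M) :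
    Integrable (fun x => min (K x) M) μ :=
  integrable_of_abs_le (hK.measurable.min measurable_const) fun x => by
    rw [abs_of_nonneg (le_min (hK.nonneg x) hM)]
    exact min_le_right _ _

theorem IsIntegrableEnvelope.tendsto_integral [∀ n, IsProbabilityMeasure (F n)] [IsProbabilityMeasure F₀]
    {K h : 𝓧 → ℝ} (hK : IsIntegrableEnvelope F F₀ K)
    (hF : ∀ A, MeasurableSet A → Tendsto (fun n => F n A) atTop (𝓝 (F₀ A)))
    (hm : Measurable h) (hh : ∀ x, |h x| ≤ K x) :
    Tendsto (fun n => ∫ x, h x ∂(F n)) atTop (𝓝 (∫ x, h x ∂F₀)) := by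
  rw [Metric.tendsto_nhds]
  intro ε hε
  obtain ⟨M, hM, hlt⟩ := hK.exists_integral_sub_min_lt (show 0 < ε / 3 by positivity)
  filter_upwards [hK.integrable, (hK.tendsto_integral_sub_min hF hM).eventually_lt_const hlt,
    (tendsto_iff_dist_tendsto_zero.1 (tendsto_integral_of_setwise_of_abs_le hF
      (measurable_clamp hm M) fun x => abs_clamp_le hM)).eventually_lt_const
      (show 0 < ε / 3 by positivity)] with n h1 h2 h3
  rw [Real.dist_eq] at h3 ⊢
  have h4 := abs_integral_sub_clamp_le h1 hm hh hM (hK.integrable_min hM)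
  have h5 := abs_integral_sub_clamp_le hK.integrable_limit hm hh hM (hK.integrable_min hM)
  rw [abs_sub_comm] at h5
  set a := ∫ x, max (-M) (min (h x) M) ∂(F n)
  set b := ∫ x, max (-M) (min (h x) M) ∂F₀
  have h6 := abs_sub_le (∫ x, h x ∂(F n)) a (∫ x, h x ∂F₀)
  have h7 := abs_sub_le a b (∫ x, h x ∂F₀)
  linarith

end Setwise

/-! ### Averages over independent observations -/

section Averages

variable {𝓧 Ω : Type*} [MeasurableSpace 𝓧] [MeasurableSpace Ω] {μ : Measure 𝓧}
  {P : Measure Ω} {n : ℕ} {X : Fin n → Ω → 𝓧} {h : 𝓧 → ℝ}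

theorem ProbabilityTheory.HasLaw.memLp_fun_comp {Y : Ω → 𝓧} {s : ENNReal}
    (hY : HasLaw Y μ P) (hh : MemLp h s μ) :
    MemLp (fun ω => h (Y ω)) s P := by
  rw [← hY.map_eq] at hh
  exact hh.comp_of_map hY.aemeasurable

theorem ProbabilityTheory.HasLaw.integrable_fun_comp {Y : Ω → 𝓧} (hY : HasLaw Y μ P)
    (hh : Integrable h μ) :
    Integrable (fun ω => h (Y ω)) P := by
  rw [← hY.map_eq] at hh
  exact hh.comp_aemeasurable hY.aemeasurable

theorem ProbabilityTheory.HasLaw.integral_fun_comp {Y : Ω → 𝓧} (hY : HasLaw Y μ P)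
    (hm : AEStronglyMeasurable h μ) : ∫ ω, h (Y ω) ∂P = ∫ x, h x ∂μ :=
  hY.integral_comp hm

theorem integrable_sampleMean (hX : ∀ i, HasLaw (X i) μ P) (hh : Integrable h μ) :
    Integrable (fun ω => sampleMean fun i => h (X i ω)) P := by
  simp only [sampleMean, smul_eq_mul]
  exact (integrable_finsetSum _ fun i _ => (hX i).integrable_fun_comp hh).const_mul _

theorem integral_sampleMean (hn : 0 < n) (hX : ∀ i, HasLaw (X i) μ P) (hh : Integrable h μ) :
    ∫ ω, (sampleMean fun i => h (X i ω)) ∂P = ∫ x, h x ∂μ := by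
  simp only [sampleMean, smul_eq_mul]
  rw [integral_const_mul, integral_finsetSum _ fun i _ => (hX i).integrable_fun_comp hh]
  simp_rw [fun i => (hX i).integral_fun_comp hh.aestronglyMeasurable]
  simp [hn.ne']

theorem memLp_two_sampleMean (hX : ∀ i, HasLaw (X i) μ P) (hh : MemLp h 2 μ) :
    MemLp (fun ω => sampleMean fun i => h (X i ω)) 2 P := by
  simp only [sampleMean, smul_eq_mul]
  exact (memLp_finsetSum _ fun i _ => (hX i).memLp_fun_comp hh).const_mul _

theorem integral_sq_sampleMean_sub_le [IsProbabilityMeasure μ] [IsProbabilityMeasure P]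
    (hn : 0 < n) (hX : ∀ i, HasLaw (X i) μ P)
    (hind : iIndepFun X P) (hm : Measurable h) (hh : MemLp h 2 μ) :
    ∫ ω, ((sampleMean fun i => h (X i ω)) - ∫ x, h x ∂μ) ^ 2 ∂P ≤ (n : ℝ)⁻¹ * ∫ x, h x ^ 2 ∂μ := by
  have hL := memLp_two_sampleMean hX hh
  rw [← integral_sampleMean hn hX (hh.integrable (by norm_num)),
    ← variance_eq_integral hL.aestronglyMeasurable.aemeasurable]
  simp only [sampleMean, smul_eq_mul]
  rw [variance_const_mul]
  have h1 : Var[fun ω => ∑ i, h (X i ω); P] = ∑ i, Var[fun ω => h (X i ω); P] := by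
    have := IndepFun.variance_sum (μ := P) (X := fun i ω => h (X i ω)) (s := Finset.univ)
      (fun i _ => (hX i).memLp_fun_comp hh)
      (fun i _ j _ hij => (hind.indepFun hij).comp hm hm)
    rwa [show (∑ i, fun ω => h (X i ω)) = fun ω => ∑ i, h (X i ω) from by ext; simp] at this
  have h2 : ∀ i, Var[fun ω => h (X i ω); P] ≤ ∫ x, h x ^ 2 ∂μ := fun i => by
    refine (variance_le_expectation_sq
      ((hX i).memLp_fun_comp hh).aestronglyMeasurable).trans_eq ?_
    exact (hX i).integral_comp (f := fun x => h x ^ 2) (by fun_prop)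
  rw [h1]
  calc _ ≤ (n : ℝ)⁻¹ ^ 2 * ∑ _i : Fin n, ∫ x, h x ^ 2 ∂μ := by
        gcongr with i
        exact h2 i
    _ = _ := by
        simp
        field_simp

end Averages

section LawOfLargeNumbers

variable {𝓧 : Type*} [MeasurableSpace 𝓧] {F : ℕ → Measure 𝓧} [∀ n, IsProbabilityMeasure (F n)]
  {F₀ : Measure 𝓧} [IsProbabilityMeasure F₀] {Ω : ℕ → Type*} [∀ n, MeasurableSpace (Ω n)]
  {P : ∀ n, Measure (Ω n)} [∀ n, IsProbabilityMeasure (P n)] {X : ∀ n, Fin n → Ω n → 𝓧}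

/-- Law of large numbers in `L¹` for triangular arrays, under a uniformly integrable envelope. -/
theorem IsIntegrableEnvelope.tendsto_integral_abs_sampleMean_sub {K h : 𝓧 → ℝ}
    (hK : IsIntegrableEnvelope F F₀ K)
    (hF : ∀ A, MeasurableSet A → Tendsto (fun n => F n A) atTop (𝓝 (F₀ A)))
    (hlaw : ∀ n i, HasLaw (X n i) (F n) (P n)) (hindep : ∀ n, iIndepFun (X n) (P n))
    (hm : Measurable h) (hh : ∀ x, |h x| ≤ K x) :
    Tendsto (fun n => ∫ ω, |(sampleMean fun i => h (X n i ω)) - ∫ x, h x ∂F₀| ∂(P n)) atTop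
      (𝓝 0) := by
  rw [Metric.tendsto_nhds]
  intro ε hε
  set η := ε / 5 with hη
  have hη0 : 0 < η := by positivity
  obtain ⟨M, hM, hlt⟩ := hK.exists_integral_sub_min_lt hη0
  set hM' : 𝓧 → ℝ := fun x => max (-M) (min (h x) M) with hhM
  have hMm : Measurable hM' := measurable_clamp hm M
  have hMb : ∀ x, |hM' x| ≤ M := fun x => abs_clamp_le hM
  have hsm : Tendsto (fun n : ℕ => η⁻¹ * ((n : ℝ)⁻¹ * M ^ 2)) atTop (𝓝 0) := by
    simpa using (tendsto_inv_atTop_nhds_zero_nat (𝕜 := ℝ)).mul_const (M ^ 2) |>.const_mul η⁻¹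
  filter_upwards [hK.integrable, (hK.tendsto_integral_sub_min hF hM).eventually_lt_const hlt,
    (tendsto_iff_dist_tendsto_zero.1
      (tendsto_integral_of_setwise_of_abs_le hF hMm hMb)).eventually_lt_const hη0,
    hsm.eventually_lt_const hη0, eventually_gt_atTop 0] with n h1 h2 h3 h4 hn
  rw [Real.dist_eq] at h3
  have h5 := abs_integral_sub_clamp_le hK.integrable_limit hm hh hM (hK.integrable_min hM)
  set a := ∫ x, hM' x ∂(F n)
  set b := ∫ x, hM' x ∂F₀
  set c := ∫ x, h x ∂F₀
  have htail : Integrable (fun x => K x - min (K x) M) (F n) := h1.sub (hK.integrable_min hM)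
  have hLp : MemLp hM' 2 (F n) := MemLp.of_bound hMm.aestronglyMeasurable M (.of_forall hMb)
  have hpt : ∀ ω, |(sampleMean fun i => h (X n i ω)) - c| ≤
      (sampleMean fun i => K (X n i ω) - min (K (X n i ω)) M) +
      η⁻¹ * ((sampleMean fun i => hM' (X n i ω)) - a) ^ 2 + 3 * η := by
    intro ω
    have e1 : |(sampleMean fun i => h (X n i ω)) - sampleMean fun i => hM' (X n i ω)| ≤
        sampleMean fun i => K (X n i ω) - min (K (X n i ω)) M := by
      rw [← sampleMean_sub, ← Real.norm_eq_abs]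
      refine (norm_sampleMean_le _).trans (sampleMean_mono fun i => ?_)
      exact abs_sub_clamp_le hM (hh (X n i ω))
    set m := sampleMean fun i => hM' (X n i ω)
    have e2 : |m - a| ≤ η⁻¹ * (m - a) ^ 2 + η := by
      rw [← sq_abs, inv_mul_eq_div, ← sub_le_iff_le_add, le_div_iff₀ hη0]
      nlinarith [sq_nonneg (|m - a| - η), mul_nonneg hη0.le (abs_nonneg (m - a)),
        sq_nonneg |m - a|]
    have e3 := abs_sub_le (sampleMean fun i => h (X n i ω)) m c
    have e4 := abs_sub_le m a c
    have e5 := abs_sub_le a b c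
    rw [abs_sub_comm] at h5
    linarith
  have hint1 := integrable_sampleMean (hlaw n) htail
  have hint2 : Integrable (fun ω => ((sampleMean fun i => hM' (X n i ω)) - a) ^ 2) (P n) :=
    ((memLp_two_sampleMean (hlaw n) hLp).sub (memLp_const a)).integrable_sq
  have hvar := integral_sq_sampleMean_sub_le hn (hlaw n) (hindep n) hMm hLp
  have hsq : ∫ x, hM' x ^ 2 ∂(F n) ≤ M ^ 2 := by
    calc _ ≤ ∫ _, M ^ 2 ∂(F n) := by
          refine integral_mono hLp.integrable_sq (integrable_const _) fun x => ?_
          exact sq_le_sq' (abs_le.1 (hMb x)).1 (abs_le.1 (hMb x)).2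
      _ = M ^ 2 := by simp
  rw [Real.dist_eq, sub_zero, abs_of_nonneg (integral_nonneg fun _ => abs_nonneg _)]
  calc _ ≤ ∫ ω, ((sampleMean fun i => K (X n i ω) - min (K (X n i ω)) M) +
      η⁻¹ * ((sampleMean fun i => hM' (X n i ω)) - a) ^ 2 + 3 * η) ∂(P n) :=
        integral_mono_of_nonneg (.of_forall fun _ => abs_nonneg _)
          ((hint1.add (hint2.const_mul _)).add (integrable_const _)) (.of_forall hpt)
    _ = (∫ x, K x - min (K x) M ∂(F n)) +
        η⁻¹ * (∫ ω, ((sampleMean fun i => hM' (X n i ω)) - a) ^ 2 ∂(P n)) + 3 * η := by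
        have hint3 : Integrable (fun ω =>
            (sampleMean fun i => K (X n i ω) - min (K (X n i ω)) M) +
              η⁻¹ * ((sampleMean fun i => hM' (X n i ω)) - a) ^ 2) (P n) :=
          hint1.add (hint2.const_mul _)
        rw [integral_add hint3 (integrable_const _), integral_add hint1 (hint2.const_mul _), integral_const_mul,
          integral_sampleMean hn (hlaw n) htail]
        simp
    _ < η + η + 3 * η := by
        have : η⁻¹ * (∫ ω, ((sampleMean fun i => hM' (X n i ω)) - a) ^ 2 ∂(P n)) ≤
            η⁻¹ * ((n : ℝ)⁻¹ * M ^ 2) := by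
          gcongr
          exact hvar.trans (by gcongr)
        linarith
    _ = ε := by rw [hη]; ring

end LawOfLargeNumbers

/-! ### Central limit theorem for triangular arrays -/

theorem norm_exp_mul_I_sub_le (x : ℝ) :
    ‖Complex.exp (x * Complex.I) - (1 + (x * Complex.I - x ^ 2 / 2))‖ ≤ 4 * |x| ^ 3 := by
  rcases le_or_gt |x| 1 with hx | hx
  · have h := Complex.exp_bound (x := x * Complex.I) (by simpa using hx) (n := 3) (by norm_num)
    have e : ∑ m ∈ Finset.range 3, (x * Complex.I : ℂ) ^ m / (m.factorial : ℂ) =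
        1 + (x * Complex.I - x ^ 2 / 2) := by
      simp [Finset.sum_range_succ, mul_pow, Nat.factorial]
      ring
    rw [e] at h
    refine h.trans ?_
    simp only [Complex.norm_mul, Complex.norm_real, Real.norm_eq_abs, Complex.norm_I, mul_one]
    have : (0 : ℝ) ≤ |x| ^ 3 := by positivity
    norm_num [Nat.factorial]
    linarith
  · have h1 : ‖Complex.exp (x * Complex.I)‖ = 1 := Complex.norm_exp_ofReal_mul_I x
    have h2 : ‖(1 + (x * Complex.I - x ^ 2 / 2) : ℂ)‖ ≤ 1 + (|x| + |x| ^ 2 / 2) := by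
      refine (norm_add_le _ _).trans ?_
      rw [norm_one]
      gcongr
      refine (norm_sub_le _ _).trans ?_
      simp
    have h3 : |x| ≤ |x| ^ 3 := le_self_pow₀ hx.le (by norm_num)
    have h4 : |x| ^ 2 ≤ |x| ^ 3 := pow_le_pow_right₀ hx.le (by norm_num)
    have := norm_sub_le (Complex.exp (x * Complex.I)) (1 + (x * Complex.I - x ^ 2 / 2) : ℂ)
    linarith

section CentralLimit

variable {𝓧 : Type*} [MeasurableSpace 𝓧] {F : ℕ → Measure 𝓧}
  {Ω : ℕ → Type*} [∀ n, MeasurableSpace (Ω n)]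
  {P : ∀ n, Measure (Ω n)} {X : ∀ n, Fin n → Ω n → 𝓧}

theorem integral_exp_sqrt_mul_sampleMean {n : ℕ}
    (hlaw : ∀ i, HasLaw (X n i) (F n) (P n)) (hindep : iIndepFun (X n) (P n))
    {h : 𝓧 → ℝ} (hm : Measurable h) :
    ∫ ω, Complex.exp ((Real.sqrt n * sampleMean fun i => h (X n i ω) : ℝ) * Complex.I) ∂(P n) =
      (∫ x, Complex.exp (((Real.sqrt n)⁻¹ * h x : ℝ) * Complex.I) ∂(F n)) ^ n := by
  have hae : ∀ i, AEMeasurable (fun ω => h (X n i ω)) (P n) := fun i =>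
    hm.comp_aemeasurable (hlaw i).aemeasurable
  have h1 := iIndepFun.charFun_map_fun_finsetSum_eq_prod (P := P n) (s := Finset.univ)
    (X := fun i ω => h (X n i ω)) (fun i _ => hae i)
    ((hindep.comp (fun _ => h) (fun _ => hm)).restrict _)
  have h2 := congrFun h1 (Real.sqrt n)⁻¹
  rw [Finset.prod_apply, charFun_apply_real, integral_map
    (Finset.aemeasurable_fun_sum _ fun i _ => hae i) (by fun_prop)] at h2
  have h3 : ∀ i, charFun (Measure.map (fun ω => h (X n i ω)) (P n)) (Real.sqrt n)⁻¹ =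
      ∫ x, Complex.exp (((Real.sqrt n)⁻¹ * h x : ℝ) * Complex.I) ∂(F n) := by
    intro i
    rw [charFun_apply_real, integral_map (hae i) (by fun_prop)]
    simp_rw [← Complex.ofReal_mul]
    exact (hlaw i).integral_comp
      (f := fun x => Complex.exp (((Real.sqrt n)⁻¹ * h x : ℝ) * Complex.I))
      (by fun_prop)
  simp_rw [h3, Finset.prod_const, Finset.card_univ, Fintype.card_fin] at h2
  rw [← h2]
  refine integral_congr_ae (.of_forall fun ω => ?_)
  simp only [sampleMean, smul_eq_mul]
  rw [← Complex.ofReal_mul]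
  congr 3
  rw [← mul_assoc, ← div_eq_mul_inv, Real.sqrt_div_self']
  simp

variable [∀ n, IsProbabilityMeasure (F n)]

theorem tendsto_integral_exp_sqrt_mul_sampleMean
    (hlaw : ∀ n i, HasLaw (X n i) (F n) (P n)) (hindep : ∀ n, iIndepFun (X n) (P n))
    {h : 𝓧 → ℝ} (hm : Measurable h) {m v b : ℝ}
    (hmean : Tendsto (fun n : ℕ => Real.sqrt n * ∫ x, h x ∂(F n)) atTop (𝓝 m))
    (hvar : Tendsto (fun n => ∫ x, h x ^ 2 ∂(F n)) atTop (𝓝 v))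
    (hint : ∀ᶠ n in atTop, Integrable (fun x => |h x| ^ 3) (F n))
    (hcube : ∀ᶠ n in atTop, ∫ x, |h x| ^ 3 ∂(F n) ≤ b) :
    Tendsto (fun n : ℕ => ∫ ω, Complex.exp
        ((Real.sqrt n * sampleMean fun i => h (X n i ω) : ℝ) * Complex.I) ∂(P n)) atTop
      (𝓝 (Complex.exp (m * Complex.I - v / 2))) := by
  set e : ℕ → ℂ := fun n => ∫ x, Complex.exp (((Real.sqrt n)⁻¹ * h x : ℝ) * Complex.I) ∂(F n)
  have hlim : Tendsto (fun n : ℕ => (n : ℂ) * (e n - 1)) atTop (𝓝 (m * Complex.I - v / 2)) := by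
    have h1 : Tendsto (fun n : ℕ => (((Real.sqrt n * ∫ x, h x ∂(F n) : ℝ) : ℂ) * Complex.I -
        ((∫ x, h x ^ 2 ∂(F n) : ℝ) : ℂ) / 2)) atTop (𝓝 (m * Complex.I - v / 2)) :=
      (((Complex.continuous_ofReal.tendsto _).comp hmean).mul_const _).sub
        (((Complex.continuous_ofReal.tendsto _).comp hvar).div_const _)
    have h2 : Tendsto (fun n : ℕ => 4 * ((Real.sqrt n)⁻¹ * b)) atTop (𝓝 0) := by
      simpa using ((tendsto_inv_sqrt_natCast tendsto_id).mul_const b).const_mul 4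
    refine tendsto_of_tendsto_of_dist h1 (squeeze_zero' (.of_forall fun _ => dist_nonneg) ?_ h2)
    filter_upwards [hint, hcube, eventually_gt_atTop 0] with n hi hc hn
    have hs : 0 < Real.sqrt n := by positivity
    have hnorm : MemLp h 3 (F n) := by
      rw [← integrable_norm_rpow_iff hm.aestronglyMeasurable (by norm_num) (by norm_num)]
      simpa [Real.norm_eq_abs] using hi
    have hi2 : Integrable (fun x => h x ^ 2) (F n) :=
      (hnorm.mono_exponent (by norm_num)).integrable_sq
    have hi1 : Integrable h (F n) := hnorm.integrable (by norm_num)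
    set s := (Real.sqrt n)⁻¹ with hsdef
    have hiexp : Integrable (fun x => Complex.exp ((s * h x : ℝ) * Complex.I)) (F n) :=
      Integrable.of_bound (by fun_prop) 1 (.of_forall fun x => by
        rw [Complex.norm_exp_ofReal_mul_I])
    have hl : Integrable (fun x => ((s * h x : ℝ) : ℂ) * Complex.I) (F n) :=
      (show Integrable (fun x => ((s * h x : ℝ) : ℂ)) (F n) from
        (hi1.const_mul s).ofReal).mul_const _
    have hq : Integrable (fun x => ((s * h x : ℝ) : ℂ) ^ 2 / 2) (F n) := by
      have h3 : Integrable (fun x => ((s ^ 2 / 2 * h x ^ 2 : ℝ) : ℂ)) (F n) :=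
        (hi2.const_mul (s ^ 2 / 2)).ofReal
      refine h3.congr (.of_forall fun x => ?_)
      push_cast
      ring
    have hilin : Integrable (fun x => ((s * h x : ℝ) : ℂ) * Complex.I -
        ((s * h x : ℝ) : ℂ) ^ 2 / 2) (F n) := hl.sub hq
    have hisum : Integrable (fun x => 1 + (((s * h x : ℝ) : ℂ) * Complex.I -
        ((s * h x : ℝ) : ℂ) ^ 2 / 2)) (F n) := (integrable_const _).add hilin
    have hrem : ‖∫ x, (Complex.exp ((s * h x : ℝ) * Complex.I) -
        (1 + (((s * h x : ℝ) : ℂ) * Complex.I - ((s * h x : ℝ) : ℂ) ^ 2 / 2))) ∂(F n)‖ ≤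
        4 * (s ^ 3 * b) := by
      calc _ ≤ ∫ x, 4 * (s ^ 3 * |h x| ^ 3) ∂(F n) := by
            refine norm_integral_le_of_norm_le ((hi.const_mul _).const_mul _)
              (.of_forall fun x => ?_)
            refine (norm_exp_mul_I_sub_le _).trans_eq ?_
            rw [abs_mul, mul_pow, abs_of_pos (show 0 < s by positivity)]
        _ = 4 * (s ^ 3 * ∫ x, |h x| ^ 3 ∂(F n)) := by
            rw [integral_const_mul, integral_const_mul]
        _ ≤ _ := by gcongr
    have hlinval : ∫ x, (((s * h x : ℝ) : ℂ) * Complex.I - ((s * h x : ℝ) : ℂ) ^ 2 / 2) ∂(F n) =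
        ((s * ∫ x, h x ∂(F n) : ℝ) : ℂ) * Complex.I -
          ((s ^ 2 * ∫ x, h x ^ 2 ∂(F n) : ℝ) : ℂ) / 2 := by
      rw [integral_sub hl hq, integral_mul_const,
        integral_div, integral_complex_ofReal, integral_const_mul]
      congr 2
      rw [← integral_const_mul, ← integral_complex_ofReal]
      refine integral_congr_ae (.of_forall fun x => ?_)
      push_cast
      ring
    rw [integral_sub hiexp hisum, integral_add (integrable_const _) hilin,
      hlinval] at hrem
    have hns : (n : ℝ) * s = Real.sqrt n := by
      rw [hsdef, ← div_eq_mul_inv, Real.div_sqrt]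
    have hns2 : (n : ℝ) * s ^ 2 = 1 := by
      rw [sq, ← mul_assoc, hns, hsdef, mul_inv_cancel₀ hs.ne']
    rw [dist_comm, dist_eq_norm]
    have hfac : (n : ℂ) * (e n - 1) - (((Real.sqrt n * ∫ x, h x ∂(F n) : ℝ) : ℂ) * Complex.I -
        ((∫ x, h x ^ 2 ∂(F n) : ℝ) : ℂ) / 2) =
        (n : ℂ) * (e n - (∫ _, (1 : ℂ) ∂(F n) + (((s * ∫ x, h x ∂(F n) : ℝ) : ℂ) * Complex.I -
          ((s ^ 2 * ∫ x, h x ^ 2 ∂(F n) : ℝ) : ℂ) / 2))) := by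
      have e1 : ((Real.sqrt n * ∫ x, h x ∂(F n) : ℝ) : ℂ) =
          n * ((s * ∫ x, h x ∂(F n) : ℝ) : ℂ) := by
        rw [← hns, mul_assoc]
        push_cast
        rfl
      have e2 : ((∫ x, h x ^ 2 ∂(F n) : ℝ) : ℂ) =
          n * ((s ^ 2 * ∫ x, h x ^ 2 ∂(F n) : ℝ) : ℂ) := by
        rw [← Complex.ofReal_natCast, ← Complex.ofReal_mul, ← mul_assoc, hns2, one_mul]
      rw [e1]
      nth_rewrite 1 [e2]
      simp
      ring
    rw [hfac, norm_mul, Complex.norm_natCast]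
    calc _ ≤ (n : ℝ) * (4 * (s ^ 3 * b)) := by gcongr
      _ = 4 * (((n : ℝ) * s ^ 2) * s * b) := by ring
      _ = 4 * (s * b) := by rw [hns2, one_mul]
  refine (Complex.tendsto_one_add_pow_exp_of_tendsto hlim).congr fun n => ?_
  rw [integral_exp_sqrt_mul_sampleMean (hlaw n) (hindep n) hm]
  congr 1
  ring

end CentralLimit

/-! ### Matrices as operators between Euclidean spaces -/

section MatrixOperators

open scoped Matrix

/-- The continuous linear map between Euclidean spaces with a given matrix. -/
def matCLM {m n : ℕ} (A : Matrix (Fin m) (Fin n) ℝ) :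
    EuclideanSpace ℝ (Fin n) →L[ℝ] EuclideanSpace ℝ (Fin m) :=
  (Matrix.toLpLin 2 2 A).toContinuousLinearMap

theorem ofLp_matCLM {m n : ℕ} (A : Matrix (Fin m) (Fin n) ℝ) (v : EuclideanSpace ℝ (Fin n)) :
    (matCLM A v).ofLp = A *ᵥ v.ofLp := rfl

theorem matCLM_mul_apply {l m n : ℕ} (A : Matrix (Fin l) (Fin m) ℝ) (B : Matrix (Fin m) (Fin n) ℝ)
    (v : EuclideanSpace ℝ (Fin n)) : matCLM (A * B) v = matCLM A (matCLM B v) := by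
  apply WithLp.ofLp_injective
  simp [ofLp_matCLM, Matrix.mulVec_mulVec]

theorem matCLM_one_apply {n : ℕ} (v : EuclideanSpace ℝ (Fin n)) : matCLM 1 v = v := by
  apply WithLp.ofLp_injective
  simp [ofLp_matCLM]

theorem inner_matCLM {m n : ℕ} (A : Matrix (Fin m) (Fin n) ℝ) (v : EuclideanSpace ℝ (Fin m))
    (w : EuclideanSpace ℝ (Fin n)) : inner ℝ v (matCLM A w) = v.ofLp ⬝ᵥ A *ᵥ w.ofLp := by
  rw [EuclideanSpace.inner_eq_star_dotProduct, ofLp_matCLM, dotProduct_comm]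
  simp

theorem adjoint_matCLM {m n : ℕ} (A : Matrix (Fin m) (Fin n) ℝ) :
    ContinuousLinearMap.adjoint (matCLM A) = matCLM Aᵀ := by
  symm
  rw [ContinuousLinearMap.eq_adjoint_iff]
  intro v w
  rw [inner_matCLM, real_inner_comm, inner_matCLM, Matrix.dotProduct_mulVec,
    Matrix.vecMul_transpose, dotProduct_comm]

theorem matCLM_single {m n : ℕ} (A : Matrix (Fin m) (Fin n) ℝ) (j : Fin n) (i : Fin m) :
    matCLM A (EuclideanSpace.single j 1) i = A i j := by
  simp [ofLp_matCLM]

theorem clm_apply_eq_sum {m n : ℕ} (L : EuclideanSpace ℝ (Fin n) →L[ℝ] EuclideanSpace ℝ (Fin m))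
    (v : EuclideanSpace ℝ (Fin n)) (i : Fin m) :
    L v i = ∑ j, v j * L (EuclideanSpace.single j 1) i := by
  have hv : v = ∑ j, v j • EuclideanSpace.single j (1 : ℝ) := by
    ext i
    simp [Finset.sum_apply, Pi.single_apply]
  conv_lhs => rw [hv, map_sum]
  simp [Finset.sum_apply]

theorem fderiv_eq_matCLM_jacobian {p m : ℕ}
    (h : EuclideanSpace ℝ (Fin p) → EuclideanSpace ℝ (Fin m)) (θ : EuclideanSpace ℝ (Fin p)) :
    fderiv ℝ h θ = matCLM (jacobian h θ) := by
  ext v i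
  rw [clm_apply_eq_sum (fderiv ℝ h θ), clm_apply_eq_sum (matCLM _)]
  simp_rw [matCLM_single]
  rfl

theorem opNorm_le_sum_entries {m n : ℕ}
    (L : EuclideanSpace ℝ (Fin n) →L[ℝ] EuclideanSpace ℝ (Fin m)) :
    ‖L‖ ≤ ∑ i, ∑ j, |L (EuclideanSpace.single j 1) i| := by
  refine L.opNorm_le_bound (Finset.sum_nonneg fun i _ => Finset.sum_nonneg fun j _ => abs_nonneg _)
    fun v => ?_
  have h1 : L v = ∑ i, L v i • EuclideanSpace.single i (1 : ℝ) := by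
    ext i
    simp [Finset.sum_apply, Pi.single_apply]
  calc ‖L v‖ ≤ ∑ i, |L v i| := by
        conv_lhs => rw [h1]
        refine (norm_sum_le _ _).trans_eq ?_
        simp [norm_smul]
    _ ≤ ∑ i, ∑ j, |L (EuclideanSpace.single j 1) i| * ‖v‖ := by
        refine Finset.sum_le_sum fun i _ => ?_
        rw [clm_apply_eq_sum]
        refine (Finset.abs_sum_le_sum_abs _ _).trans (Finset.sum_le_sum fun j _ => ?_)
        rw [abs_mul, mul_comm]
        gcongr
        exact PiLp.norm_apply_le v j
    _ = _ := by simp_rw [Finset.sum_mul]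

open scoped MatrixOrder in
theorem Matrix.PosDef.exists_transpose_mul_self {n : ℕ} {A : Matrix (Fin n) (Fin n) ℝ}
    (hA : A.PosDef) : ∃ R : Matrix (Fin n) (Fin n) ℝ, Rᵀ * R = A ∧ IsUnit R := by
  obtain ⟨R, hR⟩ := CStarAlgebra.nonneg_iff_eq_star_mul_self.1
    (Matrix.nonneg_iff_posSemidef.2 hA.posSemidef)
  have hR' : Rᵀ * R = A := by
    rw [hR, Matrix.star_eq_conjTranspose, Matrix.conjTranspose_eq_transpose_of_trivial]
  refine ⟨R, hR', ?_⟩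
  have h := hA.isUnit
  rw [← hR'] at h
  exact (Matrix.isUnit_iff_isUnit_det _).2 (by
    have := (Matrix.isUnit_iff_isUnit_det _).1 h
    rw [Matrix.det_mul] at this
    exact isUnit_of_mul_isUnit_right this)

theorem Matrix.PosDef.exists_mul_norm_sq_le {n : ℕ} {A : Matrix (Fin n) (Fin n) ℝ}
    (hA : A.PosDef) : ∃ l > 0, ∀ v, l * ‖v‖ ^ 2 ≤ inner ℝ v (matCLM A v) := by
  obtain ⟨R, hR, hu⟩ := hA.exists_transpose_mul_self
  refine ⟨((‖matCLM R⁻¹‖ + 1) ^ 2)⁻¹, by positivity, fun v => ?_⟩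
  have h1 : inner ℝ v (matCLM A v) = ‖matCLM R v‖ ^ 2 := by
    rw [← hR, matCLM_mul_apply, ← adjoint_matCLM, ContinuousLinearMap.adjoint_inner_right,
      real_inner_self_eq_norm_sq]
  have h2 : ‖v‖ ≤ (‖matCLM R⁻¹‖ + 1) * ‖matCLM R v‖ := by
    calc ‖v‖ = ‖matCLM R⁻¹ (matCLM R v)‖ := by
          rw [← matCLM_mul_apply, Matrix.nonsing_inv_mul _ ((Matrix.isUnit_iff_isUnit_det _).1 hu),
            matCLM_one_apply]
      _ ≤ ‖matCLM R⁻¹‖ * ‖matCLM R v‖ := ContinuousLinearMap.le_opNorm _ _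
      _ ≤ _ := by gcongr; linarith
  rw [h1, inv_mul_le_iff₀ (by positivity), ← mul_pow]
  gcongr

theorem Matrix.vecMul_injective_of_rank_eq {m n : ℕ} {A : Matrix (Fin m) (Fin n) ℝ}
    (hA : A.rank = m) : Function.Injective fun v => v ᵥ* A := by
  rw [Matrix.vecMul_injective_iff, linearIndependent_iff_card_eq_finrank_span, Fintype.card_fin]
  exact hA.symm.trans (Matrix.rank_eq_finrank_span_row A)

theorem Matrix.isUnit_of_rank_eq {n : ℕ} {A : Matrix (Fin n) (Fin n) ℝ} (hA : A.rank = n) :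
    IsUnit A :=
  Matrix.vecMul_injective_iff_isUnit.1 (Matrix.vecMul_injective_of_rank_eq hA)

theorem posDef_mul_mul_transpose {m n : ℕ} {A : Matrix (Fin m) (Fin n) ℝ}
    {V : Matrix (Fin n) (Fin n) ℝ} (hA : A.rank = m) (hV : V.PosDef) : (A * V * Aᵀ).PosDef := by
  have := hV.mul_mul_conjTranspose_same (Matrix.vecMul_injective_of_rank_eq hA)
  rwa [Matrix.conjTranspose_eq_transpose_of_trivial] at this

/-- The operators of the limit problem, with the drift `B G f` rotated to a prescribed vector. -/
theorem exists_isLimitData {p q : ℕ} {S G : Matrix (Fin p) (Fin p) ℝ} {C : Matrix (Fin q) (Fin p) ℝ}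
    (hS : S.PosDef) (hG : G.rank = p) (hC : C.rank = q) (f : EuclideanSpace ℝ (Fin p))
    {V : Matrix (Fin p) (Fin p) ℝ} {Q : Matrix (Fin q) (Fin q) ℝ}
    (hV : V = (Gᵀ * S⁻¹ * G)⁻¹) (hQ : Q = (C * V * Cᵀ)⁻¹) :
    ∃ B, IsLimitData (matCLM S) (matCLM S⁻¹) (matCLM G) (matCLM G⁻¹) (matCLM C) B ∧
      ∀ i, B (matCLM G f) i = -Real.sqrt (f.ofLp ⬝ᵥ (Cᵀ * Q * C) *ᵥ f.ofLp / q) := by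
  have hGu := Matrix.isUnit_of_rank_eq hG
  have hGd := (Matrix.isUnit_iff_isUnit_det _).1 hGu
  have hSd := (Matrix.isUnit_iff_isUnit_det _).1 hS.isUnit
  have hGt : Gᵀ.rank = p := by rw [Matrix.rank_transpose, hG]
  have hVpos : V.PosDef := by
    rw [hV]
    have := posDef_mul_mul_transpose hGt hS.inv
    rw [Matrix.transpose_transpose] at this
    exact this.inv
  have hVS : V = G⁻¹ * S * (G⁻¹)ᵀ := by
    rw [hV, Matrix.mul_inv_rev, Matrix.mul_inv_rev, Matrix.nonsing_inv_nonsing_inv _ hSd,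
      Matrix.transpose_nonsing_inv, Matrix.mul_assoc]
  set M := C * V * Cᵀ with hM
  have hMpos : M.PosDef := posDef_mul_mul_transpose hC hVpos
  obtain ⟨R, hR, hRu⟩ := hMpos.inv.exists_transpose_mul_self
  have hRd := (Matrix.isUnit_iff_isUnit_det _).1 hRu
  set A := R * C * G⁻¹ with hA
  have hASA : A * S * Aᵀ = 1 := by
    have e : A * S * Aᵀ = R * M * Rᵀ := by
      rw [hA, hM, hVS]
      simp only [Matrix.transpose_mul, Matrix.mul_assoc]
    rw [e, mul_eq_one_comm, ← Matrix.mul_assoc, hR]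
    exact Matrix.nonsing_inv_mul _ ((Matrix.isUnit_iff_isUnit_det _).1 hMpos.isUnit)
  have hAG : A * G = R * C := by
    rw [hA, Matrix.mul_assoc, Matrix.nonsing_inv_mul _ hGd, Matrix.mul_one]
  set δ := f.ofLp ⬝ᵥ (Cᵀ * Q * C) *ᵥ f.ofLp with hδ
  set v := matCLM A (matCLM G f) with hv
  have hvδ : ‖v‖ ^ 2 = δ := by
    rw [hv, ← matCLM_mul_apply, hAG, ← real_inner_self_eq_norm_sq,
      ← ContinuousLinearMap.adjoint_inner_right, adjoint_matCLM, ← matCLM_mul_apply, inner_matCLM,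
      hδ, hQ, ← hR, Matrix.transpose_mul]
    simp only [Matrix.mul_assoc]
  set w : EuclideanSpace ℝ (Fin q) := WithLp.toLp 2 fun _ => -Real.sqrt (δ / q) with hw
  have hnorm : ‖v‖ = ‖w‖ := by
    rcases Nat.eq_zero_or_pos q with h0 | h0
    · subst h0
      rw [Subsingleton.elim v w]
    · rw [← sq_eq_sq₀ (norm_nonneg _) (norm_nonneg _), hvδ, EuclideanSpace.norm_sq_eq]
      have hδ0 : 0 ≤ δ := by rw [← hvδ]; positivity
      have hwi : ∀ i, ‖w i‖ ^ 2 = δ / q := fun i => by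
        rw [Real.norm_eq_abs, sq_abs, hw, neg_sq, Real.sq_sqrt (by positivity)]
      simp only [hwi, Finset.sum_const, Finset.card_univ, Fintype.card_fin, nsmul_eq_mul]
      field_simp
  set U := (ℝ ∙ (v - w))ᗮ.reflection with hU
  have hUv : U v = w := Submodule.reflection_sub hnorm
  refine ⟨(U : EuclideanSpace ℝ (Fin q) →L[ℝ] EuclideanSpace ℝ (Fin q)).comp (matCLM A),
    ?_, fun i => ?_⟩
  · refine ⟨fun v w => ?_, hS.exists_mul_norm_sq_le, fun v => ?_, fun v => ?_, fun v => ?_,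
      fun v => ?_, fun u => ?_, fun s => ?_⟩
    · have hSt : Sᵀ = S := by
        rw [← Matrix.conjTranspose_eq_transpose_of_trivial, hS.isHermitian.eq]
      rw [← ContinuousLinearMap.adjoint_inner_right, adjoint_matCLM, hSt]
    · rw [← matCLM_mul_apply, Matrix.nonsing_inv_mul _ hSd, matCLM_one_apply]
    · rw [← matCLM_mul_apply, Matrix.mul_nonsing_inv _ hSd, matCLM_one_apply]
    · rw [← matCLM_mul_apply, Matrix.nonsing_inv_mul _ hGd, matCLM_one_apply]
    · rw [← matCLM_mul_apply, Matrix.mul_nonsing_inv _ hGd, matCLM_one_apply]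
    · have e : matCLM A (matCLM G u) = matCLM R (matCLM C u) := by
        rw [← matCLM_mul_apply, hAG, matCLM_mul_apply]
      simp only [ContinuousLinearMap.comp_apply, e]
      constructor
      · intro h
        simp [h]
      · intro h
        have h1 : matCLM R (matCLM C u) = 0 := U.map_eq_zero_iff.1 h
        rw [← matCLM_one_apply (matCLM C u), ← Matrix.nonsing_inv_mul _ hRd, matCLM_mul_apply, h1,
          map_zero]
    · have hadj := U.adjoint_eq_symm
      rw [ContinuousLinearMap.adjoint_comp, adjoint_matCLM]
      simp only [ContinuousLinearMap.comp_apply]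
      rw [hadj, ← matCLM_mul_apply, ← matCLM_mul_apply, hASA, matCLM_one_apply]
      exact U.apply_symm_apply s
  · change U v i = _
    rw [hUv]

theorem range_matCLM_of_rank_eq {m n : ℕ} {A : Matrix (Fin m) (Fin n) ℝ} (hA : A.rank = m) :
    (matCLM A).range = ⊤ := by
  have hpos := posDef_mul_mul_transpose hA Matrix.PosDef.one
  rw [Matrix.mul_one] at hpos
  have hd := (Matrix.isUnit_iff_isUnit_det _).1 hpos.isUnit
  rw [LinearMap.range_eq_top]
  intro s
  refine ⟨matCLM (Aᵀ * (A * Aᵀ)⁻¹) s, ?_⟩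
  change matCLM A _ = s
  rw [← matCLM_mul_apply, ← Matrix.mul_assoc, Matrix.mul_nonsing_inv _ hd, matCLM_one_apply]

end MatrixOperators

/-! ### Weak convergence -/

section WeakConvergence

theorem charFun_pi_gaussianReal_one {q : ℕ} (a : ℝ) (s : EuclideanSpace ℝ (Fin q)) :
    charFun ((Measure.pi fun _ : Fin q => gaussianReal a 1).map (WithLp.toLp 2)) s =
      Complex.exp ((∑ j, s j * a : ℝ) * Complex.I - (‖s‖ ^ 2 : ℝ) / 2) := by
  rw [charFun_pi]
  simp_rw [charFun_gaussianReal]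
  rw [← Complex.exp_sum, EuclideanSpace.norm_sq_eq]
  congr 1
  push_cast
  rw [Finset.sum_sub_distrib, Finset.sum_mul, Finset.sum_div]
  congr 1
  refine Finset.sum_congr rfl fun j _ => ?_
  rw [← Complex.ofReal_pow ‖s j‖, Real.norm_eq_abs, sq_abs]
  simp

theorem noncentralChiSq_eq_map_norm_sq (q : ℕ) (δ : ℝ) :
    noncentralChiSq q δ = ((Measure.pi fun _ : Fin q => gaussianReal (Real.sqrt (δ / q)) 1).map
      (WithLp.toLp 2)).map fun z : EuclideanSpace ℝ (Fin q) => ‖z‖ ^ 2 := by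
  rw [Measure.map_map (by fun_prop) (by fun_prop), noncentralChiSq]
  congr 1
  ext z
  simp [EuclideanSpace.norm_sq_eq]

variable {E Ω' Ω'' : Type*} [MeasurableSpace E]

theorem MeasureTheory.TendstoInDistribution.of_map_eq {ι : Type*} {Ω : ι → Type*}
    [∀ i, MeasurableSpace (Ω i)] {P : ∀ i, Measure (Ω i)} [∀ i, IsProbabilityMeasure (P i)]
    [MeasurableSpace Ω'] [MeasurableSpace Ω''] {μ' : Measure Ω'} {μ'' : Measure Ω''}
    [IsProbabilityMeasure μ'] [IsProbabilityMeasure μ''] [TopologicalSpace E]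
    [OpensMeasurableSpace E]
    {X : ∀ i, Ω i → E} {l : Filter ι} {Z : Ω' → E} {W : Ω'' → E}
    (h : TendstoInDistribution X l Z P μ') (hW : AEMeasurable W μ'')
    (hZW : μ'.map Z = μ''.map W) : TendstoInDistribution X l W P μ'' where
  forall_aemeasurable := h.forall_aemeasurable
  aemeasurable_limit := hW
  tendsto := by
    have : (⟨μ''.map W, Measure.isProbabilityMeasure_map hW⟩ : ProbabilityMeasure E) =
        ⟨μ'.map Z, Measure.isProbabilityMeasure_map h.aemeasurable_limit⟩ :=
      Subtype.ext hZW.symm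
    rw [this]
    exact h.tendsto

/-- Slutsky's lemma for random variables on varying probability spaces. -/
theorem MeasureTheory.TendstoInDistribution.of_tendsto_measure_sub {Ω : ℕ → Type*}
    [∀ i, MeasurableSpace (Ω i)] {P : ∀ i, Measure (Ω i)} [∀ i, IsProbabilityMeasure (P i)]
    [MeasurableSpace Ω'] {μ' : Measure Ω'} [IsProbabilityMeasure μ']
    {X Y : ∀ i, Ω i → ℝ} {Z : Ω' → ℝ}
    (h : TendstoInDistribution X atTop Z P μ') (hY : ∀ i, AEMeasurable (Y i) (P i))
    (hXY : ∀ ε > 0, Tendsto (fun n => P n {ω | ε ≤ |Y n ω - X n ω|}) atTop (𝓝 0)) :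
    TendstoInDistribution Y atTop Z P μ' := by
  have hmp : ∀ n, MeasurePreserving (Function.eval n) (Measure.infinitePi P) (P n) := fun n =>
    measurePreserving_eval_infinitePi P n
  have hmap : ∀ (W : ∀ i, Ω i → ℝ), (∀ i, AEMeasurable (W i) (P i)) → ∀ n,
      (Measure.infinitePi P).map (fun ω => W n (ω n)) = (P n).map (W n) := by
    intro W hW n
    have hWn := hW n
    rw [← (hmp n).map_eq] at hWn ⊢
    exact (AEMeasurable.map_map_of_aemeasurable hWn (hmp n).measurable.aemeasurable).symm
  have haem : ∀ (W : ∀ i, Ω i → ℝ), (∀ i, AEMeasurable (W i) (P i)) → ∀ n,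
      AEMeasurable (fun ω : ∀ i, Ω i => W n (ω n)) (Measure.infinitePi P) :=
    fun W hW n => (hW n).comp_quasiMeasurePreserving (hmp n).quasiMeasurePreserving
  have hX := h.forall_aemeasurable
  have h1 : TendstoInDistribution (fun n (ω : ∀ i, Ω i) => X n (ω n)) atTop Z
      (fun _ => Measure.infinitePi P) μ' :=
    { forall_aemeasurable := haem X hX
      aemeasurable_limit := h.aemeasurable_limit
      tendsto := by
        refine h.tendsto.congr fun n => Subtype.ext ?_
        exact (hmap X hX n).symm }
  have h2 := tendstoInDistribution_of_tendstoInMeasure_sub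
    (fun n (ω : ∀ i, Ω i) => Y n (ω n)) Z h1 ?_ (haem Y hY)
  · exact
      { forall_aemeasurable := hY
        aemeasurable_limit := h.aemeasurable_limit
        tendsto := by
          refine h2.tendsto.congr fun n => Subtype.ext ?_
          exact hmap Y hY n }
  · rw [tendstoInMeasure_iff_norm]
    intro ε hε
    refine (hXY ε hε).congr fun n => ?_
    have hs : NullMeasurableSet {ω | ε ≤ |Y n ω - X n ω|} (P n) :=
      nullMeasurableSet_le aemeasurable_const ((hY n).sub (hX n)).abs
    rw [← (hmp n).measure_preimage hs]
    simp [Set.preimage]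

end WeakConvergence

/-! ### Moments of the estimating function under the local alternatives -/

section Envelopes

variable {k p : ℕ}
  {g : EuclideanSpace ℝ (Fin k) → EuclideanSpace ℝ (Fin p) → EuclideanSpace ℝ (Fin p)}
  {θ₀ : EuclideanSpace ℝ (Fin p)} {F : ℕ → Measure (EuclideanSpace ℝ (Fin k))}
  {F₀ : Measure (EuclideanSpace ℝ (Fin k))}

theorem ELRegular.exists_envelope (hg : ELRegular g F F₀ θ₀) :
    ∃ K r, IsEnvelope g θ₀ K r ∧ IsIntegrableEnvelope F F₀ K := by
  obtain ⟨K₁, hm₁, hi₁, he₁, ht₁, hb₁⟩ := hg.dominated_g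
  obtain ⟨K₂, hm₂, hi₂, he₂, ht₂, hb₂⟩ := hg.dominated_deriv
  obtain ⟨K₃, hm₃, hi₃, he₃, ht₃, hb₃⟩ := hg.dominated_deriv_deriv
  have h₁ : ∀ x, 0 ≤ K₁ x := fun x => le_trans (by positivity) (hb₁.self_of_nhds x)
  have h₂ : ∀ x, 0 ≤ K₂ x := fun x => le_trans (norm_nonneg _) (hb₂.self_of_nhds x)
  have h₃ : ∀ x, 0 ≤ K₃ x := fun x =>
    (norm_nonneg (fderiv ℝ (fderiv ℝ (g x)) θ₀)).trans (hb₃.self_of_nhds x)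
  obtain ⟨r, hr, hball⟩ := Metric.eventually_nhds_iff_ball.1
    (hg.contDiffAt.and (hb₁.and (hb₂.and hb₃)))
  refine ⟨fun x => K₁ x + K₂ x + K₃ x, r, ⟨hr, fun θ hθ => (hball θ hθ).1, fun θ hθ x => ?_,
    fun θ hθ x => ?_, fun θ hθ x => ?_⟩, ⟨(hm₁.add hm₂).add hm₃, fun x => ?_,
    (hi₁.add hi₂).add hi₃, ?_, ?_⟩⟩
  · linarith [(hball θ hθ).2.1 x, h₂ x, h₃ x]
  · linarith [(hball θ hθ).2.2.1 x, h₁ x, h₃ x]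
  · linarith [(hball θ hθ).2.2.2 x, h₁ x, h₂ x]
  · linarith [h₁ x, h₂ x, h₃ x]
  · filter_upwards [he₁, he₂, he₃] with n e₁ e₂ e₃ using (e₁.add e₂).add e₃
  · have e : ∀ μ : Measure (EuclideanSpace ℝ (Fin k)), Integrable K₁ μ → Integrable K₂ μ →
        Integrable K₃ μ →
        ∫ x, K₁ x + K₂ x + K₃ x ∂μ = ∫ x, K₁ x ∂μ + ∫ x, K₂ x ∂μ + ∫ x, K₃ x ∂μ := by
      intro μ e₁ e₂ e₃
      have e₁₂ : Integrable (fun x => K₁ x + K₂ x) μ := e₁.add e₂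
      rw [integral_add e₁₂ e₃, integral_add e₁ e₂]
    rw [e F₀ hi₁ hi₂ hi₃]
    refine ((ht₁.add ht₂).add ht₃).congr' ?_
    filter_upwards [he₁, he₂, he₃] with n e₁ e₂ e₃ using (e _ e₁ e₂ e₃).symm

theorem IsIntegrableEnvelope.const_mul_one_add {𝓧 : Type*} [MeasurableSpace 𝓧]
    {F : ℕ → Measure 𝓧} [∀ n, IsProbabilityMeasure (F n)] {F₀ : Measure 𝓧}
    [IsProbabilityMeasure F₀] {K : 𝓧 → ℝ} (hK : IsIntegrableEnvelope F F₀ K)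
    {c : ℝ} (hc : 0 ≤ c) : IsIntegrableEnvelope F F₀ fun x => c * (1 + K x) where
  measurable := (measurable_const.add hK.measurable).const_mul c
  nonneg x := mul_nonneg hc (by linarith [hK.nonneg x])
  integrable_limit := ((integrable_const _).add hK.integrable_limit).const_mul c
  integrable := by
    filter_upwards [hK.integrable] with n hn using ((integrable_const _).add hn).const_mul c
  tendsto := by
    have e : ∀ (μ : Measure 𝓧) [IsProbabilityMeasure μ], Integrable K μ →
        ∫ x, c * (1 + K x) ∂μ = c * (1 + ∫ x, K x ∂μ) := by
      intro μ _ h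
      rw [integral_const_mul, integral_add (integrable_const _) h]
      simp
    rw [e F₀ hK.integrable_limit]
    refine ((hK.tendsto.const_add 1).const_mul c).congr' ?_
    filter_upwards [hK.integrable] with n hn using (e _ hn).symm

end Envelopes

namespace IsEnvelope

variable {k p : ℕ}
  {g : EuclideanSpace ℝ (Fin k) → EuclideanSpace ℝ (Fin p) → EuclideanSpace ℝ (Fin p)}
  {θ₀ θ : EuclideanSpace ℝ (Fin p)} {K : EuclideanSpace ℝ (Fin k) → ℝ} {r : ℝ}
  {F : ℕ → Measure (EuclideanSpace ℝ (Fin k))}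
  {F₀ : Measure (EuclideanSpace ℝ (Fin k))}

theorem norm_le_one_add (hK : IsEnvelope g θ₀ K r) (hθ : θ ∈ Metric.ball θ₀ r)
    (x : EuclideanSpace ℝ (Fin k)) : ‖g x θ‖ ≤ 1 + K x := by
  have h := hK.cube_le θ hθ x
  set a := ‖g x θ‖
  have ha : 0 ≤ a := norm_nonneg _
  nlinarith [mul_nonneg ha (sq_nonneg (a - 1)), sq_nonneg (a - 1)]

theorem norm_sq_le_one_add (hK : IsEnvelope g θ₀ K r) (hθ : θ ∈ Metric.ball θ₀ r)
    (x : EuclideanSpace ℝ (Fin k)) : ‖g x θ‖ ^ 2 ≤ 1 + K x := by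
  have h := hK.cube_le θ hθ x
  set a := ‖g x θ‖
  have ha : 0 ≤ a := norm_nonneg _
  nlinarith [mul_nonneg ha (sq_nonneg (a - 1)), sq_nonneg (a - 1)]

theorem measurable_fderiv_apply (hK : IsEnvelope g θ₀ K r) (hgm : ∀ θ, Measurable fun x => g x θ)
    (v : EuclideanSpace ℝ (Fin p)) : Measurable fun x => fderiv ℝ (g x) θ₀ v := by
  refine measurable_of_tendsto_metrizable
    (f := fun (m : ℕ) x => (m : ℝ) • (g x (θ₀ + (m : ℝ)⁻¹ • v) - g x θ₀))
    (fun m => ((hgm _).sub (hgm _)).const_smul (m : ℝ)) ?_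
  rw [tendsto_pi_nhds]
  intro x
  have hd := (hK.contDiffAt θ₀ hK.self_mem x).differentiableAt (by norm_num)
  refine hd.hasFDerivAt.lim v (c := fun m : ℕ => (m : ℝ)) ?_
  simpa using tendsto_natCast_atTop_atTop (R := ℝ)

theorem integrable_mul_apply (hK : IsEnvelope g θ₀ K r) (hgm : ∀ θ, Measurable fun x => g x θ)
    {μ : Measure (EuclideanSpace ℝ (Fin k))} [IsProbabilityMeasure μ] (hi : Integrable K μ)
    (i j : Fin p) : Integrable (fun x => g x θ₀ i * g x θ₀ j) μ := by
  have hm : ∀ i, Measurable fun x => g x θ₀ i := fun i =>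
    (EuclideanSpace.proj (𝕜 := ℝ) i).continuous.measurable.comp (hgm θ₀)
  refine ((integrable_const 1).add hi).mono' ((hm i).mul (hm j)).aestronglyMeasurable
    (.of_forall fun x => ?_)
  rw [norm_mul]
  calc _ ≤ ‖g x θ₀‖ * ‖g x θ₀‖ := by
        gcongr
        · exact PiLp.norm_apply_le _ i
        · exact PiLp.norm_apply_le _ j
    _ ≤ _ := by
        rw [← sq]
        exact hK.norm_sq_le_one_add hK.self_mem x

theorem integral_inner_sq (hK : IsEnvelope g θ₀ K r) (hgm : ∀ θ, Measurable fun x => g x θ)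
    [IsProbabilityMeasure F₀] (hi : Integrable K F₀) (s : EuclideanSpace ℝ (Fin p)) :
    ∫ x, inner ℝ s (g x θ₀) ^ 2 ∂F₀ = inner ℝ s (matCLM (matS11 g F₀ θ₀) s) := by
  have e1 : ∀ x, inner ℝ s (g x θ₀) ^ 2 = ∑ i, ∑ j, s i * s j * (g x θ₀ i * g x θ₀ j) := by
    intro x
    rw [sq, PiLp.inner_apply, Finset.sum_mul_sum]
    refine Finset.sum_congr rfl fun i _ => Finset.sum_congr rfl fun j _ => ?_
    simp
    ring
  simp_rw [e1]
  rw [integral_finsetSum _ fun i _ => integrable_finsetSum _ fun j _ =>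
    (hK.integrable_mul_apply hgm hi i j).const_mul _, PiLp.inner_apply]
  refine Finset.sum_congr rfl fun i _ => ?_
  rw [integral_finsetSum _ fun j _ => (hK.integrable_mul_apply hgm hi i j).const_mul _,
    clm_apply_eq_sum, inner_sum]
  refine Finset.sum_congr rfl fun j _ => ?_
  rw [integral_const_mul, matCLM_single]
  simp [matS11]
  ring

theorem integral_inner_fderiv (hK : IsEnvelope g θ₀ K r) (hgm : ∀ θ, Measurable fun x => g x θ)
    (hi : Integrable K F₀) (s f : EuclideanSpace ℝ (Fin p)) :
    ∫ x, inner ℝ s (fderiv ℝ (g x) θ₀ f) ∂F₀ = inner ℝ s (matCLM (matS12 g F₀ θ₀) f) := by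
  have hint : ∀ i j, Integrable (fun x => fderiv ℝ (g x) θ₀ (EuclideanSpace.single j 1) i) F₀ := by
    intro i j
    refine hi.mono' ((EuclideanSpace.proj (𝕜 := ℝ) i).continuous.measurable.comp
      (hK.measurable_fderiv_apply hgm _)).aestronglyMeasurable (.of_forall fun x => ?_)
    refine (PiLp.norm_apply_le _ i).trans ((ContinuousLinearMap.le_opNorm _ _).trans ?_)
    simpa using hK.deriv_le θ₀ hK.self_mem x
  have e1 : ∀ x, inner ℝ s (fderiv ℝ (g x) θ₀ f) =
      ∑ i, ∑ j, s i * f j * fderiv ℝ (g x) θ₀ (EuclideanSpace.single j 1) i := by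
    intro x
    rw [PiLp.inner_apply]
    refine Finset.sum_congr rfl fun i _ => ?_
    rw [clm_apply_eq_sum, inner_sum]
    refine Finset.sum_congr rfl fun j _ => ?_
    simp
    ring
  simp_rw [e1]
  rw [integral_finsetSum _ fun i _ => integrable_finsetSum _ fun j _ =>
    (hint i j).const_mul _, PiLp.inner_apply]
  refine Finset.sum_congr rfl fun i _ => ?_
  rw [integral_finsetSum _ fun j _ => (hint i j).const_mul _, clm_apply_eq_sum, inner_sum]
  refine Finset.sum_congr rfl fun j _ => ?_
  rw [integral_const_mul, matCLM_single]
  simp [matS12, jacobian]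
  ring

variable [∀ n, IsProbabilityMeasure (F n)] [IsProbabilityMeasure F₀]

theorem tendsto_integral_inner_sq (hK : IsEnvelope g θ₀ K r) (hI : IsIntegrableEnvelope F F₀ K)
    (hgm : ∀ θ, Measurable fun x => g x θ)
    (hF : ∀ A, MeasurableSet A → Tendsto (fun n => F n A) atTop (𝓝 (F₀ A)))
    (s : EuclideanSpace ℝ (Fin p)) :
    Tendsto (fun n => ∫ x, inner ℝ s (g x θ₀) ^ 2 ∂(F n)) atTop
      (𝓝 (inner ℝ s (matCLM (matS11 g F₀ θ₀) s))) := by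
  rw [← hK.integral_inner_sq hgm hI.integrable_limit]
  have hm := hgm θ₀
  refine (hI.const_mul_one_add (sq_nonneg ‖s‖)).tendsto_integral hF (by fun_prop) fun x => ?_
  rw [abs_of_nonneg (sq_nonneg _), ← sq_abs]
  calc _ ≤ (‖s‖ * ‖g x θ₀‖) ^ 2 := by
        gcongr
        exact abs_real_inner_le_norm _ _
    _ = ‖s‖ ^ 2 * ‖g x θ₀‖ ^ 2 := mul_pow _ _ _
    _ ≤ _ := by
        gcongr
        exact hK.norm_sq_le_one_add hK.self_mem x

theorem tendsto_sqrt_mul_integral_inner (hK : IsEnvelope g θ₀ K r)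
    (hI : IsIntegrableEnvelope F F₀ K) (hgm : ∀ θ, Measurable fun x => g x θ)
    (hF : ∀ A, MeasurableSet A → Tendsto (fun n => F n A) atTop (𝓝 (F₀ A)))
    {f : EuclideanSpace ℝ (Fin p)}
    (hFn : ∀ n : ℕ, 0 < n → ∫ x, g x (θ₀ + (Real.sqrt n)⁻¹ • f) ∂(F n) = 0)
    (s : EuclideanSpace ℝ (Fin p)) :
    Tendsto (fun n : ℕ => Real.sqrt n * ∫ x, inner ℝ s (g x θ₀) ∂(F n)) atTop
      (𝓝 (-inner ℝ s (matCLM (matS12 g F₀ θ₀) f))) := by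
  have hm1 : Measurable fun x => inner ℝ s (fderiv ℝ (g x) θ₀ f) := by
    have := hK.measurable_fderiv_apply hgm f
    fun_prop
  have hb1 : ∀ x, |inner ℝ s (fderiv ℝ (g x) θ₀ f)| ≤ ‖s‖ * ‖f‖ * (1 + K x) := fun x => by
    calc _ ≤ ‖s‖ * (‖fderiv ℝ (g x) θ₀‖ * ‖f‖) :=
          (abs_real_inner_le_norm _ _).trans (by
            gcongr
            exact ContinuousLinearMap.le_opNorm _ _)
      _ ≤ ‖s‖ * ((1 + K x) * ‖f‖) := by
          gcongr
          linarith [hK.deriv_le θ₀ hK.self_mem x]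
      _ = _ := by ring
  have hI1 := hI.const_mul_one_add (mul_nonneg (norm_nonneg s) (norm_nonneg f))
  have h1 := hI1.tendsto_integral hF hm1 hb1
  rw [hK.integral_inner_fderiv hgm hI.integrable_limit] at h1
  have hinv := tendsto_inv_sqrt_natCast tendsto_id
  have hball : ∀ᶠ n : ℕ in atTop, θ₀ + (Real.sqrt n)⁻¹ • f ∈ Metric.ball θ₀ r := by
    have h2 : Tendsto (fun n : ℕ => θ₀ + (Real.sqrt n)⁻¹ • f) atTop (𝓝 θ₀) := by
      simpa using (hinv.smul_const f).const_add θ₀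
    exact h2 (Metric.ball_mem_nhds θ₀ hK.pos)
  have hrem : Tendsto (fun n : ℕ => Real.sqrt n * ∫ x, inner ℝ s (g x θ₀) ∂(F n) +
      ∫ x, inner ℝ s (fderiv ℝ (g x) θ₀ f) ∂(F n)) atTop (𝓝 0) := by
    have h3 : Tendsto (fun n : ℕ => (Real.sqrt n)⁻¹ * (‖s‖ * ‖f‖ ^ 2 * ∫ x, K x ∂(F n))) atTop
        (𝓝 0) := by
      simpa using hinv.mul (hI.tendsto.const_mul (‖s‖ * ‖f‖ ^ 2))
    refine squeeze_zero_norm' ?_ h3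
    filter_upwards [hball, hI.integrable, hI1.integrable, eventually_gt_atTop 0]
      with n hn hi hi1 hn0
    have hs : 0 < Real.sqrt n := by positivity
    set θn := θ₀ + (Real.sqrt n)⁻¹ • f with hθn
    have hgi : ∀ θ ∈ Metric.ball θ₀ r, Integrable (fun x => g x θ) (F n) := fun θ hθ =>
      ((integrable_const 1).add hi).mono' (hgm θ).aestronglyMeasurable
        (.of_forall fun x => hK.norm_le_one_add hθ x)
    have hsub : θn - θ₀ = (Real.sqrt n)⁻¹ • f := by rw [hθn]; abel
    have hiθ₀ := (hgi θ₀ hK.self_mem).const_inner (𝕜 := ℝ) s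
    have hiθn := (hgi θn hn).const_inner (𝕜 := ℝ) s
    have hiD : Integrable (fun x => inner ℝ s (fderiv ℝ (g x) θ₀ f)) (F n) :=
      hi1.mono' hm1.aestronglyMeasurable (.of_forall hb1)
    have hzero : ∫ x, inner ℝ s (g x θn) ∂(F n) = 0 := by
      rw [integral_inner (hgi θn hn), hFn n hn0, inner_zero_right]
    have e : Real.sqrt n * ∫ x, inner ℝ s (g x θ₀) ∂(F n) +
        ∫ x, inner ℝ s (fderiv ℝ (g x) θ₀ f) ∂(F n) =
        ∫ x, -(Real.sqrt n * inner ℝ s (g x θn - g x θ₀ - fderiv ℝ (g x) θ₀ (θn - θ₀))) ∂(F n) := by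
      have e2 : ∀ x, -(Real.sqrt n *
          inner ℝ s (g x θn - g x θ₀ - fderiv ℝ (g x) θ₀ (θn - θ₀))) =
          Real.sqrt n * inner ℝ s (g x θ₀) + inner ℝ s (fderiv ℝ (g x) θ₀ f) -
            Real.sqrt n * inner ℝ s (g x θn) := by
        intro x
        rw [hsub, map_smul, inner_sub_right, inner_sub_right, inner_smul_right]
        field_simp
        ring
      simp_rw [e2]
      have hi4 : Integrable (fun x => Real.sqrt n * inner ℝ s (g x θ₀) +
          inner ℝ s (fderiv ℝ (g x) θ₀ f)) (F n) := (hiθ₀.const_mul _).add hiD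
      rw [integral_sub hi4 (hiθn.const_mul _), integral_add (hiθ₀.const_mul _) hiD,
        integral_const_mul, integral_const_mul, hzero, mul_zero, sub_zero]
    rw [e]
    calc _ ≤ ∫ x, (Real.sqrt n)⁻¹ * (‖s‖ * ‖f‖ ^ 2 * K x) ∂(F n) := by
          refine norm_integral_le_of_norm_le ((hi.const_mul _).const_mul _) (.of_forall fun x => ?_)
          rw [norm_neg, norm_mul, Real.norm_of_nonneg hs.le]
          calc _ ≤ Real.sqrt n * (‖s‖ * (K x * ‖θn - θ₀‖ ^ 2)) := by
                gcongr
                refine (norm_inner_le_norm _ _).trans ?_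
                gcongr
                exact hK.norm_taylor_le hn x
            _ = _ := by
                rw [hsub, norm_smul, norm_inv, Real.norm_of_nonneg hs.le]
                field_simp
      _ = _ := by rw [integral_const_mul, integral_const_mul]
  refine (hrem.sub h1).congr (fun n => by ring) |>.trans (by rw [zero_sub])

end IsEnvelope

/-! ### The standardized mean of the estimating function -/

section ScoreMean

variable {k p q : ℕ}
  {g : EuclideanSpace ℝ (Fin k) → EuclideanSpace ℝ (Fin p) → EuclideanSpace ℝ (Fin p)}
  {θ₀ f : EuclideanSpace ℝ (Fin p)} {K : EuclideanSpace ℝ (Fin k) → ℝ} {r : ℝ}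
  {F : ℕ → Measure (EuclideanSpace ℝ (Fin k))} {F₀ : Measure (EuclideanSpace ℝ (Fin k))}
  {Ω : ℕ → Type*} [∀ n, MeasurableSpace (Ω n)] {P : ∀ n, Measure (Ω n)}
  {X : ∀ n, Fin n → Ω n → EuclideanSpace ℝ (Fin k)}

theorem inner_scoreMean {n : ℕ} (x : Fin n → EuclideanSpace ℝ (Fin k))
    (s : EuclideanSpace ℝ (Fin p)) :
    inner ℝ (scoreMean g θ₀ x) s = Real.sqrt n * sampleMean fun i => inner ℝ s (g (x i) θ₀) := by
  rw [scoreMean, real_inner_smul_left, real_inner_comm, ← innerSL_apply_apply ℝ s, map_sampleMean]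
  rfl

theorem aemeasurable_scoreMean (hgm : ∀ θ, Measurable fun x => g x θ)
    (hlaw : ∀ n i, HasLaw (X n i) (F n) (P n)) (n : ℕ) :
    AEMeasurable (fun ω => scoreMean g θ₀ fun i => X n i ω) (P n) := by
  have h : ∀ i, AEMeasurable (fun ω => g (X n i ω) θ₀) (P n) := fun i =>
    (hgm θ₀).comp_aemeasurable (hlaw n i).aemeasurable
  simp only [scoreMean, sampleMean]
  exact ((Finset.aemeasurable_fun_sum _ fun i _ => h i).const_smul (n : ℝ)⁻¹).const_smul (Real.sqrt n)

variable [∀ n, IsProbabilityMeasure (F n)] [IsProbabilityMeasure F₀]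

theorem IsEnvelope.tendsto_charFun_scoreMean (hK : IsEnvelope g θ₀ K r)
    (hI : IsIntegrableEnvelope F F₀ K) (hgm : ∀ θ, Measurable fun x => g x θ)
    (hF : ∀ A, MeasurableSet A → Tendsto (fun n => F n A) atTop (𝓝 (F₀ A)))
    (hFn : ∀ n : ℕ, 0 < n → ∫ x, g x (θ₀ + (Real.sqrt n)⁻¹ • f) ∂(F n) = 0)
    (hlaw : ∀ n i, HasLaw (X n i) (F n) (P n)) (hindep : ∀ n, iIndepFun (X n) (P n))
    (s : EuclideanSpace ℝ (Fin p)) :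
    Tendsto (fun n => charFun ((P n).map fun ω => scoreMean g θ₀ fun i => X n i ω) s) atTop
      (𝓝 (Complex.exp ((-inner ℝ s (matCLM (matS12 g F₀ θ₀) f) : ℝ) * Complex.I -
        (inner ℝ s (matCLM (matS11 g F₀ θ₀) s) : ℝ) / 2))) := by
  have hm : Measurable fun x => inner ℝ s (g x θ₀) := by
    have := hgm θ₀
    fun_prop
  have hcube : ∀ x, |inner ℝ s (g x θ₀)| ^ 3 ≤ ‖s‖ ^ 3 * K x := fun x => by
    calc _ ≤ (‖s‖ * ‖g x θ₀‖) ^ 3 := by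
          gcongr
          exact abs_real_inner_le_norm _ _
      _ = ‖s‖ ^ 3 * ‖g x θ₀‖ ^ 3 := mul_pow _ _ _
      _ ≤ _ := by
          gcongr
          exact hK.cube_le θ₀ hK.self_mem x
  have hint : ∀ᶠ n in atTop, Integrable (fun x => |inner ℝ s (g x θ₀)| ^ 3) (F n) := by
    filter_upwards [hI.integrable] with n hn
    refine (hn.const_mul (‖s‖ ^ 3)).mono' (by fun_prop) (.of_forall fun x => ?_)
    rw [Real.norm_of_nonneg (by positivity)]
    exact hcube x
  have hbound : ∀ᶠ n in atTop, ∫ x, |inner ℝ s (g x θ₀)| ^ 3 ∂(F n) ≤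
      ‖s‖ ^ 3 * (∫ x, K x ∂F₀ + 1) := by
    filter_upwards [hint, hI.integrable, hI.tendsto.eventually_lt_const (lt_add_one _)]
      with n h1 h2 h3
    calc _ ≤ ∫ x, ‖s‖ ^ 3 * K x ∂(F n) := integral_mono h1 (h2.const_mul _) hcube
      _ = ‖s‖ ^ 3 * ∫ x, K x ∂(F n) := integral_const_mul _ _
      _ ≤ _ := by gcongr
  refine (tendsto_integral_exp_sqrt_mul_sampleMean hlaw hindep hm
    (hK.tendsto_sqrt_mul_integral_inner hI hgm hF hFn s)
    (hK.tendsto_integral_inner_sq hI hgm hF s) hint hbound).congr fun n => ?_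
  rw [charFun_apply, integral_map (aemeasurable_scoreMean hgm hlaw n) (by fun_prop)]
  simp_rw [inner_scoreMean]

variable [∀ n, IsProbabilityMeasure (P n)]

theorem IsEnvelope.tendsto_measure_lt_norm_scoreMean (hK : IsEnvelope g θ₀ K r)
    (hI : IsIntegrableEnvelope F F₀ K) (hgm : ∀ θ, Measurable fun x => g x θ)
    (hF : ∀ A, MeasurableSet A → Tendsto (fun n => F n A) atTop (𝓝 (F₀ A)))
    (hFn : ∀ n : ℕ, 0 < n → ∫ x, g x (θ₀ + (Real.sqrt n)⁻¹ • f) ∂(F n) = 0)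
    (hlaw : ∀ n i, HasLaw (X n i) (F n) (P n)) (hindep : ∀ n, iIndepFun (X n) (P n)) :
    Tendsto (fun R : ℝ => ⨆ n, P n {ω | R < ‖scoreMean g θ₀ fun i => X n i ω‖}) atTop (𝓝 0) := by
  have hmeas := fun n => aemeasurable_scoreMean (θ₀ := θ₀) hgm hlaw n
  have := fun n => Measure.isProbabilityMeasure_map (hmeas n)
  have ht := isTightMeasureSet_of_tendsto_charFun
    (μ := fun n => (P n).map fun ω => scoreMean g θ₀ fun i => X n i ω)
    (f := fun s => Complex.exp ((-inner ℝ s (matCLM (matS12 g F₀ θ₀) f) : ℝ) * Complex.I -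
        (inner ℝ s (matCLM (matS11 g F₀ θ₀) s) : ℝ) / 2))
    (by fun_prop) (hK.tendsto_charFun_scoreMean hI hgm hF hFn hlaw hindep)
  rw [isTightMeasureSet_iff_tendsto_measure_norm_gt] at ht
  refine ht.congr fun R => ?_
  rw [iSup_range]
  refine iSup_congr fun n => ?_
  rw [Measure.map_apply_of_aemeasurable (hmeas n) (measurableSet_lt measurable_const
    measurable_norm)]
  rfl

theorem IsEnvelope.tendstoInDistribution_norm_sq_scoreMean (hK : IsEnvelope g θ₀ K r)
    (hI : IsIntegrableEnvelope F F₀ K) (hgm : ∀ θ, Measurable fun x => g x θ)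
    (hF : ∀ A, MeasurableSet A → Tendsto (fun n => F n A) atTop (𝓝 (F₀ A)))
    (hFn : ∀ n : ℕ, 0 < n → ∫ x, g x (θ₀ + (Real.sqrt n)⁻¹ • f) ∂(F n) = 0)
    (hlaw : ∀ n i, HasLaw (X n i) (F n) (P n)) (hindep : ∀ n, iIndepFun (X n) (P n))
    {Si G Gi : EuclideanSpace ℝ (Fin p) →L[ℝ] EuclideanSpace ℝ (Fin p)}
    {C B : EuclideanSpace ℝ (Fin p) →L[ℝ] EuclideanSpace ℝ (Fin q)} {δ : ℝ}
    (hL : IsLimitData (matCLM (matS11 g F₀ θ₀)) Si G Gi C B)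
    (hB : ∀ i, B (matCLM (matS12 g F₀ θ₀) f) i = -Real.sqrt (δ / q)) :
    TendstoInDistribution (fun n ω => ‖B (scoreMean g θ₀ fun i => X n i ω)‖ ^ 2) atTop
      (id : ℝ → ℝ) P (noncentralChiSq q δ) := by
  have hmeas := fun n => aemeasurable_scoreMean (θ₀ := θ₀) hgm hlaw n
  have hBm : ∀ n, AEMeasurable (fun ω => B (scoreMean g θ₀ fun i => X n i ω)) (P n) := fun n =>
    B.continuous.measurable.comp_aemeasurable (hmeas n)
  set ν : Measure (EuclideanSpace ℝ (Fin q)) := (Measure.pi fun _ : Fin q => gaussianReal (Real.sqrt (δ / q)) 1).map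
    (WithLp.toLp 2) with hν
  have : IsProbabilityMeasure ν := Measure.isProbabilityMeasure_map (by fun_prop)
  have h1 : TendstoInDistribution (fun n ω => B (scoreMean g θ₀ fun i => X n i ω)) atTop
      (id : EuclideanSpace ℝ (Fin q) → EuclideanSpace ℝ (Fin q)) P ν :=
    { forall_aemeasurable := hBm
      aemeasurable_limit := aemeasurable_id
      tendsto := by
        refine ProbabilityMeasure.tendsto_iff_tendsto_charFun.2 fun s => ?_
        simp only [ProbabilityMeasure.coe_mk, Measure.map_id]
        rw [hν, charFun_pi_gaussianReal_one]
        have h2 := hK.tendsto_charFun_scoreMean hI hgm hF hFn hlaw hindep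
          (ContinuousLinearMap.adjoint B s)
        have e1 : -inner ℝ (ContinuousLinearMap.adjoint B s) (matCLM (matS12 g F₀ θ₀) f) =
            ∑ j, s j * Real.sqrt (δ / q) := by
          rw [ContinuousLinearMap.adjoint_inner_left, PiLp.inner_apply, ← Finset.sum_neg_distrib]
          refine Finset.sum_congr rfl fun j _ => ?_
          simp [hB, mul_comm]
        have e2 : inner ℝ (ContinuousLinearMap.adjoint B s)
            (matCLM (matS11 g F₀ θ₀) (ContinuousLinearMap.adjoint B s)) = ‖s‖ ^ 2 := by
          rw [ContinuousLinearMap.adjoint_inner_left, hL.whiten, real_inner_self_eq_norm_sq]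
        rw [e1, e2] at h2
        refine h2.congr fun n => ?_
        rw [charFun_apply, charFun_apply, integral_map (hmeas n) (by fun_prop),
          integral_map (hBm n) (by fun_prop)]
        simp_rw [ContinuousLinearMap.adjoint_inner_right] }
  refine (h1.continuous_comp (g := fun z => ‖z‖ ^ 2) (by fun_prop)).of_map_eq aemeasurable_id ?_
  rw [Measure.map_id, noncentralChiSq_eq_map_norm_sq]
  rfl

theorem tendsto_measure_le_of_tendsto_integral_zero {Y : ∀ n, Ω n → ℝ}
    (hY : ∀ n ω, 0 ≤ Y n ω) (hi : ∀ᶠ n in atTop, Integrable (Y n) (P n))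
    (h : Tendsto (fun n => ∫ ω, Y n ω ∂(P n)) atTop (𝓝 0)) {ε : ℝ} (hε : 0 < ε) :
    Tendsto (fun n => P n {ω | ε ≤ Y n ω}) atTop (𝓝 0) := by
  have h1 : Tendsto (fun n => ENNReal.ofReal (ε⁻¹ * ∫ ω, Y n ω ∂(P n))) atTop (𝓝 0) := by
    simpa using ENNReal.tendsto_ofReal (h.const_mul ε⁻¹)
  refine tendsto_of_tendsto_of_tendsto_of_le_of_le' tendsto_const_nhds h1
    (.of_forall fun _ => zero_le) ?_
  filter_upwards [hi] with n hn
  rw [← ofReal_measureReal]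
  refine ENNReal.ofReal_le_ofReal ?_
  have := mul_meas_ge_le_integral_of_nonneg (.of_forall (hY n)) hn ε
  rw [inv_mul_eq_div, le_div_iff₀ hε]
  linarith

theorem IsEnvelope.tendsto_measure_le_sampleDeviation (hK : IsEnvelope g θ₀ K r)
    (hI : IsIntegrableEnvelope F F₀ K) (hgm : ∀ θ, Measurable fun x => g x θ)
    (hF : ∀ A, MeasurableSet A → Tendsto (fun n => F n A) atTop (𝓝 (F₀ A)))
    (hlaw : ∀ n i, HasLaw (X n i) (F n) (P n)) (hindep : ∀ n, iIndepFun (X n) (P n))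
    {δ : ℝ} (hδ : 0 < δ) :
    Tendsto (fun n => P n {ω | δ ≤ sampleDeviation g θ₀ K (matCLM (matS11 g F₀ θ₀))
      (matCLM (matS12 g F₀ θ₀)) (∫ x, K x ∂F₀) fun i => X n i ω}) atTop (𝓝 0) := by
  let Dev (h : EuclideanSpace ℝ (Fin k) → ℝ) (n : ℕ) (ω : Ω n) : ℝ :=
    |(sampleMean fun i => h (X n i ω)) - ∫ x, h x ∂F₀|
  let h₁ (i j : Fin p) (x : EuclideanSpace ℝ (Fin k)) : ℝ := g x θ₀ i * g x θ₀ j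
  let h₂ (i j : Fin p) (x : EuclideanSpace ℝ (Fin k)) : ℝ :=
    fderiv ℝ (g x) θ₀ (EuclideanSpace.single j 1) i
  have hI1 := hI.const_mul_one_add zero_le_one
  have hm : ∀ i, Measurable fun x => g x θ₀ i := fun i =>
    (EuclideanSpace.proj (𝕜 := ℝ) i).continuous.measurable.comp (hgm θ₀)
  have hm₁ : ∀ i j, Measurable (h₁ i j) := fun i j => (hm i).mul (hm j)
  have hm₂ : ∀ i j, Measurable (h₂ i j) := fun i j =>
    (EuclideanSpace.proj (𝕜 := ℝ) i).continuous.measurable.comp (hK.measurable_fderiv_apply hgm _)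
  have hb₁ : ∀ i j x, |h₁ i j x| ≤ 1 * (1 + K x) := fun i j x => by
    rw [abs_mul, one_mul]
    calc _ ≤ ‖g x θ₀‖ * ‖g x θ₀‖ := by
          gcongr
          · exact PiLp.norm_apply_le (g x θ₀) i
          · exact PiLp.norm_apply_le (g x θ₀) j
      _ ≤ _ := by
          rw [← sq]
          exact hK.norm_sq_le_one_add hK.self_mem x
  have hb₂ : ∀ i j x, |h₂ i j x| ≤ 1 * (1 + K x) := fun i j x => by
    calc _ ≤ ‖fderiv ℝ (g x) θ₀ (EuclideanSpace.single j 1)‖ :=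
          PiLp.norm_apply_le (fderiv ℝ (g x) θ₀ (EuclideanSpace.single j 1)) i
      _ ≤ ‖fderiv ℝ (g x) θ₀‖ := by
          simpa using (fderiv ℝ (g x) θ₀).le_opNorm (EuclideanSpace.single j 1)
      _ ≤ _ := by linarith [hK.deriv_le θ₀ hK.self_mem x]
  have hb₃ : ∀ x, |K x| ≤ 1 * (1 + K x) := fun x => by
    rw [abs_of_nonneg (hK.nonneg x)]
    linarith
  have hDi : ∀ h : EuclideanSpace ℝ (Fin k) → ℝ, Measurable h → (∀ x, |h x| ≤ 1 * (1 + K x)) →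
      ∀ᶠ n in atTop, Integrable (Dev h n) (P n) := by
    intro h hh hb
    filter_upwards [hI1.integrable] with n hn
    exact ((integrable_sampleMean (hlaw n) (hn.mono' hh.aestronglyMeasurable
      (.of_forall hb))).sub (integrable_const _)).abs
  have hDt : ∀ h : EuclideanSpace ℝ (Fin k) → ℝ, Measurable h → (∀ x, |h x| ≤ 1 * (1 + K x)) →
      Tendsto (fun n => ∫ ω, Dev h n ω ∂(P n)) atTop (𝓝 0) := fun h hh hb =>
    hI1.tendsto_integral_abs_sampleMean_sub hF hlaw hindep hh hb
  have hi₁ : ∀ᶠ n in atTop, ∀ i j, Integrable (Dev (h₁ i j) n) (P n) :=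
    eventually_all.2 fun i => eventually_all.2 fun j => hDi _ (hm₁ i j) (hb₁ i j)
  have hi₂ : ∀ᶠ n in atTop, ∀ i j, Integrable (Dev (h₂ i j) n) (P n) :=
    eventually_all.2 fun i => eventually_all.2 fun j => hDi _ (hm₂ i j) (hb₂ i j)
  have hi₃ := hDi K hI.measurable hb₃
  let Y (n : ℕ) (ω : Ω n) : ℝ :=
    ∑ i, ∑ j, Dev (h₁ i j) n ω + ∑ i, ∑ j, Dev (h₂ i j) n ω + Dev K n ω
  have hDnn : ∀ h n ω, 0 ≤ Dev h n ω := fun _ _ _ => abs_nonneg _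
  have hYnn : ∀ n ω, 0 ≤ Y n ω := fun n ω =>
    add_nonneg (add_nonneg (Finset.sum_nonneg fun i _ => Finset.sum_nonneg fun j _ => hDnn _ _ _)
      (Finset.sum_nonneg fun i _ => Finset.sum_nonneg fun j _ => hDnn _ _ _)) (hDnn _ _ _)
  have hYi : ∀ᶠ n in atTop, Integrable (Y n) (P n) := by
    filter_upwards [hi₁, hi₂, hi₃] with n e₁ e₂ e₃
    exact ((integrable_finsetSum _ fun i _ => integrable_finsetSum _ fun j _ => e₁ i j).add
      (integrable_finsetSum _ fun i _ => integrable_finsetSum _ fun j _ => e₂ i j)).add e₃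
  have hYt : Tendsto (fun n => ∫ ω, Y n ω ∂(P n)) atTop (𝓝 0) := by
    have hlim : Tendsto (fun n => ∑ i, ∑ j, ∫ ω, Dev (h₁ i j) n ω ∂(P n) +
        ∑ i, ∑ j, ∫ ω, Dev (h₂ i j) n ω ∂(P n) + ∫ ω, Dev K n ω ∂(P n)) atTop (𝓝 0) := by
      simpa using ((tendsto_finsetSum Finset.univ fun i _ => tendsto_finsetSum Finset.univ
        fun j _ => hDt _ (hm₁ i j) (hb₁ i j)).add (tendsto_finsetSum Finset.univ fun i _ =>
          tendsto_finsetSum Finset.univ fun j _ => hDt _ (hm₂ i j) (hb₂ i j))).add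
        (hDt K hI.measurable hb₃)
    refine hlim.congr' ?_
    filter_upwards [hi₁, hi₂, hi₃] with n e₁ e₂ e₃
    have s₁ := fun i => integrable_finsetSum Finset.univ fun j _ => e₁ i j
    have s₂ := fun i => integrable_finsetSum Finset.univ fun j _ => e₂ i j
    have t₁ := integrable_finsetSum Finset.univ fun i _ => s₁ i
    have t₂ := integrable_finsetSum Finset.univ fun i _ => s₂ i
    have t : Integrable (fun ω => ∑ i, ∑ j, Dev (h₁ i j) n ω + ∑ i, ∑ j, Dev (h₂ i j) n ω) (P n) :=
      t₁.add t₂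
    simp only [Y]
    rw [integral_add t e₃, integral_add t₁ t₂, integral_finsetSum _ fun i _ => s₁ i,
      integral_finsetSum _ fun i _ => s₂ i]
    simp_rw [fun i => integral_finsetSum Finset.univ fun j _ => e₁ i j,
      fun i => integral_finsetSum Finset.univ fun j _ => e₂ i j]
  refine tendsto_of_tendsto_of_tendsto_of_le_of_le tendsto_const_nhds
    (tendsto_measure_le_of_tendsto_integral_zero hYnn hYi hYt hδ) (fun _ => zero_le)
    fun n => measure_mono fun ω hω => (show δ ≤ _ from hω).trans ?_
  refine add_le_add (add_le_add ?_ ?_) le_rfl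
  · refine (opNorm_le_sum_entries _).trans_eq ?_
    refine Finset.sum_congr rfl fun i _ => Finset.sum_congr rfl fun j _ => ?_
    rw [sub_apply, PiLp.sub_apply, matCLM_single, sampleGram_apply]
    have e := map_sampleMean (EuclideanSpace.proj (𝕜 := ℝ) i : EuclideanSpace ℝ (Fin p) →L[ℝ] ℝ)
      fun l => inner ℝ (g (X n l ω) θ₀) (EuclideanSpace.single j 1) • g (X n l ω) θ₀
    rw [PiLp.proj_apply] at e
    rw [e]
    simp [Dev, h₁, matS11, EuclideanSpace.inner_single_right, mul_comm]
  · refine (opNorm_le_sum_entries _).trans_eq ?_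
    refine Finset.sum_congr rfl fun i _ => Finset.sum_congr rfl fun j _ => ?_
    rw [sub_apply, PiLp.sub_apply, matCLM_single]
    have e := map_sampleMean ((EuclideanSpace.proj (𝕜 := ℝ) i : EuclideanSpace ℝ (Fin p) →L[ℝ] ℝ)
      ∘L ContinuousLinearMap.apply ℝ (EuclideanSpace ℝ (Fin p)) (EuclideanSpace.single j 1))
      fun l => fderiv ℝ (g (X n l ω)) θ₀
    rw [ContinuousLinearMap.comp_apply, PiLp.proj_apply,
      ContinuousLinearMap.apply_apply] at e
    rw [e]
    simp [Dev, h₂, matS12, jacobian]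

end ScoreMean

theorem ConstraintRegular.hasStrictFDerivAt {p q : ℕ}
    {c : EuclideanSpace ℝ (Fin p) → EuclideanSpace ℝ (Fin q)} {θ₀ : EuclideanSpace ℝ (Fin p)}
    (hc : ConstraintRegular c θ₀) : HasStrictFDerivAt c (matCLM (jacobian c θ₀)) θ₀ := by
  rw [← fderiv_eq_matCLM_jacobian]
  exact hasStrictFDerivAt_of_hasFDerivAt_of_continuousAt
    (hc.differentiableAt.mono fun _ h => h.hasFDerivAt)
    hc.differentiableAt_fderiv.self_of_nhds.continuousAt

section Statistic

variable {k p q : ℕ}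
  {g : EuclideanSpace ℝ (Fin k) → EuclideanSpace ℝ (Fin p) → EuclideanSpace ℝ (Fin p)}
  {c : EuclideanSpace ℝ (Fin p) → EuclideanSpace ℝ (Fin q)} {φ : ℝ → ℝ}
  {Θ : Set (EuclideanSpace ℝ (Fin p))} {ρ : ℕ → ℝ}
  {θ₀ f : EuclideanSpace ℝ (Fin p)} {K : EuclideanSpace ℝ (Fin k) → ℝ} {r : ℝ}
  {F : ℕ → Measure (EuclideanSpace ℝ (Fin k))} {F₀ : Measure (EuclideanSpace ℝ (Fin k))}
  [∀ n, IsProbabilityMeasure (F n)] [IsProbabilityMeasure F₀]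
  {Ω : ℕ → Type*} [∀ n, MeasurableSpace (Ω n)] {P : ∀ n, Measure (Ω n)}
  [∀ n, IsProbabilityMeasure (P n)]
  {X : ∀ n, Fin n → Ω n → EuclideanSpace ℝ (Fin k)}
  {θhat θtilde : ∀ n, Ω n → EuclideanSpace ℝ (Fin p)}
  {Si Gi : EuclideanSpace ℝ (Fin p) →L[ℝ] EuclideanSpace ℝ (Fin p)}
  {C B : EuclideanSpace ℝ (Fin p) →L[ℝ] EuclideanSpace ℝ (Fin q)}

/-- Under the local alternatives the statistic is asymptotically equivalent in probability to a
quadratic form in the standardized mean of the estimating function. -/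
theorem IsEnvelope.tendsto_measure_le_elPhiStat_sub (hK : IsEnvelope g θ₀ K r)
    (hI : IsIntegrableEnvelope F F₀ K) (hgm : ∀ θ, Measurable fun x => g x θ)
    (hF : ∀ A, MeasurableSet A → Tendsto (fun n => F n A) atTop (𝓝 (F₀ A)))
    (hFn : ∀ n : ℕ, 0 < n → ∫ x, g x (θ₀ + (Real.sqrt n)⁻¹ • f) ∂(F n) = 0)
    (hlaw : ∀ n i, HasLaw (X n i) (F n) (P n)) (hindep : ∀ n, iIndepFun (X n) (P n))
    (hL : IsLimitData (matCLM (matS11 g F₀ θ₀)) Si (matCLM (matS12 g F₀ θ₀)) Gi C B)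
    (hφ : IsDivGenerator φ) (hc : HasStrictFDerivAt c C θ₀) (hC : C.range = ⊤) (hc0 : c θ₀ = 0)
    (hΘ : Θ ∈ 𝓝 θ₀) (hρ : Tendsto ρ atTop (𝓝 0))
    (hρ' : Tendsto (fun n : ℕ => Real.sqrt n * ρ n) atTop atTop)
    (hhat : Tendsto (fun n => P n {ω | ¬ IsELMaximizer g (fun i => X n i ω)
      (Θ ∩ Metric.closedBall θ₀ (ρ n)) (θhat n ω)}) atTop (𝓝 0))
    (htilde : Tendsto (fun n => P n {ω | ¬ IsELMaximizer g (fun i => X n i ω)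
      (Θ ∩ Metric.closedBall θ₀ (ρ n) ∩ {θ | c θ = 0}) (θtilde n ω)}) atTop (𝓝 0))
    {ε : ℝ} (hε : 0 < ε) :
    Tendsto (fun n => P n {ω | ε ≤ |elPhiStat φ g (fun i => X n i ω) (θhat n ω) (θtilde n ω) -
      ‖B (scoreMean g θ₀ fun i => X n i ω)‖ ^ 2|}) atTop (𝓝 0) := by
  rw [ENNReal.tendsto_nhds_zero]
  intro η hη
  have hη2 : 0 < η / 2 := ENNReal.half_pos hη.ne'
  obtain ⟨R, hR⟩ := ((ENNReal.tendsto_nhds_zero.1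
    (hK.tendsto_measure_lt_norm_scoreMean hI hgm hF hFn hlaw hindep)) _ hη2).exists
  obtain ⟨δ, hδ, N, hN⟩ := exists_forall_abs_elPhiStat_sub_lt (κ := ∫ x, K x ∂F₀) hK hL hφ hc hC
    hc0 hΘ hρ hρ' hε R
  have hrest := ((hK.tendsto_measure_le_sampleDeviation hI hgm hF hlaw hindep hδ).add hhat).add
    htilde
  simp only [add_zero] at hrest
  filter_upwards [ENNReal.tendsto_nhds_zero.1 hrest _ hη2, eventually_ge_atTop N] with n h1 hn
  have hsub : {ω | ε ≤ |elPhiStat φ g (fun i => X n i ω) (θhat n ω) (θtilde n ω) -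
      ‖B (scoreMean g θ₀ fun i => X n i ω)‖ ^ 2|} ⊆
      {ω | R < ‖scoreMean g θ₀ fun i => X n i ω‖} ∪
      (({ω | δ ≤ sampleDeviation g θ₀ K (matCLM (matS11 g F₀ θ₀))
        (matCLM (matS12 g F₀ θ₀)) (∫ x, K x ∂F₀) fun i => X n i ω} ∪
        {ω | ¬ IsELMaximizer g (fun i => X n i ω)
          (Θ ∩ Metric.closedBall θ₀ (ρ n)) (θhat n ω)}) ∪
        {ω | ¬ IsELMaximizer g (fun i => X n i ω)
          (Θ ∩ Metric.closedBall θ₀ (ρ n) ∩ {θ | c θ = 0}) (θtilde n ω)}) := by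
    intro ω hω
    by_contra hcon
    simp only [Set.mem_union, Set.mem_ofPred_eq, not_or, not_lt, not_le, not_not] at hcon
    exact absurd (hN n hn _ hcon.2.1.1 hcon.1 _ _ hcon.2.1.2 hcon.2.2) (not_lt.2 hω)
  calc _ ≤ _ := measure_mono hsub
    _ ≤ _ := measure_union_le _ _
    _ ≤ η / 2 + η / 2 := by
        refine add_le_add ((le_iSup (fun n => P n {ω | R < ‖scoreMean g θ₀ fun i => X n i ω‖})
          n).trans hR) ((measure_union_le _ _).trans ?_)
        exact (add_le_add (measure_union_le _ _) le_rfl).trans h1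
    _ = η := ENNReal.add_halves η

end Statistic

end
theorem theorem7 {k p q : ℕ}
    -- estimating function (as many components as parameters), constraint, divergence generator
    (g : EuclideanSpace ℝ (Fin k) → EuclideanSpace ℝ (Fin p) → EuclideanSpace ℝ (Fin p))
    (c : EuclideanSpace ℝ (Fin p) → EuclideanSpace ℝ (Fin q))
    (φ : ℝ → ℝ) (hφ : IsDivGenerator φ)
    -- parameter space, null parameter, direction of the alternatives
    (Θ : Set (EuclideanSpace ℝ (Fin p))) (θ₀ f : EuclideanSpace ℝ (Fin p)) (hΘ : Θ ∈ 𝓝 θ₀)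
    -- law of an observation under the null parameter, and in the `n`-th sample
    (F₀ : Measure (EuclideanSpace ℝ (Fin k))) [IsProbabilityMeasure F₀]
    (F : ℕ → Measure (EuclideanSpace ℝ (Fin k))) [∀ n, IsProbabilityMeasure (F n)]
    (hg : ELRegular g F F₀ θ₀) (hc : ConstraintRegular c θ₀)
    -- the alternatives: `F n` has the parameter `θ₀ + n^(-1/2) f`, and `F n → F₀` setwise
    (hFn : ∀ n : ℕ, 0 < n → ∫ x, g x (θ₀ + (Real.sqrt n)⁻¹ • f) ∂(F n) = 0)
    (hF : ∀ A, MeasurableSet A → Tendsto (fun n => F n A) atTop (𝓝 (F₀ A)))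
    -- the `n`-th sample is i.i.d. with law `F n`
    {Ω : ℕ → Type*} [∀ n, MeasurableSpace (Ω n)] (P : ∀ n, Measure (Ω n))
    [∀ n, IsProbabilityMeasure (P n)]
    (X : ∀ n, Fin n → Ω n → EuclideanSpace ℝ (Fin k))
    (hlaw : ∀ n i, HasLaw (X n i) (F n) (P n)) (hindep : ∀ n, iIndepFun (X n) (P n))
    -- the estimators: with probability tending to one, maximizers near `θ₀` of the empirical
    -- likelihood, without and with the constraint
    (ρ : ℕ → ℝ) (hρ : Tendsto ρ atTop (𝓝 0))
    (hρ' : Tendsto (fun n : ℕ => Real.sqrt n * ρ n) atTop atTop)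
    (θhat θtilde : ∀ n, Ω n → EuclideanSpace ℝ (Fin p))
    (hhat_meas : ∀ n, Measurable (θhat n)) (htilde_meas : ∀ n, Measurable (θtilde n))
    (hhat : Tendsto (fun n => P n {ω | ¬ IsELMaximizer g (fun i => X n i ω)
      (Θ ∩ Metric.closedBall θ₀ (ρ n)) (θhat n ω)}) atTop (𝓝 0))
    (htilde : Tendsto (fun n => P n {ω | ¬ IsELMaximizer g (fun i => X n i ω)
      (Θ ∩ Metric.closedBall θ₀ (ρ n) ∩ {θ | c θ = 0}) (θtilde n ω)}) atTop (𝓝 0))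
    -- the statistic is a random variable
    (hT : ∀ n, AEMeasurable
      (fun ω => elPhiStat φ g (fun i => X n i ω) (θhat n ω) (θtilde n ω)) (P n)) :
    TendstoInDistribution
      (fun n ω => elPhiStat φ g (fun i => X n i ω) (θhat n ω) (θtilde n ω)) atTop
      (id : ℝ → ℝ) P
      (noncentralChiSq q
        (f ⬝ᵥ ((jacobian c θ₀).transpose * matQ g c F₀ θ₀ * jacobian c θ₀).mulVec f)) := by

  obtain ⟨K, r, hK, hI⟩ := hg.exists_envelope
  obtain ⟨B, hL, hB⟩ := exists_isLimitData (V := matV g F₀ θ₀) (Q := matQ g c F₀ θ₀)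
    hg.posDef hg.rank_eq hc.rank_eq f rfl rfl
  exact (hK.tendstoInDistribution_norm_sq_scoreMean hI hg.measurable hF hFn hlaw hindep hL
    hB).of_tendsto_measure_sub hT fun ε hε => hK.tendsto_measure_le_elPhiStat_sub hI hg.measurable
      hF hFn hlaw hindep hL hφ hc.hasStrictFDerivAt (range_matCLM_of_rank_eq hc.rank_eq)
      hc.map_eq_zero hΘ hρ hρ' hhat htilde hε
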